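/- Let $n\in\mathbb N$, let $\mathbb{R}_n$ be the real Clifford algebra generated by $\mathbf e_1,\dots,\mathbf e_n$ with $\mathbf e_r\mathbf e_s+\mathbf e_s\mathbf e_r=-2\delta_{rs}$, with the Euclidean norm $|\sum_A a_A\mathbf e_A|=(\sum_A a_A^2)^{1/2}$. Identify $\mathbb R^{n+1}$ with the paravectors $x_0+x_1\mathbf e_1+\dots+x_n\mathbf e_n$, let $\mathbb S=\{x_1\mathbf e_1+\dots+x_n\mathbf e_n:\ x_1^2+\dots+x_n^2=1\}$ be the sphere of imaginary units, and let $\mathbb R^{n+1}_+=\{x_0>0\}$. A function $f:\mathbb R^{n+1}_+\to\mathbb R_n$ is left slice monogenic if it is real differentiable and $\tfrac12\left(\partial_u+I\partial_v\right)f(u+Iv)=0$ for all $I\in\mathbb S$, $u>0$, $v\in\mathbb R$. For $1\le p\le 2$ let $H^p_{\mathrm{slice}}(\mathbb R^{n+1}_+)$ be the space of left slice monogenic $f$ with $$\sup_{I\in\mathbb S}\ \sup_{u>0}\int_{\mathbb R}|f(u+Iv)|^p\,dv<\infty .$$ For $J\in\mathbb S$ the one-dimensional left-sided Clifford Fourier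 transform is $$\mathscr F_J(g)(w)=\frac1{\sqrt{2\pi}}\int_{\mathbb R}e^{-Jtw}g(t)\,dt,\qquad g\in L^1(\mathbb R;\mathbb R_n),$$ extended to $L^2$ as the $L^2$-limit, as $T\to\infty$, of the transforms of the truncations $g\,\mathbf 1_{[-T,T]}$, and to $L^1+L^2\supset L^p$ $(1\le p\le2)$ by additivity. **Theorem.** Let $1\le p\le 2$ and $f\in H^p_{\mathrm{slice}}(\mathbb R^{n+1}_+)$. Then for every $J\in\mathbb S$ the non-tangential boundary limit $f|_{J\mathbb R}(v)$ of $f$ at $Jv$ (the limit of $f(x+Jy)$ as $x+Jy\to Jv$ inside every cone $|y-v|<\alpha x$, $\alpha>0$) exists for almost every $v\in\mathbb R$ and defines an element of $L^p(\mathbb R;\mathbb R_n)$; its transform satisfies $$\operatorname{supp}\mathscr F_J(f|_{J\mathbb R})\subset(-\infty,0],$$ that is, it vanishes almost everywhere on $(0,\infty)$; and for all $u>0$, $v\in\mathbb R$, $$f(u+Jv)=\frac1{\sqrt{2\pi}}\int_{-\infty}^0e^{(u+Jv)w}\,\mathscr F_J(f|_{J\mathbb R})(w)\,dw ,$$ where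 the integral converges absolutely. -/

import Mathlib

open MeasureTheory Filter Topology

namespace SliceMonogenic

noncomputable section

/-! ### The real Clifford algebra with `n` anticommuting imaginary units -/

/-- The negative definite form `x ↦ -|x|²` on Euclidean space. -/
def cliffordForm (n : ℕ) : QuadraticForm ℝ (EuclideanSpace ℝ (Fin n)) :=
  -(LinearMap.BilinMap.toQuadraticMap (innerₗ (EuclideanSpace ℝ (Fin n))))

theorem cliffordForm_apply {n : ℕ} (x : EuclideanSpace ℝ (Fin n)) :
    cliffordForm n x = -(‖x‖ ^ 2) := by
  simp [cliffordForm]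

/-- The real Clifford algebra `ℝ_n`, generated by `e_1, …, e_n` subject to
`e_r e_s + e_s e_r = -2 δ_{rs}`. -/
abbrev Cl (n : ℕ) : Type := CliffordAlgebra (cliffordForm n)

/-- The inclusion `x ↦ x_1 e_1 + ⋯ + x_n e_n` of Euclidean space in the Clifford algebra. -/
abbrev vec {n : ℕ} : EuclideanSpace ℝ (Fin n) →ₗ[ℝ] Cl n :=
  CliffordAlgebra.ι (cliffordForm n)

/-- The generator `e_i`. -/
def gen {n : ℕ} (i : Fin n) : Cl n := vec (EuclideanSpace.single i 1)

/-- The defining relations of the generators. -/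
theorem gen_mul_gen_add {n : ℕ} (r s : Fin n) :
    (gen r * gen s + gen s * gen r : Cl n) = algebraMap ℝ (Cl n) (if r = s then -2 else 0) := by
  rw [gen, gen, vec, CliffordAlgebra.ι_mul_ι_add_swap]
  congr 1
  rw [cliffordForm, FunLike.coe_neg, QuadraticMap.polar_neg,
    LinearMap.BilinMap.polar_toQuadraticMap]
  by_cases h : r = s
  · subst h
    simp
    norm_num
  · have h' : s ≠ r := fun e => h e.symm
    simp [PiLp.inner_apply, h, h']

/-- `e_A = e_{i_1} ⋯ e_{i_s}` for `A = {i_1 < ⋯ < i_s}`, and `e_∅ = 1`. -/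
def blade {n : ℕ} (A : Finset (Fin n)) : Cl n := (A.sort.map gen).prod

/-- The standard basis of Euclidean space. -/
abbrev stdB (n : ℕ) : Module.Basis (Fin n) ℝ (EuclideanSpace ℝ (Fin n)) :=
  (EuclideanSpace.basisFun (Fin n) ℝ).toBasis

theorem contractLeft_list {n : ℕ} (d : Module.Dual ℝ (EuclideanSpace ℝ (Fin n)))
    (l : List (Fin n)) (h : ∀ i ∈ l, d (EuclideanSpace.single i 1) = 0) :
    CliffordAlgebra.contractLeft d ((l.map gen).prod : Cl n) = 0 := by
  induction l with
  | nil => simp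
  | cons i l ih =>
    rw [List.map_cons, List.prod_cons, gen, CliffordAlgebra.contractLeft_ι_mul,
      ih (fun j hj => h j (List.mem_cons_of_mem _ hj)), h i List.mem_cons_self]
    simp

theorem equivExterior_symm_list {n : ℕ} (l : List (Fin n)) (hl : l.Nodup) :
    (CliffordAlgebra.equivExterior (cliffordForm n)).symm
      ((l.map fun i => ExteriorAlgebra.ι ℝ (EuclideanSpace.single i (1 : ℝ))).prod)
      = (l.map gen).prod := by
  induction l with
  | nil =>
    simp only [List.map_nil, List.prod_nil, CliffordAlgebra.equivExterior,
      CliffordAlgebra.changeFormEquiv_symm, CliffordAlgebra.changeFormEquiv_apply]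
    exact CliffordAlgebra.changeForm_one _
  | cons i l ih =>
    have ih := ih hl.of_cons
    simp only [CliffordAlgebra.equivExterior,
      CliffordAlgebra.changeFormEquiv_symm, CliffordAlgebra.changeFormEquiv_apply] at ih ⊢
    rw [List.map_cons, List.prod_cons, List.map_cons, List.prod_cons]
    refine (CliffordAlgebra.changeForm_ι_mul _ _ _).trans ?_
    rw [ih, contractLeft_list, sub_zero, gen]
    intro j hj
    have hij : i ≠ j := by
      rintro rfl
      exact (List.nodup_cons.1 hl).1 hj
    simp [cliffordForm, QuadraticMap.associated_apply, EuclideanSpace.inner_single_left, hij,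
      hij.symm, inner_add_right]

/-- The elements `e_A` form a basis of the Clifford algebra. -/
def bladeBasis (n : ℕ) : Module.Basis (Finset (Fin n)) ℝ (Cl n) :=
  (stdB n).ExteriorAlgebra.map (CliffordAlgebra.equivExterior (cliffordForm n)).symm

theorem bladeBasis_apply {n : ℕ} (A : Finset (Fin n)) : bladeBasis n A = blade A := by
  rw [bladeBasis, Module.Basis.map_apply, ExteriorAlgebra.basis_apply_ofCard (stdB n) rfl,
    blade, ← equivExterior_symm_list _ (Finset.sort_nodup A _)]
  congr 1
  rw [ExteriorAlgebra.ιMulti_family, ExteriorAlgebra.ιMulti_apply,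
    ← Finset.listMap_orderEmbOfFin_finRange A rfl, List.map_map, List.ofFn_eq_map]
  congr 1
  refine List.map_congr_left fun i _ => ?_
  simp only [Function.comp_apply, OrthonormalBasis.coe_toBasis, EuclideanSpace.basisFun_apply]
  rfl

/-- The norm `|a| = (∑_A a_A²)^{1/2}` of `a = ∑_A a_A e_A`. -/
instance instNormedAddCommGroupCl (n : ℕ) : NormedAddCommGroup (Cl n) :=
  NormedAddCommGroup.induced (Cl n) (EuclideanSpace ℝ (Finset (Fin n)))
    ((bladeBasis n).equivFun.trans (WithLp.linearEquiv 2 ℝ (Finset (Fin n) → ℝ)).symm)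
    (LinearEquiv.injective _)

instance instNormedSpaceCl (n : ℕ) : NormedSpace ℝ (Cl n) :=
  NormedSpace.induced ℝ (Cl n) (EuclideanSpace ℝ (Finset (Fin n)))
    ((bladeBasis n).equivFun.trans (WithLp.linearEquiv 2 ℝ (Finset (Fin n) → ℝ)).symm)

theorem norm_eq {n : ℕ} (a : Cl n) : ‖a‖ = √(∑ A, (bladeBasis n).repr a A ^ 2) := by
  change ‖(WithLp.linearEquiv 2 ℝ (Finset (Fin n) → ℝ)).symm ((bladeBasis n).equivFun a)‖ = _
  rw [EuclideanSpace.norm_eq]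
  simp

instance instFiniteCl (n : ℕ) : Module.Finite ℝ (Cl n) := Module.Finite.of_basis (bladeBasis n)

instance instCompleteCl (n : ℕ) : CompleteSpace (Cl n) := FiniteDimensional.complete ℝ (Cl n)

/-! ### Paravectors, slices and slice monogenic functions -/

/-- Paravectors `x_0 + x_1 e_1 + ⋯ + x_n e_n`, written as pairs `(x_0, x)`. -/
abbrev Paravector (n : ℕ) : Type := ℝ × EuclideanSpace ℝ (Fin n)

/-- The sphere `𝕊` of imaginary units. -/
abbrev ImagUnit (n : ℕ) : Type := Metric.sphere (0 : EuclideanSpace ℝ (Fin n)) 1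

theorem vec_unit_mul_self {n : ℕ} (J : ImagUnit n) :
    (vec (J : EuclideanSpace ℝ (Fin n)) * vec (J : EuclideanSpace ℝ (Fin n)) : Cl n) = -1 := by
  rw [vec, CliffordAlgebra.ι_sq_scalar, cliffordForm_apply, norm_eq_of_mem_sphere]
  simp

/-- The embedding `x + i y ↦ x + J y` of `ℂ` onto the slice `L_J = ℝ + J ℝ` of the Clifford
algebra. As it is a continuous homomorphism of algebras, `sliceEmb J (exp z)` is the exponential of
`sliceEmb J z`. -/
def sliceEmb {n : ℕ} (J : ImagUnit n) : ℂ →ₐ[ℝ] Cl n :=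
  Complex.lift ⟨vec (J : EuclideanSpace ℝ (Fin n)), vec_unit_mul_self J⟩

/-- The paravector `u + J v`. -/
def slicePoint {n : ℕ} (J : ImagUnit n) (u v : ℝ) : Paravector n :=
  (u, v • (J : EuclideanSpace ℝ (Fin n)))

/-- Left slice monogenic functions on an open set `U` of paravectors. -/
structure LeftSliceMonogenicOn {n : ℕ} (f : Paravector n → Cl n) (U : Set (Paravector n)) :
    Prop where
  differentiableOn : DifferentiableOn ℝ f U
  cauchyRiemann : ∀ (I : ImagUnit n) (u v : ℝ), slicePoint I u v ∈ U →
    (1 / 2 : ℝ) • (deriv (fun s : ℝ => f (slicePoint I s v)) u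
      + vec (I : EuclideanSpace ℝ (Fin n)) * deriv (fun t : ℝ => f (slicePoint I u t)) v) = 0

/-- The open right half-space. -/
def rightHalfSpace (n : ℕ) : Set (Paravector n) := {x | 0 < x.1}

/-- The left slice monogenic Hardy space `H^p` of the right half-space. -/
structure MemSliceHardy {n : ℕ} (p : ℝ) (f : Paravector n → Cl n) : Prop where
  monogenic : LeftSliceMonogenicOn f (rightHalfSpace n)
  bounded : (⨆ (I : ImagUnit n) (u : ℝ) (_ : 0 < u),
    ∫⁻ v : ℝ, ‖f (slicePoint I u v)‖ₑ ^ p) < ⊤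

/-- `f` has the non-tangential limit `a` at the boundary point `J v` of the half-plane
`{x + J y : x > 0}`: `f (x + J y) → a` as `x + J y → J v` inside each cone `|y - v| < α x`. -/
def HasNonTangentialLimit {n : ℕ} (f : Paravector n → Cl n) (J : ImagUnit n) (v : ℝ) (a : Cl n) :
    Prop :=
  ∀ α : ℝ, 0 < α → Tendsto (fun z : ℝ × ℝ => f (slicePoint J z.1 z.2))
    (𝓝[{z : ℝ × ℝ | 0 < z.1 ∧ |z.2 - v| < α * z.1}] (0, v)) (𝓝 a)

/-- `g` is (a representative of) the non-tangential boundary limit `f|_{Jℝ}`. -/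
def IsBoundaryLimit {n : ℕ} (f : Paravector n → Cl n) (J : ImagUnit n) (g : ℝ → Cl n) : Prop :=
  ∀ᵐ v : ℝ, HasNonTangentialLimit f J v (g v)

/-! ### The one-dimensional left-sided Clifford Fourier transform -/

/-- The integral `(2π)^{-1/2} ∫ e^{-J t w} g(t) dt`, for integrable `g`. -/
def fourierInt {n : ℕ} (J : ImagUnit n) (g : ℝ → Cl n) (w : ℝ) : Cl n :=
  (√(2 * Real.pi))⁻¹ • ∫ t : ℝ, sliceEmb J (Complex.exp (-(Complex.I * t * w))) * g t

/-- `h` is the Fourier transform of `g ∈ L²`: the `L²` limit of the transforms of the truncations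
of `g` to `[-T, T]`. -/
def IsFourierL2 {n : ℕ} (J : ImagUnit n) (g h : ℝ → Cl n) : Prop :=
  MemLp h 2 ∧
    Tendsto (fun T : ℝ => eLpNorm (h - fourierInt J ((Set.Icc (-T) T).indicator g)) 2 volume)
      atTop (𝓝 0)

/-- `h` is (a representative of) the Fourier transform of `g ∈ L¹ + L²`, a space which contains
`L^p` for `1 ≤ p ≤ 2`: the sum of the transforms of an `L¹` part and of an `L²` part of `g`. -/
def IsFourier {n : ℕ} (J : ImagUnit n) (g h : ℝ → Cl n) : Prop :=
  ∃ g₁ g₂ h₂ : ℝ → Cl n, MemLp g₁ 1 ∧ MemLp g₂ 2 ∧ g =ᵐ[volume] g₁ + g₂ ∧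
    IsFourierL2 J g₂ h₂ ∧ h =ᵐ[volume] fourierInt J g₁ + h₂

/-- The support of an almost everywhere defined function: the complement of the largest open set
on which the function vanishes almost everywhere. -/
def essSupport {n : ℕ} (h : ℝ → Cl n) : Set ℝ :=
  (⋃₀ {U : Set ℝ | IsOpen U ∧ ∀ᵐ w : ℝ, w ∈ U → h w = 0})ᶜ

end

end SliceMonogenic

open SliceMonogenic

namespace SliceMonogenic

/-! ### Cauchy's theorem on the half-plane, and the Poisson kernel -/

section Contour

variable {E : Type*} [NormedAddCommGroup E] [NormedSpace ℂ E]

/-! Fix `J`. Left multiplication by `ℝ + Jℝ ≅ ℂ` makes the Clifford algebra a finite-dimensional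
complex vector space, and the slice equation for `I = J` becomes the Cauchy-Riemann equation. A
linear isomorphism `e` onto a Euclidean space `E` (`exists_sliceEquiv`) carries the theorem to a
Paley-Wiener theorem for `E`-valued `H^p` on the right half-plane. It need not be isometric, because
limits, `L^p` membership and the Fourier transform only see the topology and the complex structure.

For `H²`, functions are bounded away from the boundary, so they are Poisson integrals of their
traces on vertical lines. Weak compactness of balls of `L²` produces a boundary density, and
Lebesgue's differentiation theorem gives Fatou's theorem (`ae_tendsto_poissonIntegral`).

For `p < 2` weak compactness fails at `p = 1`. In place of a factorization by zeros there is a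
majorant (`MemHardy.exists_majorant`): a scalar `G` in `H²` with `Re G > 0` and `‖F‖^(p/2) ≤ ‖G‖`.
It is the Cauchy transform of a weak `L²` limit of the traces of `‖F‖^(p/2)`, made strictly positive
by an added term, and the inequality follows from Phragmén-Lindelöf. Then `F / ((1 + z) G^(2/p))` is
in `H²`, so `F` is assembled from functions with non-tangential limits; and `‖F‖^p ≤ ‖G‖²` yields
convergence in `L^p` of the traces to the boundary function `g`.

Passing to the limit in Cauchy's theorem gives `∫ (it + c)⁻¹ g(t) dt = 0` for `Re c > 0`, and with
the Poisson formula this gives Cauchy's formula for `g`. Up to `√(2π)`, the Cauchy kernels are the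
Fourier transforms of exponentials cut off to a half-line. The multiplication formula `∫ k h = ∫ k̂
g`, for `h` the transform of `g`, therefore turns the vanishing integrals into `h = 0` on `(0, ∞)`
and Cauchy's formula into the Paley-Wiener integral. -/

theorem continuous_verticalLine (a : ℂ) : Continuous fun t : ℝ => a + t * Complex.I := by
  fun_prop

theorem one_add_sq_le_norm_sq {t a : ℝ} : 1 + t ^ 2 ≤ 1 + ‖(a : ℂ) + t * Complex.I‖ ^ 2 := by
  rw [Complex.sq_norm, Complex.normSq_add_mul_I]
  nlinarith [sq_nonneg a]

/-- Cauchy's theorem for the right half-plane, for functions with quadratic decay. -/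
theorem integral_imaginaryAxis_eq_zero {f : ℂ → E} {δ M : ℝ} (hδ : 0 < δ)
    (hf : DifferentiableOn ℂ f {z | -δ < z.re})
    (hM : ∀ z : ℂ, 0 ≤ z.re → ‖f z‖ ≤ M / (1 + ‖z‖ ^ 2)) :
    Integrable (fun t : ℝ => f (t * Complex.I)) ∧ ∫ t : ℝ, f (t * Complex.I) = 0 := by
  have hM0 : 0 ≤ M := by simpa using (norm_nonneg _).trans (hM 0 le_rfl)
  have hline : ∀ a : ℝ, 0 ≤ a → Continuous fun t : ℝ => f (a + t * Complex.I) := fun a ha =>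
    hf.continuousOn.comp_continuous (continuous_verticalLine a) fun t => by
      simpa using lt_of_lt_of_le (neg_lt_zero.2 hδ) ha
  have hb : ∀ a t : ℝ, 0 ≤ a → ‖f (a + t * Complex.I)‖ ≤ M / (1 + t ^ 2) := fun a t ha =>
    (hM _ (by simpa)).trans (div_le_div_of_nonneg_left hM0 (by positivity) one_add_sq_le_norm_sq)
  have hint : Integrable (fun t : ℝ => f (t * Complex.I)) := by
    have h0 := hline 0 le_rfl
    simp only [Complex.ofReal_zero, zero_add] at h0
    refine ((integrable_inv_one_add_sq.const_mul M).mono' h0.aestronglyMeasurable ?_)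
    refine .of_forall fun t => ?_
    simpa [div_eq_mul_inv] using hb 0 t le_rfl
  refine ⟨hint, ?_⟩
  have h1 : Tendsto (fun R : ℝ => ∫ t in (-R)..R, f (t * Complex.I)) atTop
      (𝓝 (∫ t : ℝ, f (t * Complex.I))) :=
    intervalIntegral_tendsto_integral hint tendsto_neg_atTop_atBot tendsto_id
  refine tendsto_nhds_unique h1 ?_
  -- The constant is 1 + 1 + 2: each horizontal edge contributes at most `M / R`, and the right
  -- edge, of length `2R`, at most `2M / R`.
  have h2 : Tendsto (fun R : ℝ => 4 * (M / R)) atTop (𝓝 0) := by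
    simpa using ((tendsto_const_nhds (x := M)).div_atTop tendsto_id).const_mul (4 : ℝ)
  refine squeeze_zero_norm' ?_ h2
  filter_upwards [eventually_gt_atTop 0] with R hR
  have key := Complex.integral_boundary_rect_eq_zero_of_differentiableOn f (-R * Complex.I)
    (R + R * Complex.I) (hf.mono ?_)
  swap
  · intro z hz
    have := hz.1
    simp [Set.uIcc_of_le hR.le] at this
    exact lt_of_lt_of_le (neg_lt_zero.2 hδ) this.1
  simp only [Complex.add_re, Complex.mul_re, Complex.neg_re, Complex.ofReal_re, Complex.I_re,
    Complex.neg_im, Complex.ofReal_im, Complex.I_im, Complex.add_im, Complex.mul_im, mul_zero,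
    mul_one, neg_zero, sub_self, add_zero, zero_add, Complex.ofReal_neg, Complex.ofReal_zero]
    at key
  have hA : ∀ s : ℝ, |s| = R → ‖∫ x in (0 : ℝ)..R, f (x + s * Complex.I)‖ ≤ M / R := fun s hs => by
    have := intervalIntegral.norm_integral_le_of_norm_le_const (a := 0) (b := R)
      (C := M / (1 + R ^ 2)) (f := fun x : ℝ => f (x + s * Complex.I)) fun x hx => by
        rw [Set.uIoc_of_le hR.le] at hx
        simpa [← hs] using hb x s hx.1.le
    refine this.trans ?_
    rw [sub_zero, abs_of_pos hR, div_mul_eq_mul_div, div_le_div_iff₀ (by positivity) hR]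
    nlinarith [mul_nonneg hM0 hR.le, sq_nonneg R]
  have hB : ‖∫ y in (-R)..R, f (R + y * Complex.I)‖ ≤ 2 * (M / R) := by
    have := intervalIntegral.norm_integral_le_of_norm_le_const (a := -R) (b := R)
      (C := M / (1 + R ^ 2)) (f := fun y : ℝ => f (R + y * Complex.I)) fun y hy => by
        refine (hM _ (by simpa using hR.le)).trans
          (div_le_div_of_nonneg_left hM0 (by positivity) ?_)
        rw [Complex.sq_norm, Complex.normSq_add_mul_I]
        nlinarith [sq_nonneg y]
    refine this.trans ?_
    rw [show R - -R = 2 * R by ring, abs_of_pos (by positivity), div_mul_eq_mul_div, ← mul_div_assoc,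
      div_le_div_iff₀ (by positivity) hR]
    nlinarith [mul_nonneg hM0 hR.le, sq_nonneg R]
  have h3 : Complex.I • ∫ y in (-R)..R, f (y * Complex.I) =
      (∫ x in (0 : ℝ)..R, f (x + -(R * Complex.I))) - (∫ x in (0 : ℝ)..R, f (x + R * Complex.I)) +
        Complex.I • ∫ y in (-R)..R, f (R + y * Complex.I) := by
    rw [sub_eq_zero] at key
    simpa using key.symm
  have h4 : ‖∫ y in (-R)..R, f (y * Complex.I)‖ = ‖Complex.I • ∫ y in (-R)..R, f (y * Complex.I)‖ := by
    simp [norm_smul]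
  rw [h4, h3]
  have h5 := hA (-R) (by simp [abs_of_pos hR])
  simp only [Complex.ofReal_neg, neg_mul] at h5
  refine (norm_add_le _ _).trans ?_
  rw [norm_smul, Complex.norm_I, one_mul]
  linarith [norm_sub_le (∫ x in (0 : ℝ)..R, f (x + -(R * Complex.I)))
    (∫ x in (0 : ℝ)..R, f (x + R * Complex.I)), hA R (abs_of_pos hR)]

theorem ne_zero_of_re_pos {z : ℂ} (h : 0 < z.re) : z ≠ 0 := fun h0 => by simp [h0] at h

/-- The distance from `w` to `-c` is at least `Re c` and at least `‖w‖ - ‖c‖`. Two factors `(w +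
c)⁻¹` thus supply the quadratic decay that the contour argument requires. -/
theorem one_add_norm_sq_le {w c : ℂ} (hc : 0 < c.re) (hw : 0 ≤ w.re) :
    1 + ‖w‖ ≤ (1 + (1 + ‖c‖) / c.re) * ‖w + c‖ := by
  have h1 : c.re ≤ ‖w + c‖ := by
    refine le_trans ?_ (Complex.re_le_norm _)
    simpa
  have h2 : ‖w‖ ≤ ‖w + c‖ + ‖c‖ := by simpa using norm_sub_le (w + c) c
  rw [add_mul, one_mul, div_mul_eq_mul_div]
  have : 1 + ‖c‖ ≤ (1 + ‖c‖) * ‖w + c‖ / c.re := by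
    rw [le_div_iff₀ hc]
    gcongr
  linarith

/-- Both poles lie in the left half-plane. For a merely bounded `F` a single factor would not decay
fast enough; the second is removed later by letting `d` tend to infinity. -/
theorem integral_inv_mul_inv_smul_eq_zero {F : ℂ → E} {δ M : ℝ} (hδ : 0 < δ)
    (hF : DifferentiableOn ℂ F {z | -δ < z.re}) (hM : ∀ z : ℂ, 0 ≤ z.re → ‖F z‖ ≤ M)
    {c d : ℂ} (hc : 0 < c.re) (hd : 0 < d.re) :
    ∫ t : ℝ, ((t * Complex.I + c)⁻¹ * (t * Complex.I + d)⁻¹) • F (t * Complex.I) = 0 := by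
  have hM0 : 0 ≤ M := (norm_nonneg _).trans (hM 0 le_rfl)
  have hne : ∀ {z a : ℂ}, -min δ (min c.re d.re) < z.re → min δ (min c.re d.re) ≤ a.re →
      z + a ≠ 0 := fun {z a} hz ha => ne_zero_of_re_pos (by rw [Complex.add_re]; linarith)
  refine (integral_imaginaryAxis_eq_zero (f := fun z => ((z + c)⁻¹ * (z + d)⁻¹) • F z)
    (δ := min δ (min c.re d.re))
    (M := (1 + (1 + ‖c‖) / c.re) * (1 + (1 + ‖d‖) / d.re) * M) (by positivity) ?_ ?_).2
  · refine DifferentiableOn.smul (DifferentiableOn.mul ?_ ?_) (hF.mono fun z hz => ?_)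
    · exact fun z hz => DifferentiableAt.differentiableWithinAt
        ((differentiableAt_id.add_const c).inv (hne hz (by simp)))
    · exact fun z hz => DifferentiableAt.differentiableWithinAt
        ((differentiableAt_id.add_const d).inv (hne hz (by simp)))
    · have : min δ (min c.re d.re) ≤ δ := by simp
      simp only [Set.mem_ofPred_eq] at hz ⊢
      linarith
  · intro z hz
    have h1 := one_add_norm_sq_le hc hz
    have h2 := one_add_norm_sq_le hd hz
    have h1' : 0 < ‖z + c‖ := norm_pos_iff.2 (ne_zero_of_re_pos (by simpa using by linarith))
    have h2' : 0 < ‖z + d‖ := norm_pos_iff.2 (ne_zero_of_re_pos (by simpa using by linarith))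
    rw [norm_smul, norm_mul, norm_inv, norm_inv, ← mul_inv, inv_mul_eq_div,
      div_le_div_iff₀ (by positivity) (by positivity)]
    have h3 : 1 + ‖z‖ ^ 2 ≤ (1 + ‖z‖) * (1 + ‖z‖) := by nlinarith [norm_nonneg z]
    calc ‖F z‖ * (1 + ‖z‖ ^ 2) ≤ M * (((1 + (1 + ‖c‖) / c.re) * ‖z + c‖) *
          ((1 + (1 + ‖d‖) / d.re) * ‖z + d‖)) := by
          gcongr
          · exact hM z hz
          · exact h3.trans (by gcongr)
      _ = _ := by ring

/-- The Poisson kernel of the right half-plane at `u + i v`, at the boundary point `i t`. -/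
noncomputable def poissonKernel (u v t : ℝ) : ℝ := Real.pi⁻¹ * (u / (u ^ 2 + (v - t) ^ 2))

theorem poissonKernel_nonneg {u : ℝ} (hu : 0 ≤ u) (v t : ℝ) : 0 ≤ poissonKernel u v t := by
  unfold poissonKernel
  positivity

theorem poissonKernel_pos {u : ℝ} (hu : 0 < u) (v t : ℝ) : 0 < poissonKernel u v t := by
  unfold poissonKernel
  positivity

theorem poissonKernel_eq_rescale {u : ℝ} (hu : 0 < u) (v t : ℝ) :
    poissonKernel u v t = (Real.pi * u)⁻¹ * (1 + ((t - v) * u⁻¹) ^ 2)⁻¹ := by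
  unfold poissonKernel
  field_simp
  ring

theorem integrable_poissonKernel {u : ℝ} (hu : 0 < u) (v : ℝ) :
    Integrable (poissonKernel u v) := by
  have := ((integrable_inv_one_add_sq.comp_mul_right' (inv_pos.2 hu).ne').comp_sub_right
    v).const_mul (Real.pi * u)⁻¹
  exact this.congr (.of_forall fun t => (poissonKernel_eq_rescale hu v t).symm)

theorem integral_poissonKernel {u : ℝ} (hu : 0 < u) (v : ℝ) : ∫ t, poissonKernel u v t = 1 := by
  simp_rw [poissonKernel_eq_rescale hu]
  rw [integral_const_mul, integral_sub_right_eq_self (fun t : ℝ => (1 + (t * u⁻¹) ^ 2)⁻¹) v,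
    Measure.integral_comp_mul_right (fun t : ℝ => (1 + t ^ 2)⁻¹), integral_univ_inv_one_add_sq]
  rw [inv_inv, abs_of_pos hu, smul_eq_mul]
  field_simp

theorem continuous_poissonKernel {u : ℝ} (hu : 0 < u) : 
    Continuous fun z : ℝ × ℝ => poissonKernel u z.1 z.2 := by
  unfold poissonKernel
  refine continuous_const.mul (continuous_const.div (by fun_prop) fun z => ?_)
  positivity

theorem continuous_poissonKernel_right {u : ℝ} (hu : 0 < u) (v : ℝ) : 
    Continuous (poissonKernel u v) :=
  (continuous_poissonKernel hu).comp (Continuous.prodMk_right v)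

theorem poissonKernel_symm (u v t : ℝ) : poissonKernel u v t = poissonKernel u t v := by
  rw [poissonKernel, poissonKernel, ← neg_sq (v - t), neg_sub]

end Contour

/-! ### The Poisson formula for bounded holomorphic functions -/

section Poisson

variable {E : Type*} [NormedAddCommGroup E] [NormedSpace ℂ E]

/-- The denominator `u² + (v - t)²` factors into the distances of `it` to `z = u + iv` and to its
mirror image `-u + iv`. -/
theorem poissonKernel_eq_complex (u v t : ℝ) :
    ((poissonKernel u v t : ℝ) : ℂ) = -(Real.pi : ℂ)⁻¹ * u *
      ((t * Complex.I - (u + v * Complex.I))⁻¹ * (t * Complex.I + (u - v * Complex.I))⁻¹) := by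
  have h1 : (t * Complex.I - (u + v * Complex.I)) * (t * Complex.I + (u - v * Complex.I))
      = -(((u ^ 2 + (v - t) ^ 2 : ℝ)) : ℂ) := by
    push_cast
    linear_combination ((v - t) ^ 2 : ℂ) * Complex.I_sq
  rw [← mul_inv, h1, poissonKernel]
  push_cast
  rw [inv_neg]
  ring

/-- The Poisson formula in the right half-plane, for bounded holomorphic functions. -/
theorem eq_integral_poissonKernel_smul [CompleteSpace E] {F : ℂ → E} {δ M : ℝ} (hδ : 0 < δ)
    (hF : DifferentiableOn ℂ F {z | -δ < z.re}) (hM : ∀ z : ℂ, 0 ≤ z.re → ‖F z‖ ≤ M)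
    {u : ℝ} (hu : 0 < u) (v : ℝ) :
    F (u + v * Complex.I) = ∫ t : ℝ, (poissonKernel u v t : ℂ) • F (t * Complex.I) := by
  have hM0 : 0 ≤ M := (norm_nonneg _).trans (hM 0 le_rfl)
  set z : ℂ := u + v * Complex.I with hz
  set c : ℂ := u - v * Complex.I with hc
  have hzre : z.re = u := by simp [hz]
  have hcre : c.re = u := by simp [hc]
  have hopen : IsOpen {w : ℂ | -δ < w.re} := isOpen_lt continuous_const Complex.continuous_re
  have hds : DifferentiableOn ℂ (dslope F z) {w | -δ < w.re} := by
    refine (Complex.differentiableOn_dslope ?_).2 hF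
    exact hopen.mem_nhds (by simp only [Set.mem_ofPred_eq, hzre]; linarith)
  have hcont : ContinuousOn (dslope F z) {w | -δ < w.re} := hds.continuousOn
  -- a bound for the difference quotient
  obtain ⟨K, hK⟩ : ∃ K, ∀ w : ℂ, 0 ≤ w.re → ‖dslope F z w‖ ≤ K / ‖w + c‖ := by
    have hcpt : IsCompact (Metric.closedBall z 1 ∩ {w : ℂ | 0 ≤ w.re}) :=
      (isCompact_closedBall z 1).inter_right
        (isClosed_le continuous_const Complex.continuous_re)
    have hcont' : ContinuousOn (fun w : ℂ => ‖w + c‖ * ‖dslope F z w‖)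
        (Metric.closedBall z 1 ∩ {w : ℂ | 0 ≤ w.re}) := by
      refine ContinuousOn.mul (by fun_prop) (hcont.mono fun w hw => ?_).norm
      have := hw.2
      simp only [Set.mem_ofPred_eq] at this ⊢
      linarith
    obtain ⟨K₀, hK₀⟩ := hcpt.bddAbove_image hcont'
    refine ⟨max K₀ (2 * M * (1 + ‖z + c‖)), fun w hw => ?_⟩
    have hwc : 0 < ‖w + c‖ := norm_pos_iff.2 (ne_zero_of_re_pos (by simp [hcre]; linarith))
    rw [le_div_iff₀ hwc, mul_comm]
    rcases le_or_gt ‖w - z‖ 1 with h | h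
    · exact (hK₀ ⟨w, ⟨by simpa [dist_eq_norm] using h, hw⟩, rfl⟩).trans (le_max_left _ _)
    · refine le_trans ?_ (le_max_right _ _)
      have hne : w ≠ z := by
        rintro rfl
        simp at h
        linarith
      rw [dslope_of_ne _ hne, slope_def_module, norm_smul, norm_inv]
      have h1 : ‖F w - F z‖ ≤ 2 * M := by
        linarith [norm_sub_le (F w) (F z), hM w hw, hM z (by linarith)]
      have h2 : ‖w + c‖ * ‖w - z‖⁻¹ ≤ 1 + ‖z + c‖ := by
        rw [← div_eq_mul_inv, div_le_iff₀ (by positivity)]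
        have : ‖w + c‖ ≤ ‖w - z‖ + ‖z + c‖ := by
          exact (by congr 1; ring : ‖w + c‖ = ‖w - z + (z + c)‖).trans_le <|
              norm_add_le (w - z) (z + c)
        nlinarith [norm_nonneg (z + c)]
      calc _ = (‖w + c‖ * ‖w - z‖⁻¹) * ‖F w - F z‖ := by ring
        _ ≤ (1 + ‖z + c‖) * (2 * M) := by gcongr
        _ = _ := by ring
  have hK0 : 0 ≤ K := by
    have h := (norm_nonneg _).trans (hK 0 le_rfl)
    have hc0 : 0 < ‖(0 : ℂ) + c‖ := norm_pos_iff.2 (ne_zero_of_re_pos (by simp [hcre, hu]))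
    by_contra! hneg
    exact absurd h (not_le.2 (div_neg_of_neg_of_pos hneg hc0))
  have hne : ∀ {w : ℂ}, -min δ u < w.re → w + c ≠ 0 := fun {w} hw =>
    ne_zero_of_re_pos (by
      have : min δ u ≤ u := min_le_right _ _
      rw [Complex.add_re, hcre]; linarith)
  -- The difference quotient removes the pole at `z`, so no residue is needed; the other pole `-c`
  -- is the mirror image of `z`. The vanishing integral says that `F - F z` has Poisson integral
  -- zero, and the kernel has mass one.
  have key := (integral_imaginaryAxis_eq_zero (f := fun w => (w + c)⁻¹ • dslope F z w)
    (δ := min δ u) (M := (1 + (1 + ‖c‖) / c.re) ^ 2 * K) (by positivity) ?_ ?_)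
  rotate_left
  · refine DifferentiableOn.smul ?_ (hds.mono fun w hw => ?_)
    · exact fun w hw => DifferentiableAt.differentiableWithinAt
        ((differentiableAt_id.add_const c).inv (hne hw))
    · have : min δ u ≤ δ := by simp
      simp only [Set.mem_ofPred_eq] at hw ⊢
      linarith
  · intro w hw
    have h1 := one_add_norm_sq_le (hcre.symm ▸ hu : 0 < c.re) hw
    have h1' : 0 < ‖w + c‖ := norm_pos_iff.2 (hne (by have := lt_min hδ hu; linarith))
    rw [norm_smul, norm_inv, inv_mul_eq_div,
      div_le_div_iff₀ (by positivity) (by positivity)]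
    have h3 : 1 + ‖w‖ ^ 2 ≤ (1 + ‖w‖) * (1 + ‖w‖) := by nlinarith [norm_nonneg w]
    have hA : 0 ≤ 1 + (1 + ‖c‖) / c.re := by rw [hcre]; positivity
    calc _ ≤ (K / ‖w + c‖) * (((1 + (1 + ‖c‖) / c.re) * ‖w + c‖) *
          ((1 + (1 + ‖c‖) / c.re) * ‖w + c‖)) := by
          gcongr
          · exact hK w hw
          · exact h3.trans (by gcongr)
      _ = _ := by field_simp
  obtain ⟨hi, h0⟩ := key
  have hid : ∀ t : ℝ, (t * Complex.I + c)⁻¹ • dslope F z (t * Complex.I) =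
      (-(Real.pi : ℂ) * (u : ℂ)⁻¹) • ((poissonKernel u v t : ℂ) • F (t * Complex.I)
        - (poissonKernel u v t : ℂ) • F z) := by
    intro t
    have hne' : (t * Complex.I : ℂ) ≠ z := by
      intro h
      have := congrArg Complex.re h
      simp [hzre] at this
      exact hu.ne this
    rw [dslope_of_ne _ hne', slope_def_module, smul_smul, ← smul_sub, smul_smul,
      poissonKernel_eq_complex, ← hz, ← hc]
    congr 1
    have hp : (Real.pi : ℂ) ≠ 0 := by exact_mod_cast Real.pi_ne_zero
    have hu' : (u : ℂ) ≠ 0 := by exact_mod_cast hu.ne'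
    field_simp
  simp_rw [hid] at h0 hi
  have hp : (-(Real.pi : ℂ) * (u : ℂ)⁻¹) ≠ 0 := by
    have hp : (Real.pi : ℂ) ≠ 0 := by exact_mod_cast Real.pi_ne_zero
    have hu' : (u : ℂ) ≠ 0 := by exact_mod_cast hu.ne'
    simp [hp, hu']
  rw [integral_smul, smul_eq_zero, or_iff_right hp] at h0
  have hPi : Integrable fun t => (poissonKernel u v t : ℂ) • F z :=
    (integrable_poissonKernel hu v).ofReal.smul_const _
  have hi2 : Integrable fun t : ℝ => (poissonKernel u v t : ℂ) • F (t * Complex.I) := by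
    have hcF : Continuous fun t : ℝ => F (t * Complex.I) :=
      hF.continuousOn.comp_continuous (by fun_prop) fun t => by simpa
    refine ((integrable_poissonKernel hu v).mul_const M).mono'
      ((Complex.continuous_ofReal.comp (continuous_poissonKernel_right hu v)).smul
        hcF).aestronglyMeasurable
      (.of_forall fun t => ?_)
    rw [norm_smul, Complex.norm_real, Real.norm_of_nonneg (poissonKernel_nonneg hu.le v t)]
    exact mul_le_mul_of_nonneg_left (hM _ (by simp)) (poissonKernel_nonneg hu.le v t)
  rw [integral_sub hi2 hPi, sub_eq_zero, integral_smul_const, integral_complex_ofReal,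
    integral_poissonKernel hu, Complex.ofReal_one, one_smul] at h0
  exact h0.symm

end Poisson

open scoped ENNReal NNReal

/-! ### Hardy spaces: interior bounds and Poisson representation -/

section

variable {E : Type*} [NormedAddCommGroup E]

/-- `‖k‖^q ≤ M^(q-p) ‖k‖^p`. -/
theorem memLp_of_bounded {k : ℝ → E} {M : ℝ} {p q : ℝ≥0∞} (hk : MemLp k p) (hp : p ≠ 0)
    (hM : ∀ t, ‖k t‖ ≤ M) (hq : p ≤ q) : MemLp k q := by
  rcases eq_or_ne q ⊤ with rfl | hqt
  · exact memLp_top_of_bound hk.1 M (.of_forall hM)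
  have hpt : p ≠ ⊤ := ne_top_of_le_ne_top hqt hq
  have hq0 : q ≠ 0 := (lt_of_lt_of_le (pos_iff_ne_zero.2 hp) hq).ne'
  refine ⟨hk.1, ?_⟩
  rw [eLpNorm_lt_top_iff_lintegral_rpow_enorm_lt_top hq0 hqt]
  have h2 := (eLpNorm_lt_top_iff_lintegral_rpow_enorm_lt_top hp hpt).1 hk.2
  have hpq : p.toReal ≤ q.toReal := ENNReal.toReal_mono hqt hq
  refine lt_of_le_of_lt (lintegral_mono (g := fun t =>
    ENNReal.ofReal M ^ (q.toReal - p.toReal) * ‖k t‖ₑ ^ p.toReal) fun t => ?_) ?_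
  · have h3 : ‖k t‖ₑ ≤ ENNReal.ofReal M := by
      rw [← ofReal_norm]
      exact ENNReal.ofReal_le_ofReal (hM t)
    calc ‖k t‖ₑ ^ q.toReal = ‖k t‖ₑ ^ (q.toReal - p.toReal) * ‖k t‖ₑ ^ p.toReal := by
          rw [← ENNReal.rpow_add_of_nonneg _ _ (by linarith) ENNReal.toReal_nonneg]
          simp
      _ ≤ _ := by
          exact mul_le_mul' (ENNReal.rpow_le_rpow h3 (by linarith)) le_rfl
  · rw [lintegral_const_mul' _ _
      (ENNReal.rpow_ne_top_of_nonneg (by linarith) ENNReal.ofReal_ne_top)]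
    exact ENNReal.mul_lt_top
      (ENNReal.rpow_lt_top_of_nonneg (by linarith) ENNReal.ofReal_ne_top) h2

end

section Hardy

variable {E : Type*} [NormedAddCommGroup E] [NormedSpace ℂ E]

/-- The Hardy space `H^p` of the right half-plane, for functions with values in `E`. -/
structure MemHardy (p : ℝ) (F : ℂ → E) : Prop where
  differentiableOn : DifferentiableOn ℂ F {z | 0 < z.re}
  bounded : ∃ C : ℝ≥0, ∀ u : ℝ, 0 < u → ∫⁻ v : ℝ, ‖F (u + v * Complex.I)‖ₑ ^ p ≤ C

theorem isOpen_rightHalfPlane : IsOpen {z : ℂ | 0 < z.re} :=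
  isOpen_lt continuous_const Complex.continuous_re

theorem continuous_comp_verticalLine {F : ℂ → E} (hF : DifferentiableOn ℂ F {z | 0 < z.re})
    {u : ℝ} (hu : 0 < u) : Continuous fun v : ℝ => F (u + v * Complex.I) :=
  hF.continuousOn.comp_continuous (continuous_verticalLine u) fun t => by simpa

/-- The mean value property combined with `x ≤ 1 + x^p`. This crude substitute for Jensen's
inequality suffices, because only some bound is wanted. The interval `(-π, π)` is the angular range
of `polarCoord`. -/
theorem two_pi_mul_norm_sub_one_le [CompleteSpace E] {F : ℂ → E} {z : ℂ} {ρ p : ℝ} (hρ : 0 < ρ)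
    (hp : 1 ≤ p) (hF : DifferentiableOn ℂ F (Metric.closedBall z ρ)) :
    ENNReal.ofReal (2 * Real.pi * (‖F z‖ - 1)) ≤
      ∫⁻ θ in Set.Ioo (-Real.pi) Real.pi, ‖F (circleMap z ρ θ)‖ₑ ^ p := by
  have hmem : ∀ θ, circleMap z ρ θ ∈ Metric.closedBall z ρ := fun θ =>
    circleMap_mem_closedBall z hρ.le θ
  have hc : Continuous fun θ => F (circleMap z ρ θ) :=
    hF.continuousOn.comp_continuous (continuous_circleMap z ρ) hmem
  have hcp : Continuous fun θ => ‖F (circleMap z ρ θ)‖ ^ p :=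
    hc.norm.rpow_const fun θ => Or.inr (by linarith)
  have hle : ∀ x : ℝ, 0 ≤ x → x ≤ 1 + x ^ p := fun x hx => by
    rcases le_total x 1 with h | h
    · linarith [Real.rpow_nonneg hx p]
    · linarith [Real.self_le_rpow_of_one_le h hp]
  have hper : ∫ θ in (0 : ℝ)..2 * Real.pi, ‖F (circleMap z ρ θ)‖ ^ p =
      ∫ θ in (-Real.pi)..Real.pi, ‖F (circleMap z ρ θ)‖ ^ p := by
    have h : Function.Periodic (fun θ => ‖F (circleMap z ρ θ)‖ ^ p) (2 * Real.pi) := fun θ => by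
      simp only [periodic_circleMap z ρ θ]
    have := h.intervalIntegral_add_eq 0 (-Real.pi)
    rw [zero_add, show -Real.pi + 2 * Real.pi = Real.pi by ring] at this
    exact this
  have hmv : F z = Real.circleAverage F z ρ := by
    refine (DiffContOnCl.circleAverage ?_).symm
    rw [abs_of_pos hρ]
    exact hF.diffContOnCl_ball subset_rfl
  have h1 : 2 * Real.pi * ‖F z‖ ≤ ∫ θ in (0 : ℝ)..2 * Real.pi, ‖F (circleMap z ρ θ)‖ := by
    rw [hmv, Real.circleAverage_def, norm_smul, norm_inv, Real.norm_of_nonneg (by positivity),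
      mul_inv_cancel_left₀ (by positivity)]
    exact intervalIntegral.norm_integral_le_integral_norm (by positivity)
  have h2 : ∫ θ in (0 : ℝ)..2 * Real.pi, ‖F (circleMap z ρ θ)‖ ≤
      ∫ θ in (0 : ℝ)..2 * Real.pi, (1 + ‖F (circleMap z ρ θ)‖ ^ p) :=
    intervalIntegral.integral_mono_on (by positivity) (hc.norm.intervalIntegrable _ _)
      ((continuous_const.add hcp).intervalIntegrable _ _) fun θ _ => hle _ (norm_nonneg _)
  rw [intervalIntegral.integral_add (by simp) (hcp.intervalIntegrable _ _), hper,
    intervalIntegral.integral_const, sub_zero, smul_eq_mul, mul_one] at h2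
  have h3 : ∫ θ in (-Real.pi)..Real.pi, ‖F (circleMap z ρ θ)‖ ^ p =
      ∫ θ in Set.Ioo (-Real.pi) Real.pi, ‖F (circleMap z ρ θ)‖ ^ p := by
    rw [intervalIntegral.integral_of_le (by linarith [Real.pi_pos]), integral_Ioc_eq_integral_Ioo]
  have h4 : 2 * Real.pi * (‖F z‖ - 1) ≤
      ∫ θ in Set.Ioo (-Real.pi) Real.pi, ‖F (circleMap z ρ θ)‖ ^ p := by
    rw [← h3]
    linarith
  refine (ENNReal.ofReal_le_ofReal h4).trans_eq ?_
  rw [ofReal_integral_eq_lintegral_ofReal]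
  · refine lintegral_congr fun θ => ?_
    rw [← ENNReal.ofReal_rpow_of_nonneg (norm_nonneg _) (by linarith), ofReal_norm]
  · exact (hcp.integrableOn_Icc (a := -Real.pi) (b := Real.pi)).mono_set Set.Ioo_subset_Icc_self
  · exact .of_forall fun θ => by positivity

/-- Functions in the Hardy space are bounded away from the boundary. -/
theorem MemHardy.norm_le [CompleteSpace E] {F : ℂ → E} {p : ℝ} (hp : 1 ≤ p) (hF : MemHardy p F)
    {ε : ℝ} (hε : 0 < ε) : ∃ M : ℝ, ∀ z : ℂ, ε ≤ z.re → ‖F z‖ ≤ M := by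
  obtain ⟨C, hC⟩ := hF.bounded
  set r : ℝ := ε / 2 with hr
  have hr0 : 0 < r := by positivity
  refine ⟨1 + (2 * r * C) / (r / 2 * (r / 2)) / (2 * Real.pi), fun z hz => ?_⟩
  set s : Set (ℝ × ℝ) := {q | q.1 ^ 2 + q.2 ^ 2 < r ^ 2} with hs
  have hsm : MeasurableSet s := (isOpen_lt (by fun_prop) continuous_const).measurableSet
  have hfst : ∀ q ∈ s, q.1 ∈ Set.Ioo (-r) r := fun q hq => by
    rw [Set.mem_Ioo, ← abs_lt]
    refine abs_lt_of_sq_lt_sq ?_ hr0.le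
    have : q.1 ^ 2 + q.2 ^ 2 < r ^ 2 := hq
    nlinarith [sq_nonneg q.2]
  have hcont : ContinuousOn (fun q : ℝ × ℝ => ‖F (z + q.1 + q.2 * Complex.I)‖ₑ ^ p) s := by
    refine (ENNReal.continuous_rpow_const.comp_continuousOn (ContinuousOn.enorm ?_))
    refine hF.differentiableOn.continuousOn.comp (by fun_prop) fun q hq => ?_
    have := (hfst q hq).1
    simp
    linarith
  classical
  set h : ℝ × ℝ → ℝ≥0∞ := s.piecewise (fun q => ‖F (z + q.1 + q.2 * Complex.I)‖ₑ ^ p) 0 with hh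
  have hmeas : Measurable h := hcont.measurable_piecewise continuousOn_const hsm
  have hup : ∫⁻ q, h q ≤ ENNReal.ofReal (2 * r * C) := by
    -- Slice the disc of radius `r` by vertical lines: each contributes at most `C`, over a range of
    -- abscissas of length `2r`.
    rw [Measure.volume_eq_prod, lintegral_prod _ hmeas.aemeasurable]
    calc ∫⁻ x, ∫⁻ y, h (x, y) ≤ ∫⁻ x, (Set.Ioo (-r) r).indicator (fun _ => (C : ℝ≥0∞)) x := by
          refine lintegral_mono fun x => ?_
          by_cases hx : x ∈ Set.Ioo (-r) r
          · rw [Set.indicator_of_mem hx]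
            have hx1 : 0 < z.re + x := by linarith [hx.1]
            refine le_trans ?_ (hC (z.re + x) hx1)
            rw [← lintegral_add_left_eq_self
              (fun v : ℝ => ‖F (((z.re + x : ℝ) : ℂ) + v * Complex.I)‖ₑ ^ p) z.im]
            refine lintegral_mono fun y => ?_
            by_cases hy : (x, y) ∈ s
            · rw [hh, Set.piecewise_eq_of_mem _ _ _ hy]
              refine le_of_eq ?_
              congr 3
              apply Complex.ext <;> simp
            · rw [hh, Set.piecewise_eq_of_notMem _ _ _ hy]
              simp
          · rw [Set.indicator_of_notMem hx]
            have h0 : ∀ y, h (x, y) = 0 := fun y => by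
              rw [hh, Set.piecewise_eq_of_notMem _ _ _ fun hy => hx (hfst _ hy)]
              rfl
            simp [h0]
      _ = ENNReal.ofReal (2 * r * C) := by
          rw [lintegral_indicator_const measurableSet_Ioo, Real.volume_Ioo, mul_comm,
            ← ENNReal.ofReal_coe_nnreal, ← ENNReal.ofReal_mul (by linarith)]
          congr 1
          ring
  -- In polar coordinates keep only the ring `r / 2 < ρ < r`: one factor `r / 2` is its width, the
  -- other a lower bound for the Jacobian `ρ`.
  have hlow : ENNReal.ofReal (r / 2 * (r / 2) * (2 * Real.pi * (‖F z‖ - 1))) ≤ ∫⁻ q, h q := by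
    rw [← lintegral_comp_polarCoord_symm]
    have hsub : Set.Ioo (r / 2) r ×ˢ Set.Ioo (-Real.pi) Real.pi ⊆ polarCoord.target := by
      rintro ⟨ρ, θ⟩ ⟨h1, h2⟩
      exact ⟨lt_trans (by positivity) h1.1, h2⟩
    refine le_trans ?_ (lintegral_mono_set hsub)
    rw [Measure.volume_eq_prod, ← Measure.prod_restrict, lintegral_prod]
    swap
    · have hm2 : Measurable fun q : ℝ × ℝ => h (polarCoord.symm q) := by
        refine hmeas.comp ?_
        exact Measurable.prodMk (by fun_prop) (by fun_prop)
      exact ((ENNReal.measurable_ofReal.comp measurable_fst).smul hm2).aemeasurable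
    calc ENNReal.ofReal (r / 2 * (r / 2) * (2 * Real.pi * (‖F z‖ - 1)))
        = ∫⁻ _ in Set.Ioo (r / 2) r, ENNReal.ofReal (r / 2) *
            ENNReal.ofReal (2 * Real.pi * (‖F z‖ - 1)) := by
          rw [setLIntegral_const, Real.volume_Ioo, ← ENNReal.ofReal_mul (by positivity),
            ← ENNReal.ofReal_mul' (by linarith)]
          congr 1
          ring
      _ ≤ _ := by
          refine setLIntegral_mono' measurableSet_Ioo fun ρ hρ => ?_
          have hρ0 : 0 < ρ := lt_trans (by positivity) hρ.1
          simp only [smul_eq_mul]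
          rw [lintegral_const_mul' _ _ ENNReal.ofReal_ne_top]
          refine mul_le_mul' (ENNReal.ofReal_le_ofReal hρ.1.le) ?_
          refine (two_pi_mul_norm_sub_one_le hρ0 hp (hF.differentiableOn.mono ?_)).trans_eq ?_
          · intro w hw
            have h1 : |(w - z).re| ≤ ρ :=
              (Complex.abs_re_le_norm _).trans (by simpa [dist_eq_norm] using hw)
            have h2 := (abs_le.1 h1).1
            simp only [Complex.sub_re, Set.mem_ofPred_eq] at h2 ⊢
            linarith [hρ.2]
          · refine setLIntegral_congr_fun measurableSet_Ioo fun θ _ => ?_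
            have hmem : polarCoord.symm (ρ, θ) ∈ s := by
              simp only [polarCoord_symm_apply, hs, Set.mem_ofPred_eq]
              have : (ρ * Real.cos θ) ^ 2 + (ρ * Real.sin θ) ^ 2 = ρ ^ 2 := by
                linear_combination ρ ^ 2 * Real.sin_sq_add_cos_sq θ
              rw [this]
              exact pow_lt_pow_left₀ hρ.2 hρ0.le two_ne_zero
            simp only [hh]
            rw [Set.piecewise_eq_of_mem _ _ _ hmem]
            simp only [polarCoord_symm_apply]
            congr 3
            rw [circleMap, Complex.exp_mul_I]
            push_cast
            ring
  have h1 := hlow.trans hup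
  rw [ENNReal.ofReal_le_ofReal_iff (by positivity)] at h1
  have h2 : 2 * Real.pi * (‖F z‖ - 1) ≤ (2 * r * C) / (r / 2 * (r / 2)) := by
    rw [le_div_iff₀ (by positivity)]
    linarith
  have h3 : ‖F z‖ - 1 ≤ (2 * r * C) / (r / 2 * (r / 2)) / (2 * Real.pi) := by
    rw [le_div_iff₀ (by positivity)]
    linarith
  linarith

theorem differentiableOn_comp_const_add {F : ℂ → E} (hF : DifferentiableOn ℂ F {z | 0 < z.re})
    (ε : ℝ) : DifferentiableOn ℂ (fun z => F (ε + z)) {z | -ε < z.re} :=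
  hF.comp (by fun_prop) fun z hz => by
    simp only [Set.mem_ofPred_eq, Complex.add_re, Complex.ofReal_re] at hz ⊢
    linarith

/-- Functions in the Hardy space are Poisson integrals of their restrictions to lines. -/
theorem MemHardy.eq_integral_poissonKernel [CompleteSpace E] {F : ℂ → E} {p : ℝ} (hp : 1 ≤ p)
    (hF : MemHardy p F) {ε u : ℝ} (hε : 0 < ε) (hu : 0 < u) (v : ℝ) :
    F ((ε + u : ℝ) + v * Complex.I) =
      ∫ t : ℝ, (poissonKernel u v t : ℂ) • F (ε + t * Complex.I) := by
  obtain ⟨M, hM⟩ := hF.norm_le hp hε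
  rw [← eq_integral_poissonKernel_smul (F := fun z => F (ε + z)) hε
    (differentiableOn_comp_const_add hF.differentiableOn ε)
    (fun z hz => hM _ (by simpa)) hu v]
  push_cast
  rw [add_assoc]

theorem MemHardy.integral_inv_mul_inv_eq_zero [CompleteSpace E] {F : ℂ → E} {p : ℝ} (hp : 1 ≤ p)
    (hF : MemHardy p F) {ε : ℝ} (hε : 0 < ε) {c d : ℂ} (hc : 0 < c.re) (hd : 0 < d.re) :
    ∫ t : ℝ, ((t * Complex.I + c)⁻¹ * (t * Complex.I + d)⁻¹) • F (ε + t * Complex.I) = 0 := by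
  obtain ⟨M, hM⟩ := hF.norm_le hp hε
  exact integral_inv_mul_inv_smul_eq_zero (F := fun z => F (ε + z)) hε
    (differentiableOn_comp_const_add hF.differentiableOn ε)
    (fun z hz => hM _ (by simpa)) hc hd

theorem MemHardy.memLp {F : ℂ → E} {p : ℝ} (hp : 1 ≤ p)
    (hF : MemHardy p F) {u : ℝ} (hu : 0 < u) :
    MemLp (fun v : ℝ => F (u + v * Complex.I)) (ENNReal.ofReal p) := by
  obtain ⟨C, hC⟩ := hF.bounded
  refine ⟨(continuous_comp_verticalLine hF.differentiableOn hu).aestronglyMeasurable, ?_⟩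
  rw [eLpNorm_lt_top_iff_lintegral_rpow_enorm_lt_top (by simp; linarith) ENNReal.ofReal_ne_top,
    ENNReal.toReal_ofReal (by linarith)]
  exact (hC u hu).trans_lt ENNReal.coe_lt_top

theorem poissonKernel_le {u : ℝ} (hu : 0 < u) (v t : ℝ) :
    poissonKernel u v t ≤ (Real.pi * u)⁻¹ := by
  rw [poissonKernel_eq_rescale hu]
  refine mul_le_of_le_one_right (by positivity) (inv_le_one_of_one_le₀ ?_)
  nlinarith [sq_nonneg ((t - v) * u⁻¹)]

theorem memLp_poissonKernel {u : ℝ} (hu : 0 < u) (v : ℝ) {q : ℝ≥0∞} (hq : 1 ≤ q) :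
    MemLp (fun t => (poissonKernel u v t : ℂ)) q :=
  memLp_of_bounded (memLp_one_iff_integrable.2 (integrable_poissonKernel hu v).ofReal)
    one_ne_zero (M := (Real.pi * u)⁻¹)
    (fun t => by
      rw [Complex.norm_real, Real.norm_of_nonneg (poissonKernel_nonneg hu.le v t)]
      exact poissonKernel_le hu v t) hq

end Hardy

/-! ### Weak limits in `L²` and the Poisson representation of `H²` -/

section WeakLimit

variable {E : Type*} [NormedAddCommGroup E] [InnerProductSpace ℂ E]

theorem memLp_conj_smul {k : ℝ → ℂ} (hk : MemLp k 2) (c : E) :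
    MemLp (fun t => (starRingEnd ℂ (k t)) • c) 2 :=
  ((ContinuousLinearMap.toSpanSingleton ℂ c).comp_memLp' hk.star)

variable [CompleteSpace E]

/-- Integration against a scalar kernel, tested on a vector `c`, is an inner product in `L²`, so it
is controlled by weak convergence. The conjugate in `memLp_conj_smul` compensates for conjugate
linearity in the first argument. -/
theorem inner_integral_smul {k : ℝ → ℂ} {φ : ℝ → E} (hk : MemLp k 2) (hφ : MemLp φ 2) (c : E) :
    inner ℂ (hφ.toLp φ) ((memLp_conj_smul hk c).toLp _) = inner ℂ (∫ t, k t • φ t) c := by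
  have hi : Integrable (fun t => k t • φ t) := memLp_one_iff_integrable.1 (hφ.smul hk)
  rw [L2.inner_def, ← inner_conj_symm, ← integral_inner hi, ← integral_conj]
  refine integral_congr_ae ?_
  filter_upwards [hφ.coeFn_toLp, (memLp_conj_smul hk c).coeFn_toLp] with t h1 h2
  rw [h1, h2, inner_conj_symm, inner_smul_left, inner_smul_right]

/-- Weak compactness of balls of `L²`. -/
theorem exists_weak_limit (φ : ℕ → ℝ → E) (hφ : ∀ n, MemLp (φ n) 2) {C : ℝ≥0}
    (hC : ∀ n, eLpNorm (φ n) 2 volume ≤ C) :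
    ∃ g : ℝ → E, MemLp g 2 ∧ ∀ k : ℝ → ℂ, MemLp k 2 → ∀ c : E,
      Tendsto (fun n => inner ℂ (∫ t, k t • φ n t) c) (hyperfilter ℕ)
        (𝓝 (inner ℂ (∫ t, k t • g t) c)) := by
  set x : ℕ → StrongDual ℂ (Lp E 2 (volume : Measure ℝ)) := fun n =>
    InnerProductSpace.toDual ℂ _ ((hφ n).toLp (φ n)) with hx
  have hxn : ∀ n, x n ∈ Metric.closedBall 0 (C : ℝ) := fun n => by
    have : ‖x n‖ ≤ C := by
      rw [hx, LinearIsometryEquiv.norm_map, Lp.norm_toLp]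
      exact ENNReal.toReal_le_coe_of_le_coe (hC n)
    exact (dist_zero_right (x n)).trans_le this
  -- Banach-Alaoglu, with an ultrafilter finer than `atTop` in place of a subsequence: compactness
  -- alone gives the limit.
  obtain ⟨y, -, hy⟩ := (WeakDual.isCompact_closedBall
    (0 : StrongDual ℂ (Lp E 2 (volume : Measure ℝ))) (C : ℝ)).ultrafilter_le_nhds
    ((hyperfilter ℕ).map fun n => StrongDual.toWeakDual (x n)) (by
      simp only [Ultrafilter.coe_map, le_principal_iff, mem_map]
      exact univ_mem' fun n => hxn n)
  set g := (InnerProductSpace.toDual ℂ _).symm (WeakDual.toStrongDual y) with hg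
  refine ⟨g, Lp.memLp g, fun k hk c => ?_⟩
  have h1 := ((WeakDual.eval_continuous (𝕜 := ℂ)
    ((memLp_conj_smul hk c).toLp _)).tendsto y).comp
      (show Tendsto (fun n => StrongDual.toWeakDual (x n)) (hyperfilter ℕ) (𝓝 y) from hy)
  have h2 : y ((memLp_conj_smul hk c).toLp _) = inner ℂ (∫ t, k t • g t) c := by
    rw [← inner_integral_smul hk (Lp.memLp g) c, Lp.toLp_coeFn, hg,
      InnerProductSpace.toDual_symm_apply]
    rfl
  rw [h2] at h1
  refine h1.congr fun n => ?_
  rw [← inner_integral_smul hk (hφ n) c]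
  rfl

/-- Functions in `H²` are Poisson integrals of functions in `L²`. -/
theorem MemHardy.exists_eq_poissonIntegral {F : ℂ → E} (hF : MemHardy 2 F) :
    ∃ g : ℝ → E, MemLp g 2 ∧ ∀ u v : ℝ, 0 < u →
      F (u + v * Complex.I) = ∫ t : ℝ, (poissonKernel u v t : ℂ) • g t := by
  obtain ⟨C, hC⟩ := hF.bounded
  set ε : ℕ → ℝ := fun n => 1 / ((n : ℝ) + 1)
  have hε : ∀ n, 0 < ε n := fun n => Nat.one_div_pos_of_nat
  have hε0 : Tendsto ε atTop (𝓝 0) := tendsto_one_div_add_atTop_nhds_zero_nat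
  obtain ⟨g, hg, hlim⟩ := exists_weak_limit (fun n (t : ℝ) => F (ε n + t * Complex.I))
    (fun n => by simpa using hF.memLp one_le_two (hε n)) (C := NNReal.sqrt C) fun n => by
      rw [eLpNorm_eq_lintegral_rpow_enorm_toReal two_ne_zero ENNReal.ofNat_ne_top,
        ENNReal.toReal_ofNat, NNReal.sqrt_eq_rpow, ENNReal.coe_rpow_of_nonneg _ (by norm_num)]
      exact ENNReal.rpow_le_rpow (hC _ (hε n)) (by norm_num)
  refine ⟨g, hg, fun u v hu => ?_⟩
  refine ext_inner_right ℂ fun c => ?_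
  have hk : MemLp (fun t => (poissonKernel u v t : ℂ)) 2 := memLp_poissonKernel hu v one_le_two
  -- Both sides of the Poisson formula on the line `Re = ε n` have limits: the left by continuity of
  -- `F`, the right by weak convergence.
  refine tendsto_nhds_unique ?_ (hlim _ hk c)
  have hle : (hyperfilter ℕ : Filter ℕ) ≤ atTop := Nat.hyperfilter_le_atTop
  have h1 : Tendsto (fun n => F ((ε n + u : ℝ) + v * Complex.I)) atTop
      (𝓝 (F (u + v * Complex.I))) := by
    have hat : ContinuousAt F (u + v * Complex.I) :=
      (hF.differentiableOn.differentiableAt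
        (isOpen_rightHalfPlane.mem_nhds (by simpa))).continuousAt
    refine hat.tendsto.comp ?_
    have : Continuous fun s : ℝ => ((s + u : ℝ) : ℂ) + v * Complex.I := by fun_prop
    have h := (this.tendsto 0).comp hε0
    rwa [zero_add] at h
  have h2 := (h1.mono_left hle).inner (𝕜 := ℂ) (tendsto_const_nhds (x := c))
  refine h2.congr fun n => ?_
  rw [hF.eq_integral_poissonKernel one_le_two (hε n) hu v]

end WeakLimit

/-! ### Fatou's theorem and contractivity of the Poisson integral -/

section Fatou

/-- Take the least `k` with `|τ| ≤ 2^k x`. If `k > 0`, minimality gives `|τ| > 2^(k-1) x`, whence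
the decay `4^(-k)`. The Poisson kernel is thereby dominated by a sum of multiples of indicators of
dyadic intervals. -/
theorem exists_dyadic_bound {x : ℝ} (hx : 0 < x) (τ : ℝ) :
    ∃ k : ℕ, |τ| ≤ 2 ^ k * x ∧ x / (x ^ 2 + τ ^ 2) ≤ 4 * (1 / 4) ^ k / x := by
  have hex : ∃ k : ℕ, |τ| ≤ 2 ^ k * x := by
    obtain ⟨k, hk⟩ := pow_unbounded_of_one_lt (|τ| / x) one_lt_two
    exact ⟨k, ((div_lt_iff₀ hx).1 hk).le⟩
  classical
  refine ⟨Nat.find hex, Nat.find_spec hex, ?_⟩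
  rcases Nat.eq_zero_or_pos (Nat.find hex) with h | h
  · rw [h, pow_zero, mul_one, div_le_div_iff₀ (by positivity) hx]
    nlinarith [sq_nonneg τ]
  · obtain ⟨m, hm⟩ := Nat.exists_eq_succ_of_ne_zero h.ne'
    have h1 : 2 ^ m * x < |τ| := not_le.1 (Nat.find_min hex (by omega))
    rw [hm, div_le_div_iff₀ (by positivity) hx, Nat.succ_eq_add_one, pow_succ]
    have h2 : (2 ^ m * x) ^ 2 ≤ τ ^ 2 := by
      rw [← sq_abs τ]
      gcongr
    have h3 : ((1 : ℝ) / 4) ^ m * (2 ^ m * x) ^ 2 = x ^ 2 := by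
      rw [mul_pow, ← pow_mul, mul_comm m 2, pow_mul, ← mul_assoc, ← mul_pow]
      norm_num
    have h4 : 0 < ((1 : ℝ) / 4) ^ m := by positivity
    nlinarith [mul_le_mul_of_nonneg_left h2 h4.le, mul_nonneg h4.le (sq_nonneg x)]

/-- Inside a cone the centre can be moved from `y` to its vertex at bounded cost, since `(t - t₀)² ≤
2 (t - y)² + 2 α² x²`. -/
theorem poissonKernel_le_of_cone {α x y t₀ : ℝ} (hx : 0 < x) (hy : |y - t₀| < α * x) (t : ℝ) :
    poissonKernel x y t ≤ (2 + 2 * α ^ 2) / Real.pi * (x / (x ^ 2 + (t - t₀) ^ 2)) := by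
  have h1 : (y - t₀) ^ 2 ≤ (α * x) ^ 2 := by
    rw [← sq_abs]
    gcongr
  have h2 : x ^ 2 + (t - t₀) ^ 2 ≤ (2 + 2 * α ^ 2) * (x ^ 2 + (y - t) ^ 2) := by
    nlinarith [sq_nonneg (t - y + (y - t₀)), sq_nonneg (t - y - (y - t₀)),
      mul_nonneg (sq_nonneg α) (sq_nonneg (y - t))]
  rw [poissonKernel, div_eq_mul_inv _ Real.pi, mul_comm _ Real.pi⁻¹, mul_assoc]
  refine mul_le_mul_of_nonneg_left ?_ (by positivity)
  rw [← mul_div_assoc, div_le_div_iff₀ (by positivity) (by positivity)]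
  nlinarith [mul_le_mul_of_nonneg_left h2 hx.le]

variable {E : Type*} [NormedAddCommGroup E]

/-- The height `4 · 4^(-k) / x` times the length `2 · 2^k x` of the dyadic interval is the weight `8
· 2^(-k)` of the average over it. -/
theorem lintegral_kernel_mul_le {φ : ℝ → ℝ} (hφ : LocallyIntegrable φ) (hφ0 : ∀ t, 0 ≤ φ t)
    {x : ℝ} (hx : 0 < x) (t₀ : ℝ)
    (hs : Summable fun k : ℕ => 8 * (1 / 2 : ℝ) ^ k * ⨍ t in Metric.closedBall t₀ (2 ^ k * x), φ t) :
    ∫⁻ t, ENNReal.ofReal (x / (x ^ 2 + (t - t₀) ^ 2) * φ t) ≤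
      ENNReal.ofReal (∑' k : ℕ, 8 * (1 / 2 : ℝ) ^ k *
        ⨍ t in Metric.closedBall t₀ (2 ^ k * x), φ t) := by
  have hA0 : ∀ k : ℕ, 0 ≤ 8 * (1 / 2 : ℝ) ^ k * ⨍ t in Metric.closedBall t₀ (2 ^ k * x), φ t :=
    fun k => by
      rw [setAverage_eq]
      have : 0 ≤ ∫ t in Metric.closedBall t₀ (2 ^ k * x), φ t := integral_nonneg hφ0
      positivity
  rw [ENNReal.ofReal_tsum_of_nonneg hA0 hs]
  calc ∫⁻ t, ENNReal.ofReal (x / (x ^ 2 + (t - t₀) ^ 2) * φ t)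
      ≤ ∫⁻ t, ∑' k : ℕ, (Metric.closedBall t₀ (2 ^ k * x)).indicator
          (fun t => ENNReal.ofReal (4 * (1 / 4) ^ k / x) * ENNReal.ofReal (φ t)) t := by
        refine lintegral_mono fun t => ?_
        obtain ⟨k, hk1, hk2⟩ := exists_dyadic_bound hx (t - t₀)
        refine le_trans ?_ (ENNReal.le_tsum k)
        rw [Set.indicator_of_mem (by simpa [Real.dist_eq] using hk1),
          ← ENNReal.ofReal_mul (by positivity)]
        exact ENNReal.ofReal_le_ofReal (mul_le_mul_of_nonneg_right hk2 (hφ0 t))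
    _ = ∑' k : ℕ, ENNReal.ofReal (8 * (1 / 2 : ℝ) ^ k *
        ⨍ t in Metric.closedBall t₀ (2 ^ k * x), φ t) := by
        rw [lintegral_tsum fun k => ((hφ.aestronglyMeasurable.aemeasurable.ennreal_ofReal.const_mul
          _).indicator Metric.isClosed_closedBall.measurableSet)]
        refine tsum_congr fun k => ?_
        rw [lintegral_indicator Metric.isClosed_closedBall.measurableSet,
          lintegral_const_mul' _ _ ENNReal.ofReal_ne_top, ← ofReal_integral_eq_lintegral_ofReal
          (hφ.integrableOn_isCompact (isCompact_closedBall _ _)) (.of_forall hφ0),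
          ← ENNReal.ofReal_mul (by positivity), setAverage_eq, Real.volume_real_closedBall
          (by positivity), smul_eq_mul]
        congr 1
        have : (1 / 4 : ℝ) ^ k = (1 / 2) ^ k * (1 / 2) ^ k := by rw [← mul_pow]; norm_num
        have h2 : (1 / 2 : ℝ) ^ k * 2 ^ k = 1 := by rw [← mul_pow]; norm_num
        rw [this]
        generalize (∫ t in Metric.closedBall t₀ (2 ^ k * x), φ t) = I
        field_simp
        linear_combination 8 * I * h2

variable [NormedSpace ℂ E]

theorem integrable_poissonKernel_smul {g : ℝ → E} (hg : MemLp g 2) {u : ℝ} (hu : 0 < u) (v : ℝ) :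
    Integrable fun t => (poissonKernel u v t : ℂ) • g t :=
  memLp_one_iff_integrable.1 (hg.smul (memLp_poissonKernel hu v one_le_two))

/-- Fatou's theorem: Poisson integrals have non-tangential limits almost everywhere. -/
theorem ae_tendsto_poissonIntegral [CompleteSpace E] {g : ℝ → E} (hg : MemLp g 2) :
    ∀ᵐ t₀ : ℝ, ∀ α : ℝ,
      Tendsto (fun z : ℝ × ℝ => ∫ t, (poissonKernel z.1 z.2 t : ℂ) • g t)
        (𝓝[{z : ℝ × ℝ | 0 < z.1 ∧ |z.2 - t₀| < α * z.1}] (0, t₀)) (𝓝 (g t₀)) := by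
  have hloc : LocallyIntegrable g := hg.locallyIntegrable one_le_two
  have hsq : Integrable fun t => ‖g t‖ ^ 2 := hg.integrable_norm_pow two_ne_zero
  -- The exceptional set is that of the points which are not Lebesgue points of `g`; it serves all
  -- apertures `α` at once.
  filter_upwards [(Besicovitch.vitaliFamily (volume : Measure ℝ)).ae_tendsto_average_norm_sub hloc]
    with t₀ h₀ α
  set φ : ℝ → ℝ := fun t => ‖g t - g t₀‖ with hφ
  have hφloc : LocallyIntegrable φ := fun t =>
    ((hloc.sub (locallyIntegrable_const (g t₀))) t).norm
  set A : ℝ → ℝ := fun r => ⨍ t in Metric.closedBall t₀ r, φ t with hA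
  have hA1 : Tendsto A (𝓝[>] 0) (𝓝 0) := h₀.comp (Besicovitch.tendsto_filterAt volume t₀)
  have hA0 : ∀ r, 0 ≤ A r := fun r => by
    simp only [hA, setAverage_eq]
    have : 0 ≤ ∫ t in Metric.closedBall t₀ r, φ t := integral_nonneg fun t => norm_nonneg _
    positivity
  -- All averages are bounded: for small radii because they tend to zero, for large ones because
  -- `‖g‖ ≤ 1 + ‖g‖²` and `‖g‖²` is integrable. This dominates the dyadic series, so its limit as `x
  -- → 0` may be taken term by term.
  obtain ⟨K, hK⟩ : ∃ K, ∀ r, 0 < r → A r ≤ K := by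
    obtain ⟨δ, hδ, hδA⟩ := Metric.mem_nhdsWithin_iff.1 (hA1.eventually_lt_const zero_lt_one)
    refine ⟨max 1 ((2 * δ)⁻¹ * (∫ t, ‖g t‖ ^ 2) + (1 + ‖g t₀‖)), fun r hr => ?_⟩
    rcases lt_or_ge r δ with h | h
    · exact (le_of_lt (hδA ⟨by simpa [Real.dist_eq, abs_of_pos hr] using h, hr⟩)).trans
        (le_max_left _ _)
    · refine le_trans ?_ (le_max_right _ _)
      simp only [hA, setAverage_eq, smul_eq_mul]
      rw [Real.volume_real_closedBall hr.le]
      have h1 : ∫ t in Metric.closedBall t₀ r, φ t ≤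
          ∫ t in Metric.closedBall t₀ r, (‖g t‖ ^ 2 + (1 + ‖g t₀‖)) := by
        refine integral_mono (hφloc.integrableOn_isCompact (isCompact_closedBall _ _))
          (hsq.integrableOn.add (integrableOn_const (measure_closedBall_lt_top.ne))) fun t => ?_
        have := norm_sub_le (g t) (g t₀)
        simp only [hφ]
        nlinarith [sq_nonneg (‖g t‖ - 1)]
      rw [integral_add hsq.integrableOn (integrableOn_const (measure_closedBall_lt_top.ne)),
        setIntegral_const, Real.volume_real_closedBall hr.le, smul_eq_mul] at h1
      have h2 : ∫ t in Metric.closedBall t₀ r, ‖g t‖ ^ 2 ≤ ∫ t, ‖g t‖ ^ 2 :=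
        setIntegral_le_integral hsq (.of_forall fun t => by positivity)
      calc (2 * r)⁻¹ * ∫ t in Metric.closedBall t₀ r, φ t
          ≤ (2 * r)⁻¹ * ((∫ t, ‖g t‖ ^ 2) + 2 * r * (1 + ‖g t₀‖)) := by
            gcongr
            linarith
        _ = (2 * r)⁻¹ * (∫ t, ‖g t‖ ^ 2) + (1 + ‖g t₀‖) := by
            field_simp
        _ ≤ _ := by
            have : 0 ≤ ∫ t, ‖g t‖ ^ 2 := integral_nonneg fun t => by positivity
            gcongr
  have hgeo : Summable fun k : ℕ => 8 * (1 / 2 : ℝ) ^ k * K :=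
    (summable_geometric_two.mul_left 8).mul_right K
  have hbound : ∀ {x : ℝ}, 0 < x → ∀ k : ℕ,
      ‖8 * (1 / 2 : ℝ) ^ k * A (2 ^ k * x)‖ ≤ 8 * (1 / 2 : ℝ) ^ k * K := fun {x} hx k => by
    rw [Real.norm_of_nonneg (mul_nonneg (by positivity) (hA0 _))]
    exact mul_le_mul_of_nonneg_left (hK _ (by positivity)) (by positivity)
  set S : ℝ → ℝ := fun x => ∑' k : ℕ, 8 * (1 / 2 : ℝ) ^ k * A (2 ^ k * x) with hS
  have hS0 : Tendsto S (𝓝[>] 0) (𝓝 0) := by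
    have : Tendsto S (𝓝[>] 0) (𝓝 (∑' _ : ℕ, (0 : ℝ))) :=
      tendsto_tsum_of_dominated_convergence (𝓕 := 𝓝[>] (0 : ℝ))
      (f := fun (x : ℝ) (k : ℕ) => 8 * (1 / 2 : ℝ) ^ k * A (2 ^ k * x)) (g := fun _ => (0 : ℝ)) hgeo
      (fun k => by
        have h1 : Tendsto (fun x : ℝ => 2 ^ k * x) (𝓝[>] 0) (𝓝[>] 0) := by
          refine tendsto_nhdsWithin_iff.2 ⟨?_, ?_⟩
          · exact ((continuous_const.mul continuous_id).tendsto' 0 0 (by simp)).mono_left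
              nhdsWithin_le_nhds
          · filter_upwards [self_mem_nhdsWithin] with x hx
            exact mul_pos (by positivity) (show (0 : ℝ) < x from hx)
        simpa using (hA1.comp h1).const_mul (8 * (1 / 2 : ℝ) ^ k))
      (by filter_upwards [self_mem_nhdsWithin] with x hx k using hbound hx k)
    rwa [tsum_zero] at this
  rw [tendsto_iff_norm_sub_tendsto_zero]
  have hlim : Tendsto (fun z : ℝ × ℝ => (2 + 2 * α ^ 2) / Real.pi * S z.1)
      (𝓝[{z : ℝ × ℝ | 0 < z.1 ∧ |z.2 - t₀| < α * z.1}] (0, t₀)) (𝓝 0) := by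
    have h1 : Tendsto (fun z : ℝ × ℝ => z.1)
        (𝓝[{z : ℝ × ℝ | 0 < z.1 ∧ |z.2 - t₀| < α * z.1}] (0, t₀)) (𝓝[>] 0) := by
      refine tendsto_nhdsWithin_iff.2 ⟨?_, ?_⟩
      · exact (continuous_fst.tendsto' ((0 : ℝ), t₀) 0 rfl).mono_left nhdsWithin_le_nhds
      · filter_upwards [self_mem_nhdsWithin] with z hz using hz.1
    simpa using (hS0.comp h1).const_mul ((2 + 2 * α ^ 2) / Real.pi)
  refine squeeze_zero' (.of_forall fun z => norm_nonneg _) ?_ hlim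
  filter_upwards [self_mem_nhdsWithin] with z hz
  obtain ⟨hx, hy⟩ := hz
  have hsum : Summable fun k : ℕ => 8 * (1 / 2 : ℝ) ^ k * A (2 ^ k * z.1) :=
    Summable.of_norm_bounded hgeo (hbound hx)
  have hconst : Integrable fun t => (poissonKernel z.1 z.2 t : ℂ) • g t₀ :=
    (integrable_poissonKernel hx z.2).ofReal.smul_const _
  have h1 : (∫ t, (poissonKernel z.1 z.2 t : ℂ) • g t) - g t₀ =
      ∫ t, (poissonKernel z.1 z.2 t : ℂ) • (g t - g t₀) := by
    simp_rw [smul_sub]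
    rw [integral_sub (integrable_poissonKernel_smul hg hx _) hconst, integral_smul_const,
      integral_complex_ofReal, integral_poissonKernel hx, Complex.ofReal_one, one_smul]
  rw [h1, ← ENNReal.ofReal_le_ofReal_iff (by
    have : 0 ≤ S z.1 := tsum_nonneg fun k => mul_nonneg (by positivity) (hA0 _)
    positivity), ofReal_norm]
  refine (enorm_integral_le_lintegral_enorm _).trans ?_
  calc ∫⁻ t, ‖(poissonKernel z.1 z.2 t : ℂ) • (g t - g t₀)‖ₑ
      ≤ ∫⁻ t, ENNReal.ofReal ((2 + 2 * α ^ 2) / Real.pi) *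
          ENNReal.ofReal (z.1 / (z.1 ^ 2 + (t - t₀) ^ 2) * φ t) := by
        refine lintegral_mono fun t => ?_
        rw [← ofReal_norm, norm_smul, Complex.norm_real,
          Real.norm_of_nonneg (poissonKernel_nonneg hx.le _ _),
          ← ENNReal.ofReal_mul (by positivity), ← mul_assoc]
        exact ENNReal.ofReal_le_ofReal
          (mul_le_mul_of_nonneg_right (poissonKernel_le_of_cone hx hy t) (norm_nonneg _))
    _ ≤ ENNReal.ofReal ((2 + 2 * α ^ 2) / Real.pi) * ENNReal.ofReal (S z.1) := by
        rw [lintegral_const_mul' _ _ ENNReal.ofReal_ne_top]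
        exact mul_le_mul' le_rfl
          (lintegral_kernel_mul_le hφloc (fun t => norm_nonneg _) hx t₀ hsum)
    _ = _ := (ENNReal.ofReal_mul (by positivity)).symm

theorem measurable_ofReal_poissonKernel {u : ℝ} (hu : 0 < u) :
    Measurable fun z : ℝ × ℝ => ENNReal.ofReal (poissonKernel u z.1 z.2) :=
  (ENNReal.continuous_ofReal.comp (continuous_poissonKernel hu)).measurable

theorem lintegral_poissonKernel {u : ℝ} (hu : 0 < u) (v : ℝ) :
    ∫⁻ t, ENNReal.ofReal (poissonKernel u v t) = 1 := by
  rw [← ofReal_integral_eq_lintegral_ofReal (integrable_poissonKernel hu v)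
    (.of_forall fun t => poissonKernel_nonneg hu.le v t), integral_poissonKernel hu,
    ENNReal.ofReal_one]

/-- Jensen's inequality for the probability density `k`: Cauchy-Schwarz applied to `√k · (√k G)`. -/
theorem lintegral_mul_sq_le {k G : ℝ → ℝ≥0∞} (hk : AEMeasurable k) (hG : AEMeasurable G)
    (h1 : ∫⁻ t, k t = 1) : (∫⁻ t, k t * G t) ^ (2 : ℝ) ≤ ∫⁻ t, k t * G t ^ (2 : ℝ) := by
  have e1 : ∀ t, k t ^ (1 / 2 : ℝ) * (k t ^ (1 / 2 : ℝ) * G t) = k t * G t :=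
    fun t => by
      rw [← mul_assoc, ← ENNReal.rpow_add_of_nonneg _ _ (by norm_num) (by norm_num)]
      norm_num
  have e2 : ∀ t, (k t ^ (1 / 2 : ℝ)) ^ (2 : ℝ) = k t := fun t => by
    rw [← ENNReal.rpow_mul]
    norm_num
  have e3 : ∀ t, (k t ^ (1 / 2 : ℝ) * G t) ^ (2 : ℝ) = k t * G t ^ (2 : ℝ) := fun t => by
    rw [ENNReal.mul_rpow_of_nonneg _ _ zero_le_two, e2]
  have := ENNReal.lintegral_mul_le_Lp_mul_Lq volume Real.HolderConjugate.two_two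
    (hk.pow_const (1 / 2 : ℝ)) ((hk.pow_const (1 / 2 : ℝ)).mul hG)
  change ∫⁻ t, k t ^ (1 / 2 : ℝ) * (k t ^ (1 / 2 : ℝ) * G t) ≤
    _ * (∫⁻ t, (k t ^ (1 / 2 : ℝ) * G t) ^ (2 : ℝ)) ^ (1 / 2 : ℝ) at this
  rw [lintegral_congr e1, lintegral_congr e2, lintegral_congr e3, h1, ENNReal.one_rpow,
    one_mul] at this
  refine (ENNReal.rpow_le_rpow this zero_le_two).trans_eq ?_
  rw [← ENNReal.rpow_mul]
  norm_num

/-- By symmetry the kernel has mass one in `v` as well as in `t`, so Tonelli's theorem applies. -/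
theorem lintegral_lintegral_poissonKernel_mul {G : ℝ → ℝ≥0∞} (hG : AEMeasurable G) {u : ℝ}
    (hu : 0 < u) :
    ∫⁻ v, ∫⁻ t, ENNReal.ofReal (poissonKernel u v t) * G t = ∫⁻ t, G t := by
  rw [lintegral_lintegral_swap]
  · refine lintegral_congr fun t => ?_
    simp_rw [poissonKernel_symm u _ t]
    rw [lintegral_mul_const'' _ ((continuous_poissonKernel_right hu
      t).measurable.ennreal_ofReal.aemeasurable), lintegral_poissonKernel hu, one_mul]
  · exact (measurable_ofReal_poissonKernel hu).aemeasurable.mul hG.comp_snd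

/-- The Poisson integral is a contraction on `L²`. -/
theorem lintegral_poissonIntegral_sq_le {g : ℝ → E} (hg : MemLp g 2) {u : ℝ} (hu : 0 < u) :
    ∫⁻ v, ‖∫ t, (poissonKernel u v t : ℂ) • g t‖ₑ ^ (2 : ℝ) ≤ ∫⁻ t, ‖g t‖ₑ ^ (2 : ℝ) := by
  have hgm : AEMeasurable fun t => ‖g t‖ₑ := hg.1.enorm
  rw [← lintegral_lintegral_poissonKernel_mul (hgm.pow_const _) hu]
  refine lintegral_mono fun v => ?_
  have h1 : ‖∫ t, (poissonKernel u v t : ℂ) • g t‖ₑ ≤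
      ∫⁻ t, ENNReal.ofReal (poissonKernel u v t) * ‖g t‖ₑ := by
    refine (enorm_integral_le_lintegral_enorm _).trans_eq (lintegral_congr fun t => ?_)
    rw [enorm_smul, ← ofReal_norm, Complex.norm_real,
      Real.norm_of_nonneg (poissonKernel_nonneg hu.le _ _)]
  exact (ENNReal.rpow_le_rpow h1 zero_le_two).trans
    (lintegral_mul_sq_le ((measurable_ofReal_poissonKernel hu).comp
      measurable_prodMk_left).aemeasurable hgm (lintegral_poissonKernel hu v))

end Fatou

section

variable {E : Type*} [NormedAddCommGroup E] [InnerProductSpace ℂ E] [CompleteSpace E]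

/-- Boundary values of functions in `H²`. -/
theorem MemHardy.exists_boundary_two {F : ℂ → E} (hF : MemHardy 2 F) :
    ∃ g : ℝ → E, MemLp g 2 ∧
      (∀ᵐ t₀ : ℝ, ∀ α : ℝ, Tendsto (fun z : ℝ × ℝ => F (z.1 + z.2 * Complex.I))
        (𝓝[{z : ℝ × ℝ | 0 < z.1 ∧ |z.2 - t₀| < α * z.1}] (0, t₀)) (𝓝 (g t₀))) ∧
      ∀ u : ℝ, 0 < u → ∫⁻ v : ℝ, ‖F (u + v * Complex.I)‖ₑ ^ (2 : ℝ) ≤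
        ∫⁻ t, ‖g t‖ₑ ^ (2 : ℝ) := by
  obtain ⟨g, hg, h⟩ := hF.exists_eq_poissonIntegral
  refine ⟨g, hg, ?_, fun u hu => ?_⟩
  · filter_upwards [ae_tendsto_poissonIntegral hg] with t₀ ht α
    refine (ht α).congr' ?_
    filter_upwards [self_mem_nhdsWithin] with z hz using (h _ _ hz.1).symm
  · simp_rw [h u _ hu]
    exact lintegral_poissonIntegral_sq_le hg hu

end

open scoped FourierTransform SchwartzMap ContDiff

/-! ### The Fourier integral on `L¹` -/

section FourierIntegral

variable {E : Type*} [NormedAddCommGroup E] [NormedSpace ℂ E]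

/-- The Fourier integral `(2π)^{-1/2} ∫ e^{-itw} g(t) dt`. -/
noncomputable def ft (g : ℝ → E) (w : ℝ) : E :=
  ((√(2 * Real.pi))⁻¹ : ℂ) • ∫ t : ℝ, Complex.exp (-(Complex.I * t * w)) • g t

/-- The bilinear form `(t, w) ↦ t w / (2π)`. -/
noncomputable def scaledMul : ℝ →ₗ[ℝ] ℝ →ₗ[ℝ] ℝ := (2 * Real.pi)⁻¹ • LinearMap.mul ℝ ℝ

theorem continuous_scaledMul : Continuous fun p : ℝ × ℝ => scaledMul p.1 p.2 := by
  simp only [scaledMul, LinearMap.smul_apply, LinearMap.mul_apply', smul_eq_mul]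
  fun_prop

theorem flip_scaledMul : scaledMul.flip = scaledMul := by
  ext
  simp [scaledMul]

theorem ft_eq_fourierIntegral (g : ℝ → E) (w : ℝ) :
    ft g w = ((√(2 * Real.pi))⁻¹ : ℂ) •
      VectorFourier.fourierIntegral Real.fourierChar volume scaledMul g w := by
  rw [ft, VectorFourier.fourierIntegral]
  congr 1
  refine integral_congr_ae (.of_forall fun t => ?_)
  simp only [Circle.smul_def, Real.fourierChar_apply, scaledMul, LinearMap.smul_apply,
    LinearMap.mul_apply', smul_eq_mul]
  congr 2
  have hp : (Real.pi : ℂ) ≠ 0 := by exact_mod_cast Real.pi_ne_zero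
  push_cast
  field_simp

theorem ft_eq_fourier (g : ℝ → E) (w : ℝ) :
    ft g w = ((√(2 * Real.pi))⁻¹ : ℂ) • 𝓕 g ((2 * Real.pi)⁻¹ * w) := by
  rw [ft, Real.fourier_real_eq_integral_exp_smul]
  congr 1
  refine integral_congr_ae (.of_forall fun t => ?_)
  simp only
  congr 2
  have hp : (Real.pi : ℂ) ≠ 0 := by exact_mod_cast Real.pi_ne_zero
  push_cast
  field_simp

theorem continuous_ft {g : ℝ → E} (hg : Integrable g) : Continuous (ft g) := by
  have := VectorFourier.fourierIntegral_continuous Real.continuous_fourierChar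
    continuous_scaledMul hg
  rw [show ft g = fun w => ((√(2 * Real.pi))⁻¹ : ℂ) •
    VectorFourier.fourierIntegral Real.fourierChar volume scaledMul g w from
      funext (ft_eq_fourierIntegral g)]
  exact this.const_smul _

theorem norm_ft_le (g : ℝ → E) (w : ℝ) : ‖ft g w‖ ≤ (√(2 * Real.pi))⁻¹ * ∫ t, ‖g t‖ := by
  rw [ft_eq_fourierIntegral, norm_smul, norm_inv, Complex.norm_real,
    Real.norm_of_nonneg (Real.sqrt_nonneg _)]
  gcongr
  exact VectorFourier.norm_fourierIntegral_le_integral_norm _ _ _ _ _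

theorem integral_smul_ft [CompleteSpace E] {k : ℝ → ℂ} {g : ℝ → E} (hk : Integrable k)
    (hg : Integrable g) : ∫ w, k w • ft g w = ∫ t, ft k t • g t := by
  have h := VectorFourier.integral_fourierIntegral_smul_eq_flip (L := scaledMul)
    Real.continuous_fourierChar continuous_scaledMul hk hg
  simp_rw [ft_eq_fourierIntegral, smul_comm (k _) _, smul_assoc, integral_smul]
  rw [h, flip_scaledMul]

end FourierIntegral

/-! ### Hölder convergence and truncation -/

section Convergence

variable {E : Type*} [NormedAddCommGroup E] [NormedSpace ℂ E] {ι : Type*}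

theorem MemLp.integrable_smul' {k : ℝ → ℂ} {φ : ℝ → E} {p q : ℝ≥0∞} [ENNReal.HolderTriple p q 1]
    (hk : MemLp k p) (hφ : MemLp φ q) : Integrable fun t => k t • φ t :=
  memLp_one_iff_integrable.1 (hφ.smul hk)

theorem tendsto_integral_smul_of_tendsto_eLpNorm {k : ℝ → ℂ} {φ : ℝ → E} {ψ : ι → ℝ → E}
    {l : Filter ι} {p q : ℝ≥0∞} [ENNReal.HolderTriple p q 1]
    (hk : MemLp k p) (hφ : MemLp φ q) (hψ : ∀ᶠ n in l, MemLp (ψ n) q)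
    (h : Tendsto (fun n => eLpNorm (φ - ψ n) q volume) l (𝓝 0)) :
    Tendsto (fun n => ∫ t, k t • ψ n t) l (𝓝 (∫ t, k t • φ t)) := by
  rw [tendsto_iff_edist_tendsto_0]
  have h2 : Tendsto (fun n => eLpNorm k p volume * eLpNorm (φ - ψ n) q volume) l (𝓝 0) := by
    simpa using ENNReal.Tendsto.const_mul h (Or.inr hk.eLpNorm_ne_top)
  refine tendsto_of_tendsto_of_tendsto_of_le_of_le' tendsto_const_nhds h2
    (.of_forall fun _ => zero_le) ?_
  filter_upwards [hψ] with n hn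
  rw [edist_comm, edist_eq_enorm_sub, ← integral_sub (MemLp.integrable_smul' hk hφ)
    (MemLp.integrable_smul' hk hn)]
  refine (enorm_integral_le_lintegral_enorm _).trans ?_
  rw [← eLpNorm_one_eq_lintegral_enorm]
  refine le_trans (le_of_eq ?_) (eLpNorm_smul_le_mul_eLpNorm (r := 1) (hφ.sub hn).1 hk.1)
  refine eLpNorm_congr_ae (.of_forall fun t => ?_)
  simp [smul_sub]

end Convergence

section

variable {E : Type*} [NormedAddCommGroup E]

theorem eLpNorm_comp_mul_left (f : ℝ → E) (hf : AEStronglyMeasurable f) {a : ℝ} (ha : 0 < a) :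
    eLpNorm (fun w => f (a * w)) 2 volume =
      ENNReal.ofReal (√a)⁻¹ * eLpNorm f 2 volume := by
  have hmap := Real.map_volume_mul_left ha.ne'
  have hac : AEStronglyMeasurable f (Measure.map (a * ·) volume) := by
    rw [hmap]
    exact hf.smul_measure _
  have := eLpNorm_map_measure (p := 2) hac (measurable_const_mul a).aemeasurable
  rw [hmap, eLpNorm_smul_measure_of_ne_top (by simp)] at this
  rw [show (fun w => f (a * w)) = f ∘ (a * ·) from rfl, ← this, smul_eq_mul]
  congr 1
  rw [abs_of_pos (by positivity), ENNReal.ofReal_rpow_of_pos (by positivity), Real.sqrt_eq_rpow,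
    ← Real.inv_rpow ha.le]
  simp

theorem integrable_indicator_Icc {g : ℝ → E} (hg : MemLp g 2) (T : ℝ) :
    Integrable ((Set.Icc (-T) T).indicator g) :=
  (integrable_indicator_iff measurableSet_Icc).2
    ((hg.locallyIntegrable one_le_two).integrableOn_isCompact isCompact_Icc)

theorem tendsto_eLpNorm_sub_indicator_Icc {g : ℝ → E} (hg : MemLp g 2) :
    Tendsto (fun T : ℝ => eLpNorm (g - (Set.Icc (-T) T).indicator g) 2 volume) atTop (𝓝 0) := by
  have hfin : ∫⁻ t, ‖g t‖ₑ ^ (2 : ℝ) ≠ ⊤ := by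
    simpa using ((eLpNorm_lt_top_iff_lintegral_rpow_enorm_lt_top two_ne_zero
      ENNReal.ofNat_ne_top).1 hg.2).ne
  have h := tendsto_lintegral_filter_of_dominated_convergence' (μ := volume) (l := atTop)
    (F := fun (T : ℝ) t => ‖(g - (Set.Icc (-T) T).indicator g) t‖ₑ ^ (2 : ℝ)) (f := fun _ => 0)
    (fun t => ‖g t‖ₑ ^ (2 : ℝ))
    (.of_forall fun T => ((hg.1.sub (hg.1.indicator measurableSet_Icc)).enorm.pow_const _))
    (.of_forall fun T => .of_forall fun t => by
      by_cases ht : t ∈ Set.Icc (-T) T <;> simp [ht]) hfin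
    (.of_forall fun t => by
      refine tendsto_const_nhds.congr' ?_
      filter_upwards [eventually_ge_atTop |t|] with T hT
      simp [abs_le.1 hT])
  have h2 := (ENNReal.continuous_rpow_const (y := 1 / 2)).tendsto _ |>.comp h
  simp only [lintegral_zero] at h2
  rw [ENNReal.zero_rpow_of_pos (by norm_num)] at h2
  refine h2.congr fun T => ?_
  rw [eLpNorm_eq_lintegral_rpow_enorm_toReal two_ne_zero ENNReal.ofNat_ne_top,
    ENNReal.toReal_ofNat]
  rfl

end

/-! ### Plancherel's theorem and the Fourier transform on `L¹ + L²` -/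

section Plancherel

variable {E : Type*} [NormedAddCommGroup E] [InnerProductSpace ℂ E] [CompleteSpace E]

/-- Both transforms have the same integrals against test functions: the `L²` one because it agrees
with the distributional transform, the integral one by the multiplication formula. -/
theorem fourier_toLp_ae_eq {g : ℝ → E} (h1 : Integrable g) (h2 : MemLp g 2) :
    (𝓕 (h2.toLp g) : Lp E 2 (volume : Measure ℝ)) =ᵐ[volume] 𝓕 g := by
  have hc : Continuous (𝓕 g) := VectorFourier.fourierIntegral_continuous
    Real.continuous_fourierChar (by exact continuous_inner) h1
  refine ae_eq_of_integral_contDiff_smul_eq ((Lp.memLp _).locallyIntegrable one_le_two)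
    hc.locallyIntegrable fun ψ hψ hψc => ?_
  have hd : ContDiff ℝ ∞ fun x => (ψ x : ℂ) := Complex.ofRealCLM.contDiff.comp hψ
  have hdc : HasCompactSupport fun x => (ψ x : ℂ) := hψc.comp_left Complex.ofReal_zero
  set Ψ : 𝓢(ℝ, ℂ) := hdc.toSchwartzMap hd with hΨ
  have key := congrArg (fun T => T Ψ) (Lp.fourier_toTemperedDistribution_eq (h2.toLp g))
  simp only [TemperedDistribution.fourier_apply, Lp.toTemperedDistribution_apply] at key
  have e1 : ∫ x, (𝓕 Ψ) x • (h2.toLp g) x = ∫ x, (𝓕 (Ψ : ℝ → ℂ)) x • g x := by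
    refine integral_congr_ae ?_
    filter_upwards [h2.coeFn_toLp] with x hx
    rw [hx, SchwartzMap.fourier_coe]
  have e2 : ∫ x, (𝓕 (Ψ : ℝ → ℂ)) x • g x = ∫ x, Ψ x • 𝓕 g x := by
    have := VectorFourier.integral_fourierIntegral_smul_eq_flip (L := innerₗ ℝ)
      Real.continuous_fourierChar continuous_inner (Ψ.integrable (μ := volume)) h1
    rw [flip_innerₗ] at this
    exact this
  rw [e1, e2] at key
  simpa [hΨ] using key.symm

/-- The Fourier transform on `L²`. -/
noncomputable def ftLp {g : ℝ → E} (hg : MemLp g 2) (w : ℝ) : E :=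
  ((√(2 * Real.pi))⁻¹ : ℂ) •
    (𝓕 (hg.toLp g) : Lp E 2 (volume : Measure ℝ)) ((2 * Real.pi)⁻¹ * w)

theorem quasiMeasurePreserving_mul_left {a : ℝ} (ha : a ≠ 0) :
    Measure.QuasiMeasurePreserving (a * · : ℝ → ℝ) volume volume :=
  ⟨measurable_const_mul a, by
    rw [Real.map_volume_mul_left ha]
    exact Measure.smul_absolutelyContinuous⟩

/-- The factor `(2π)^(-1/2)` cancels the effect of the dilation by `(2π)⁻¹` on the `L²` norm. -/
theorem eLpNorm_ftLp {g : ℝ → E} (hg : MemLp g 2) :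
    eLpNorm (ftLp hg) 2 volume = eLpNorm g 2 volume := by
  have hpos : (0 : ℝ) < 2 * Real.pi := by positivity
  have h1 : ftLp hg = ((√(2 * Real.pi))⁻¹ : ℂ) • fun w =>
    (𝓕 (hg.toLp g) : Lp E 2 (volume : Measure ℝ)) ((2 * Real.pi)⁻¹ * w) := rfl
  have h2 : eLpNorm (𝓕 (hg.toLp g) : Lp E 2 (volume : Measure ℝ)) 2 volume =
      eLpNorm g 2 volume := by
    rw [← eLpNorm_congr_ae hg.coeFn_toLp, ← Lp.enorm_def, ← Lp.enorm_def,
      ← ofReal_norm, ← ofReal_norm, Lp.norm_fourier_eq]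
  rw [h1, eLpNorm_const_smul, eLpNorm_comp_mul_left _ (Lp.aestronglyMeasurable _)
    (inv_pos.2 hpos), h2, ← mul_assoc, ← ofReal_norm, ← ENNReal.ofReal_mul (norm_nonneg _),
    norm_inv, Complex.norm_real, Real.norm_of_nonneg (Real.sqrt_nonneg _), Real.sqrt_inv, inv_inv,
    inv_mul_cancel₀ (by positivity), ENNReal.ofReal_one, one_mul]

theorem memLp_ftLp {g : ℝ → E} (hg : MemLp g 2) : MemLp (ftLp hg) 2 := by
  refine ⟨?_, by rw [eLpNorm_ftLp]; exact hg.2⟩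
  exact ((Lp.aestronglyMeasurable _).comp_quasiMeasurePreserving
    (quasiMeasurePreserving_mul_left (by positivity))).const_smul _

theorem ftLp_ae_eq_ft {g : ℝ → E} (h1 : Integrable g) (h2 : MemLp g 2) :
    ftLp h2 =ᵐ[volume] ft g := by
  have := (quasiMeasurePreserving_mul_left (a := (2 * Real.pi)⁻¹) (by positivity)).ae_eq_comp
    (fourier_toLp_ae_eq h1 h2)
  filter_upwards [this] with w hw
  rw [ftLp, ft_eq_fourier]
  exact congrArg _ hw

theorem ftLp_sub_ae_eq {g g' : ℝ → E} (h : MemLp g 2) (h' : MemLp g' 2) :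
    ftLp (h.sub h') =ᵐ[volume] ftLp h - ftLp h' := by
  have h1 : 𝓕 ((h.sub h').toLp (g - g')) = 𝓕 (h.toLp g) - 𝓕 (h'.toLp g') := by
    rw [MemLp.toLp_sub]
    exact (Lp.fourierTransformₗᵢ ℝ E).map_sub _ _
  have := (quasiMeasurePreserving_mul_left (a := (2 * Real.pi)⁻¹) (by positivity)).ae_eq_comp
    (Lp.coeFn_sub (𝓕 (h.toLp g)) (𝓕 (h'.toLp g')))
  filter_upwards [this] with w hw
  simp only [Function.comp_apply, Pi.sub_apply] at hw
  rw [Pi.sub_apply, ftLp, ftLp, ftLp, h1, hw, smul_sub]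

/-- Plancherel's theorem. -/
theorem memLp_ft {g : ℝ → E} (h1 : Integrable g) (h2 : MemLp g 2) : MemLp (ft g) 2 :=
  (memLp_ftLp h2).ae_eq (ftLp_ae_eq_ft h1 h2)

theorem eLpNorm_ft {g : ℝ → E} (h1 : Integrable g) (h2 : MemLp g 2) :
    eLpNorm (ft g) 2 volume = eLpNorm g 2 volume := by
  rw [← eLpNorm_congr_ae (ftLp_ae_eq_ft h1 h2), eLpNorm_ftLp]

/-- `h` is the Fourier transform of `g ∈ L²`. -/
def IsFTL2 (g h : ℝ → E) : Prop :=
  MemLp h 2 ∧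
    Tendsto (fun T : ℝ => eLpNorm (h - ft ((Set.Icc (-T) T).indicator g)) 2 volume) atTop (𝓝 0)

/-- `h` is the Fourier transform of `g ∈ L¹ + L²`. -/
def IsFT (g h : ℝ → E) : Prop :=
  ∃ g₁ g₂ h₂ : ℝ → E, MemLp g₁ 1 ∧ MemLp g₂ 2 ∧ g =ᵐ[volume] g₁ + g₂ ∧
    IsFTL2 g₂ h₂ ∧ h =ᵐ[volume] ft g₁ + h₂

/-- By linearity and Plancherel the error at stage `T` has the norm of the tail `g - g 1_[-T,T]`. -/
theorem isFTL2_ftLp {g : ℝ → E} (hg : MemLp g 2) : IsFTL2 g (ftLp hg) := by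
  refine ⟨memLp_ftLp hg, (tendsto_eLpNorm_sub_indicator_Icc hg).congr fun T => ?_⟩
  have hT := hg.indicator (measurableSet_Icc (a := -T) (b := T))
  rw [← eLpNorm_ftLp (hg.sub hT)]
  refine eLpNorm_congr_ae ?_
  filter_upwards [ftLp_sub_ae_eq hg hT, ftLp_ae_eq_ft (integrable_indicator_Icc hg T) hT]
    with w h1 h2
  rw [h1, Pi.sub_apply, Pi.sub_apply, h2]

/-- The multiplication formula for the Fourier transform on `L¹ + L²`. -/
theorem IsFT.integral_smul {g h : ℝ → E} (hgh : IsFT g h) {k : ℝ → ℂ} (hk1 : Integrable k)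
    (hk2 : MemLp k 2) :
    Integrable (fun w => k w • h w) ∧ Integrable (fun t => ft k t • g t) ∧
      ∫ w, k w • h w = ∫ t, ft k t • g t := by
  obtain ⟨g₁, g₂, h₂, hg1, hg2, hg, ⟨hh2, hlim⟩, hh⟩ := hgh
  have hk1' : MemLp k 1 := memLp_one_iff_integrable.2 hk1
  have hg1' : Integrable g₁ := memLp_one_iff_integrable.1 hg1
  -- The two hypotheses on `k` serve the two parts of `g`: integrability pairs with the bounded
  -- function `ft g₁`, square integrability with `h₂`.
  have hft1 : MemLp (ft g₁) ⊤ := memLp_top_of_bound (continuous_ft hg1').aestronglyMeasurable _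
    (.of_forall (norm_ft_le g₁))
  have hkt : MemLp (ft k) ⊤ := memLp_top_of_bound (continuous_ft hk1).aestronglyMeasurable _
    (.of_forall (norm_ft_le k))
  have hkt2 : MemLp (ft k) 2 := memLp_ft hk1 hk2
  have i1 : Integrable fun w => k w • ft g₁ w := MemLp.integrable_smul' hk1' hft1
  have i2 : Integrable fun w => k w • h₂ w := MemLp.integrable_smul' hk2 hh2
  have j1 : Integrable fun t => ft k t • g₁ t := MemLp.integrable_smul' hkt hg1
  have j2 : Integrable fun t => ft k t • g₂ t := MemLp.integrable_smul' hkt2 hg2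
  have e1 : (fun w => k w • h w) =ᵐ[volume] (fun w => k w • ft g₁ w) + fun w => k w • h₂ w := by
    filter_upwards [hh] with w hw
    rw [hw, Pi.add_apply, Pi.add_apply, smul_add]
  have e2 : (fun t => ft k t • g t) =ᵐ[volume]
      (fun t => ft k t • g₁ t) + fun t => ft k t • g₂ t := by
    filter_upwards [hg] with w hw
    rw [hw, Pi.add_apply, Pi.add_apply, smul_add]
  refine ⟨(i1.add i2).congr e1.symm, (j1.add j2).congr e2.symm, ?_⟩
  rw [integral_congr_ae e1, integral_congr_ae e2, integral_add' i1 i2, integral_add' j1 j2,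
    integral_smul_ft hk1 hg1']
  congr 1
  have hi : ∀ T : ℝ, MemLp ((Set.Icc (-T) T).indicator g₂) 2 := fun T =>
    hg2.indicator measurableSet_Icc
  have l1 := tendsto_integral_smul_of_tendsto_eLpNorm (l := atTop) hk2 hh2
    (.of_forall fun T : ℝ => memLp_ft (integrable_indicator_Icc hg2 T) (hi T)) hlim
  have l2 := tendsto_integral_smul_of_tendsto_eLpNorm (l := atTop) hkt2 hg2
    (.of_forall fun T : ℝ => hi T) (tendsto_eLpNorm_sub_indicator_Icc hg2)
  refine tendsto_nhds_unique l1 (l2.congr fun T => ?_)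
  exact (integral_smul_ft hk1 (integrable_indicator_Icc hg2 T)).symm

/-- Functions in `L^p`, `1 ≤ p ≤ 2`, have a Fourier transform. -/
theorem exists_isFT {g : ℝ → E} {p : ℝ} (hp1 : 1 ≤ p) (hp2 : p ≤ 2)
    (hg : MemLp g (ENNReal.ofReal p)) : ∃ h, IsFT g h := by
  -- Split a measurable representative at height 1: the large values are integrable since `‖g‖ ≤
  -- ‖g‖^p` there, the small ones are bounded and in `L^p`, hence in `L²`.
  set g' := hg.1.mk g with hg'
  have hae : g =ᵐ[volume] g' := hg.1.ae_eq_mk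
  have hg1 : MemLp g' (ENNReal.ofReal p) := hg.ae_eq hae
  set S : Set ℝ := {t | 1 < ‖g' t‖} with hS
  have hSm : MeasurableSet S :=
    measurableSet_lt measurable_const hg.1.stronglyMeasurable_mk.norm.measurable
  have h1 : MemLp (S.indicator g') 1 := by
    rw [memLp_one_iff_integrable]
    have hi := hg1.integrable_norm_rpow (by simp; linarith) ENNReal.ofReal_ne_top
    rw [ENNReal.toReal_ofReal (by linarith)] at hi
    refine hi.mono' (hg1.1.indicator hSm) (.of_forall fun t => ?_)
    by_cases ht : t ∈ S
    · rw [Set.indicator_of_mem ht]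
      exact Real.self_le_rpow_of_one_le (le_of_lt ht) hp1
    · rw [Set.indicator_of_notMem ht, norm_zero]
      positivity
  have h2 : MemLp (Sᶜ.indicator g') 2 := by
    refine memLp_of_bounded (M := 1) (hg1.indicator hSm.compl) (by simp; linarith) (fun t => ?_)
      (by simpa using ENNReal.ofReal_le_ofReal hp2)
    by_cases ht : t ∈ S
    · simp [ht]
    · rw [Set.indicator_of_mem (by exact ht)]
      exact not_lt.1 ht
  refine ⟨ft (S.indicator g') + ftLp h2, _, _, _, h1, h2, ?_, isFTL2_ftLp h2, ae_eq_rfl⟩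
  rw [Set.indicator_self_add_compl]
  exact hae

end Plancherel

/-! ### Cauchy kernels as Fourier transforms of half-line exponentials -/

section Kernels

/-- The function `w ↦ e^{zw}` on the negative half-line. -/
noncomputable def expLeft (z : ℂ) : ℝ → ℂ :=
  (Set.Iic 0).indicator fun w : ℝ => Complex.exp (z * w)

/-- The function `w ↦ e^{-cw}` on the positive half-line. -/
noncomputable def expRight (c : ℂ) : ℝ → ℂ :=
  (Set.Ioi 0).indicator fun w : ℝ => Complex.exp (-c * w)

theorem integrable_expLeft {z : ℂ} (hz : 0 < z.re) : Integrable (expLeft z) :=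
  (integrable_indicator_iff measurableSet_Iic).2 (integrableOn_exp_mul_complex_Iic hz 0)

theorem integrable_expRight {c : ℂ} (hc : 0 < c.re) : Integrable (expRight c) :=
  (integrable_indicator_iff measurableSet_Ioi).2
    (integrableOn_exp_mul_complex_Ioi (by simpa) 0)

theorem norm_expLeft_le {z : ℂ} (hz : 0 ≤ z.re) (w : ℝ) : ‖expLeft z w‖ ≤ 1 := by
  by_cases hw : w ∈ Set.Iic (0 : ℝ)
  · rw [expLeft, Set.indicator_of_mem hw, Complex.norm_exp, Complex.re_mul_ofReal]
    exact Real.exp_le_one_iff.2 (mul_nonpos_of_nonneg_of_nonpos hz hw)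
  · simp [expLeft, hw]

theorem norm_expRight_le {c : ℂ} (hc : 0 ≤ c.re) (w : ℝ) : ‖expRight c w‖ ≤ 1 := by
  by_cases hw : w ∈ Set.Ioi (0 : ℝ)
  · rw [expRight, Set.indicator_of_mem hw, Complex.norm_exp, Complex.re_mul_ofReal, Complex.neg_re]
    exact Real.exp_le_one_iff.2 (mul_nonpos_of_nonpos_of_nonneg (by linarith) (le_of_lt hw))
  · simp [expRight, hw]

theorem memLp_expLeft {z : ℂ} (hz : 0 < z.re) : MemLp (expLeft z) 2 :=
  memLp_of_bounded (memLp_one_iff_integrable.2 (integrable_expLeft hz)) one_ne_zero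
    (norm_expLeft_le hz.le) one_le_two

theorem memLp_expRight {c : ℂ} (hc : 0 < c.re) : MemLp (expRight c) 2 :=
  memLp_of_bounded (memLp_one_iff_integrable.2 (integrable_expRight hc)) one_ne_zero
    (norm_expRight_le hc.le) one_le_two

theorem ft_expLeft {z : ℂ} (hz : 0 < z.re) (t : ℝ) :
    ft (expLeft z) t = ((√(2 * Real.pi))⁻¹ : ℂ) * (z - t * Complex.I)⁻¹ := by
  have h : ∀ w : ℝ, Complex.exp (-(Complex.I * w * t)) • expLeft z w =
      (Set.Iic 0).indicator (fun w : ℝ => Complex.exp ((z - t * Complex.I) * w)) w := fun w => by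
    by_cases hw : w ∈ Set.Iic (0 : ℝ)
    · rw [expLeft, Set.indicator_of_mem hw, Set.indicator_of_mem hw, smul_eq_mul, ← Complex.exp_add]
      congr 1
      ring
    · rw [expLeft, Set.indicator_of_notMem hw, Set.indicator_of_notMem hw, smul_zero]
  rw [ft, smul_eq_mul]
  congr 1
  simp_rw [h]
  rw [integral_indicator measurableSet_Iic, integral_exp_mul_complex_Iic (by simpa)]
  simp

theorem ft_expRight {c : ℂ} (hc : 0 < c.re) (t : ℝ) :
    ft (expRight c) t = ((√(2 * Real.pi))⁻¹ : ℂ) * (t * Complex.I + c)⁻¹ := by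
  have h : ∀ w : ℝ, Complex.exp (-(Complex.I * w * t)) • expRight c w =
      (Set.Ioi 0).indicator (fun w : ℝ => Complex.exp (-(t * Complex.I + c) * w)) w := fun w => by
    by_cases hw : w ∈ Set.Ioi (0 : ℝ)
    · rw [expRight, Set.indicator_of_mem hw, Set.indicator_of_mem hw, smul_eq_mul,
        ← Complex.exp_add]
      congr 1
      ring
    · rw [expRight, Set.indicator_of_notMem hw, Set.indicator_of_notMem hw, smul_zero]
  rw [ft, smul_eq_mul]
  congr 1
  simp_rw [h]
  rw [integral_indicator measurableSet_Ioi, integral_exp_mul_complex_Ioi (by simpa), Complex.ofReal_zero,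
    mul_zero, Complex.exp_zero, neg_div_neg_eq, one_div]

theorem sqrt_two_pi_ne_zero : (√(2 * Real.pi) : ℂ) ≠ 0 := by
  exact_mod_cast (Real.sqrt_pos.2 (by positivity)).ne'

theorem sqrt_two_pi_mul_self : (√(2 * Real.pi) : ℂ) * √(2 * Real.pi) = 2 * Real.pi := by
  rw [← Complex.ofReal_mul, Real.mul_self_sqrt (by positivity)]
  push_cast
  ring

theorem sub_mul_I_ne_zero {z : ℂ} (hz : 0 < z.re) (t : ℝ) : z - t * Complex.I ≠ 0 :=
  ne_zero_of_re_pos (by simpa)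

theorem mul_I_add_ne_zero {z : ℂ} (hz : 0 < z.re) (t : ℝ) : t * Complex.I + z ≠ 0 :=
  ne_zero_of_re_pos (by simpa)

/-- Membership in `L²` is Plancherel's theorem for `expLeft`; larger exponents follow since the
kernel is bounded by `1 / Re z`. -/
theorem memLp_inv_sub {z : ℂ} (hz : 0 < z.re) {q : ℝ≥0∞} (hq : 2 ≤ q) :
    MemLp (fun t : ℝ => (z - t * Complex.I)⁻¹) q := by
  have h2 : MemLp (fun t : ℝ => (z - t * Complex.I)⁻¹) 2 := by
    refine ((memLp_ft (integrable_expLeft hz) (memLp_expLeft hz)).const_mul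
      (√(2 * Real.pi) : ℂ)).ae_eq (.of_forall fun t => ?_)
    simp only [ft_expLeft hz, mul_inv_cancel_left₀ sqrt_two_pi_ne_zero]
  refine memLp_of_bounded (M := z.re⁻¹) h2 two_ne_zero (fun t => ?_) hq
  rw [norm_inv]
  refine inv_anti₀ hz ?_
  simpa using Complex.re_le_norm (z - t * Complex.I)

theorem memLp_inv_add {c : ℂ} (hc : 0 < c.re) {q : ℝ≥0∞} (hq : 2 ≤ q) :
    MemLp (fun t : ℝ => (t * Complex.I + c)⁻¹) q := by
  have h2 : MemLp (fun t : ℝ => (t * Complex.I + c)⁻¹) 2 := by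
    refine ((memLp_ft (integrable_expRight hc) (memLp_expRight hc)).const_mul
      (√(2 * Real.pi) : ℂ)).ae_eq (.of_forall fun t => ?_)
    simp only [ft_expRight hc, mul_inv_cancel_left₀ sqrt_two_pi_ne_zero]
  refine memLp_of_bounded (M := c.re⁻¹) h2 two_ne_zero (fun t => ?_) hq
  rw [norm_inv]
  refine inv_anti₀ hc ?_
  simpa using Complex.re_le_norm (t * Complex.I + c)

end Kernels

/-! ### The Cauchy transform from `L²` to `H²` -/

section CauchyTransform

/-- The function `π⁻¹ ∫ (z - it)⁻¹ g(t) dt`; its real part is the Poisson integral of `g` if `g`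
is real. -/
noncomputable def cauchyTransform (g : ℝ → ℂ) (z : ℂ) : ℂ :=
  (Real.pi : ℂ)⁻¹ * ∫ t : ℝ, (z - t * Complex.I)⁻¹ • g t

theorem re_inv_sub_eq {u : ℝ} (v t : ℝ) :
    ((u + v * Complex.I : ℂ) - t * Complex.I)⁻¹.re = Real.pi * poissonKernel u v t := by
  have h : (u + v * Complex.I : ℂ) - t * Complex.I = u + (v - t : ℝ) * Complex.I := by
    push_cast
    ring
  rw [h, Complex.inv_re, Complex.normSq_add_mul_I, poissonKernel, mul_inv_cancel_left₀
    Real.pi_ne_zero]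
  simp

theorem re_cauchyTransform {γ : ℝ → ℝ} (hγ : MemLp (fun t => (γ t : ℂ)) 2) {u : ℝ} (hu : 0 < u)
    (v : ℝ) : (cauchyTransform (fun t => (γ t : ℂ)) (u + v * Complex.I)).re =
      ∫ t, poissonKernel u v t * γ t := by
  have hint : Integrable fun t : ℝ => ((u + v * Complex.I : ℂ) - t * Complex.I)⁻¹ • (γ t : ℂ) :=
    MemLp.integrable_smul' (memLp_inv_sub (by simpa) le_rfl) hγ
  rw [cauchyTransform, ← Complex.ofReal_inv, Complex.re_ofReal_mul]
  have := integral_re hint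
  simp only [RCLike.re_to_complex] at this
  rw [← this, ← integral_const_mul]
  refine integral_congr_ae (.of_forall fun t => ?_)
  simp only [smul_eq_mul, Complex.re_mul_ofReal, re_inv_sub_eq]
  field_simp

theorem differentiableOn_cauchyTransform {g : ℝ → ℂ} (hg : MemLp g 2) :
    DifferentiableOn ℂ (cauchyTransform g) {z | 0 < z.re} := by
  intro z₀ hz₀
  have hz₀ : 0 < z₀.re := hz₀
  set r := z₀.re / 2 with hr
  have hr0 : 0 < r := by positivity
  have hre : ∀ z ∈ Metric.ball z₀ r, 0 < z.re := fun z hz => by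
    have h1 : |(z - z₀).re| < r := (Complex.abs_re_le_norm _).trans_lt (by simpa [dist_eq_norm]
      using hz)
    have h2 := (abs_lt.1 h1).1
    simp only [Complex.sub_re] at h2
    linarith
  -- The factor 4 is the square of the 2 in `‖z₀ - it‖ ≤ 2 ‖z - it‖`, valid within distance `Re z₀ /
  -- 2` of `z₀`.
  have hsq : Integrable fun t : ℝ => 4 * (‖(z₀ - t * Complex.I)⁻¹‖ * ‖(z₀ - t * Complex.I)⁻¹ • g t‖) := by
    refine Integrable.const_mul ?_ 4
    refine ((MemLp.integrable_smul' (memLp_inv_sub hz₀ le_rfl) hg).norm).bdd_mul (c := z₀.re⁻¹)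
      (memLp_inv_sub hz₀ le_rfl).1.norm (.of_forall fun t => ?_)
    rw [norm_norm, norm_inv]
    refine inv_anti₀ hz₀ ?_
    simpa using Complex.re_le_norm (z₀ - t * Complex.I)
  have key := hasDerivAt_integral_of_dominated_loc_of_deriv_le (𝕜 := ℂ) (μ := volume)
    (F := fun (z : ℂ) (t : ℝ) => (z - t * Complex.I)⁻¹ • g t)
    (F' := fun (z : ℂ) (t : ℝ) => (-1 / (z - t * Complex.I) ^ 2) • g t)
    (Metric.ball_mem_nhds z₀ hr0)
    (by
      filter_upwards [Metric.ball_mem_nhds z₀ hr0] with z hz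
      exact (MemLp.integrable_smul' (memLp_inv_sub (hre z hz) le_rfl) hg).1)
    (MemLp.integrable_smul' (memLp_inv_sub hz₀ le_rfl) hg)
    (by
      have hc : Continuous fun t : ℝ => -1 / (z₀ - t * Complex.I) ^ 2 :=
        continuous_const.div (by fun_prop) fun t => pow_ne_zero 2 (sub_mul_I_ne_zero hz₀ t)
      exact hc.aestronglyMeasurable.smul hg.1)
    (.of_forall fun t z hz => ?_) hsq
    (.of_forall fun t z hz => by
      have h1 := ((hasDerivAt_id z).sub_const (t * Complex.I)).inv
        (sub_mul_I_ne_zero (hre z hz) t)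
      exact h1.smul_const (g t))
  · exact (key.2.differentiableAt.const_mul _).differentiableWithinAt
  · have h0 := norm_pos_iff.2 (sub_mul_I_ne_zero hz₀ t)
    have h1 : ‖z₀ - t * Complex.I‖ ≤ 2 * ‖z - t * Complex.I‖ := by
      have h2 : ‖z₀ - t * Complex.I‖ ≤ ‖z - t * Complex.I‖ + ‖z - z₀‖ := by
        have := norm_sub_le (z - t * Complex.I) (z - z₀)
        simpa using this
      have h3 : ‖z - z₀‖ < r := by simpa [dist_eq_norm] using hz
      have h4 : z₀.re ≤ ‖z₀ - t * Complex.I‖ := by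
        simpa using Complex.re_le_norm (z₀ - t * Complex.I)
      linarith
    have h5 : 0 < ‖z - t * Complex.I‖ := by linarith
    rw [norm_smul, norm_smul, norm_div, norm_neg, norm_one, norm_pow, norm_inv, ← mul_assoc,
      ← mul_assoc]
    refine mul_le_mul_of_nonneg_right ?_ (norm_nonneg _)
    rw [one_div, mul_assoc, ← mul_inv, ← div_eq_mul_inv, le_div_iff₀ (by positivity),
      inv_mul_le_iff₀ (by positivity)]
    nlinarith

theorem lintegral_comp_neg (f : ℝ → ℝ≥0∞) : ∫⁻ v, f (-v) = ∫⁻ v, f v :=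
  (Measure.measurePreserving_neg (volume : Measure ℝ)).lintegral_comp_emb
    (MeasurableEquiv.neg ℝ).measurableEmbedding f

/-- Cauchy transforms of functions in `L²` are in `H²`. -/
theorem memHardy_cauchyTransform {g : ℝ → ℂ} (hg : MemLp g 2) :
    MemHardy 2 (cauchyTransform g) := by
  refine ⟨differentiableOn_cauchyTransform hg, ?_⟩
  have hfin : ∀ {φ : ℝ → ℂ}, eLpNorm φ 2 volume ^ (2 : ℝ) = ∫⁻ t, ‖φ t‖ₑ ^ (2 : ℝ) := fun {φ} => by
    rw [eLpNorm_eq_lintegral_rpow_enorm_toReal two_ne_zero ENNReal.ofNat_ne_top,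
      ENNReal.toReal_ofNat, ← ENNReal.rpow_mul]
    norm_num
  have hC : (2 * eLpNorm g 2 volume) ^ (2 : ℝ) ≠ ⊤ :=
    ENNReal.rpow_ne_top_of_nonneg zero_le_two (ENNReal.mul_ne_top ENNReal.ofNat_ne_top hg.2.ne)
  refine ⟨((2 * eLpNorm g 2 volume) ^ (2 : ℝ)).toNNReal, fun u hu => ?_⟩
  rw [ENNReal.coe_toNNReal hC]
  have hgh : IsFT g (ftLp hg) := ⟨0, g, ftLp hg, MemLp.zero, hg, by rw [zero_add],
    isFTL2_ftLp hg, .of_forall fun w => by simp [ft]⟩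
  set φ : ℝ → ℂ := fun w => expLeft u w • ftLp hg w with hφ
  have hu' : 0 < (u : ℂ).re := by simpa
  have hφ1 : Integrable φ := (hgh.integral_smul (integrable_expLeft hu') (memLp_expLeft hu')).1
  have hφle : ∀ w, ‖φ w‖ ≤ ‖ftLp hg w‖ := fun w => by
    rw [hφ, norm_smul]
    exact mul_le_of_le_one_left (norm_nonneg _) (norm_expLeft_le hu'.le w)
  have hφ2 : MemLp φ 2 := (memLp_ftLp hg).mono hφ1.1 (.of_forall hφle)
  -- On a vertical line the Cauchy transform is, up to the reflection `v ↦ -v`, the Fourier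
  -- transform of the damped `e^{uw} ĝ(w)` on `w ≤ 0`, so Plancherel bounds it uniformly in `u`. The
  -- 2 is `π⁻¹ · √(2π) · √(2π)`.
  have hG : ∀ v : ℝ, cauchyTransform g (u + v * Complex.I) = 2 * ft φ (-v) := fun v => by
    have hz : 0 < (u + v * Complex.I : ℂ).re := by simpa
    have h1 := (hgh.integral_smul (integrable_expLeft hz) (memLp_expLeft hz)).2.2
    simp_rw [ft_expLeft hz, mul_smul, integral_smul] at h1
    have h2 : ∀ w : ℝ, expLeft (u + v * Complex.I) w • ftLp hg w =
        Complex.exp (-(Complex.I * w * (-v : ℝ))) • φ w := fun w => by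
      rw [hφ, smul_smul]
      congr 1
      by_cases hw : w ∈ Set.Iic (0 : ℝ)
      · rw [expLeft, expLeft, Set.indicator_of_mem hw, Set.indicator_of_mem hw, ← Complex.exp_add]
        congr 1
        push_cast
        ring
      · rw [expLeft, expLeft, Set.indicator_of_notMem hw, Set.indicator_of_notMem hw, mul_zero]
    simp_rw [h2] at h1
    rw [ft, h1, cauchyTransform, smul_smul, ← mul_inv, sqrt_two_pi_mul_self, smul_eq_mul]
    ring
  calc ∫⁻ v : ℝ, ‖cauchyTransform g (u + v * Complex.I)‖ₑ ^ (2 : ℝ)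
      = ∫⁻ v : ℝ, ‖((2 : ℂ) • ft φ) v‖ₑ ^ (2 : ℝ) := by
        rw [← lintegral_comp_neg]
        refine lintegral_congr fun v => ?_
        have := hG (-v)
        rw [neg_neg] at this
        rw [this]
        rfl
    _ = (2 * eLpNorm (ft φ) 2 volume) ^ (2 : ℝ) := by
        rw [← hfin, eLpNorm_const_smul, ← ofReal_norm, RCLike.norm_ofNat, ENNReal.ofReal_ofNat]
    _ ≤ _ := by
        rw [eLpNorm_ft hφ1 hφ2, ← eLpNorm_ftLp hg]
        exact ENNReal.rpow_le_rpow (mul_le_mul' le_rfl (eLpNorm_mono hφle)) zero_le_two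

end CauchyTransform

/-! ### The `H²` majorant of an `H^p` function -/

section Majorant

/-- A quantitative lower bound for Poisson integrals near the boundary. -/
theorem sub_le_poissonIntegral {g : ℝ → ℝ} {M κ r η t : ℝ} (hg : Continuous g)
    (hg0 : ∀ τ, 0 ≤ g τ) (hgM : ∀ τ, g τ ≤ M) (hκ : 0 ≤ κ) (hr : 0 < r) (hη : 0 < η)
    (h : ∀ τ, |t - τ| < r → g t - κ ≤ g τ) :
    g t - κ - M * η * (1 + 1 / r ^ 2) ≤ ∫ τ, poissonKernel η t τ * g τ := by
  have hM0 : 0 ≤ M := (hg0 0).trans (hgM 0)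
  have i1 : Integrable fun τ => poissonKernel η t τ * (g t - κ) :=
    (integrable_poissonKernel hη t).mul_const _
  -- This multiple of a fixed density pays for the points with `|t - τ| ≥ r`. Its mass depends on
  -- `M`, `η` and `r` but not on `t`, which makes the bound uniform along a line.
  have i2 : Integrable fun τ : ℝ =>
      M * η * (1 + 1 / r ^ 2) * Real.pi⁻¹ * (1 + (τ - t) ^ 2)⁻¹ :=
    (integrable_inv_one_add_sq.comp_sub_right t).const_mul _
  have i3 : Integrable fun τ => poissonKernel η t τ * g τ := by
    refine (integrable_poissonKernel hη t).mul_bdd (c := M) hg.aestronglyMeasurable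
      (.of_forall fun τ => ?_)
    rw [Real.norm_of_nonneg (hg0 τ)]
    exact hgM τ
  have key := integral_mono (i1.sub i2) i3 fun τ => ?_
  · rw [integral_sub' i1 i2, integral_mul_const, integral_poissonKernel hη, one_mul,
      integral_const_mul, integral_sub_right_eq_self (fun τ : ℝ => (1 + τ ^ 2)⁻¹) t,
      integral_univ_inv_one_add_sq, mul_assoc _ Real.pi⁻¹,
      inv_mul_cancel₀ Real.pi_ne_zero, mul_one] at key
    exact key
  · have hP := poissonKernel_nonneg hη.le t τ
    simp only [Pi.sub_apply]
    rcases lt_or_ge |t - τ| r with hlt | hge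
    · have h1 := mul_le_mul_of_nonneg_left (h τ hlt) hP
      have h2 : 0 ≤ M * η * (1 + 1 / r ^ 2) * Real.pi⁻¹ * (1 + (τ - t) ^ 2)⁻¹ := by positivity
      linarith
    · have h1 : poissonKernel η t τ * (g t - κ) ≤ poissonKernel η t τ * M :=
        mul_le_mul_of_nonneg_left (by linarith [hgM t]) hP
      have h2 : 0 ≤ poissonKernel η t τ * g τ := mul_nonneg hP (hg0 τ)
      have hsq : r ^ 2 ≤ (t - τ) ^ 2 := by
        rw [← sq_abs (t - τ)]
        gcongr
      have h3 : poissonKernel η t τ ≤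
          η * (1 + 1 / r ^ 2) * Real.pi⁻¹ * (1 + (τ - t) ^ 2)⁻¹ := by
        have h4 : 1 + (τ - t) ^ 2 ≤ (1 + 1 / r ^ 2) * (η ^ 2 + (t - τ) ^ 2) := by
          have h5 : 1 ≤ 1 / r ^ 2 * (t - τ) ^ 2 := by
            rw [one_div, inv_mul_eq_div, one_le_div (by positivity)]
            exact hsq
          have h6 : 0 ≤ (1 + 1 / r ^ 2) * η ^ 2 := by positivity
          nlinarith
        rw [poissonKernel, mul_comm _ Real.pi⁻¹, mul_assoc]
        refine mul_le_mul_of_nonneg_left ?_ (by positivity)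
        rw [← div_eq_mul_inv, div_le_div_iff₀ (by positivity) (by positivity), mul_assoc]
        exact mul_le_mul_of_nonneg_left h4 hη.le
      have h5 := mul_le_mul_of_nonneg_right h3 hM0
      linarith

/-- Subadditivity of concave powers. With `s = p / 2` it uses `p ≤ 2`, and it lets `‖F‖^(p/2)`
inherit uniform continuity from `F`. -/
theorem rpow_le_rpow_add_abs_sub_rpow {a b s : ℝ} (ha : 0 ≤ a) (hb : 0 ≤ b) (hs0 : 0 ≤ s)
    (hs1 : s ≤ 1) : a ^ s ≤ b ^ s + |a - b| ^ s :=
  (Real.rpow_le_rpow ha (by linarith [le_abs_self (a - b)]) hs0).trans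
    (Real.rpow_add_le_add_rpow hb (abs_nonneg _) hs0 hs1)

variable {E : Type*} [NormedAddCommGroup E]

theorem lintegral_norm_rpow_half {p : ℝ} (hp : 0 ≤ p) (φ : ℝ → E) :
    ∫⁻ t, ‖((‖φ t‖ ^ (p / 2) : ℝ) : ℂ)‖ₑ ^ (2 : ℝ) = ∫⁻ t, ‖φ t‖ₑ ^ p := by
  refine lintegral_congr fun t => ?_
  rw [← ofReal_norm, Complex.norm_real, Real.norm_of_nonneg (by positivity),
    ENNReal.ofReal_rpow_of_nonneg (by positivity) zero_le_two, ← Real.rpow_mul (norm_nonneg _)]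
  rw [← ofReal_norm, ENNReal.ofReal_rpow_of_nonneg (norm_nonneg _) hp, div_mul_cancel₀ _ two_ne_zero]

variable [NormedSpace ℂ E] {F : ℂ → E} {p : ℝ}

theorem MemHardy.memLp_norm_rpow (hp : 1 ≤ p) (hF : MemHardy p F) {ε : ℝ} (hε : 0 < ε) :
    MemLp (fun t : ℝ => ((‖F (ε + t * Complex.I)‖ ^ (p / 2) : ℝ) : ℂ)) 2 := by
  obtain ⟨C, hC⟩ := hF.bounded
  refine ⟨(Complex.continuous_ofReal.comp ((continuous_comp_verticalLine hF.differentiableOn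
    hε).norm.rpow_const fun t => Or.inr (by linarith))).aestronglyMeasurable, ?_⟩
  rw [eLpNorm_lt_top_iff_lintegral_rpow_enorm_lt_top two_ne_zero ENNReal.ofNat_ne_top,
    ENNReal.toReal_ofNat, lintegral_norm_rpow_half (by linarith) fun t : ℝ => F (ε + t * Complex.I)]
  exact (hC ε hε).trans_lt ENNReal.coe_lt_top

variable [CompleteSpace E]

/-- Cauchy's estimate on discs of radius `ε / 2`, where `F` is bounded, bounds the derivative on a
convex half-plane. -/
theorem MemHardy.norm_sub_le (hp : 1 ≤ p) (hF : MemHardy p F) {ε : ℝ} (hε : 0 < ε) :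
    ∃ L : ℝ, 0 ≤ L ∧ ∀ z w : ℂ, ε ≤ z.re → ε ≤ w.re → ‖F z - F w‖ ≤ L * ‖z - w‖ := by
  obtain ⟨M, hM⟩ := hF.norm_le hp (half_pos hε)
  have hM0 : 0 ≤ M := (norm_nonneg _).trans (hM ε (by simp; linarith))
  refine ⟨M / (ε / 2), by positivity, fun z w hz hw => ?_⟩
  refine Convex.norm_image_sub_le_of_norm_deriv_le (s := {z : ℂ | ε ≤ z.re}) (fun x hx => ?_)
    (fun x hx => ?_) (convex_halfSpace_re_ge ε) hw hz
  · have hx : ε ≤ x.re := hx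
    exact hF.differentiableOn.differentiableAt
      (isOpen_rightHalfPlane.mem_nhds (show 0 < x.re by linarith))
  · have hx : ε ≤ x.re := hx
    have hre : ∀ y ∈ Metric.closedBall x (ε / 2), ε / 2 ≤ y.re := fun y hy => by
      have h1 : |(y - x).re| ≤ ε / 2 :=
        (Complex.abs_re_le_norm _).trans (by simpa [dist_eq_norm] using hy)
      have h2 := (abs_le.1 h1).1
      simp only [Complex.sub_re] at h2
      linarith
    refine Complex.norm_deriv_le_of_forall_mem_sphere_norm_le (half_pos hε) ?_ fun y hy =>
      hM y (hre y (Metric.sphere_subset_closedBall hy))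
    refine DifferentiableOn.diffContOnCl_ball (U := {z | 0 < z.re}) hF.differentiableOn
      fun y hy => ?_
    have := hre y hy
    simp only [Set.mem_ofPred_eq]
    linarith

/-- A function in `H^p` is dominated by the power `2/p` of a Cauchy transform of the power `p/2` of
its norm on a line. -/
theorem MemHardy.norm_rpow_le_norm_cauchyTransform_add (hp : 1 ≤ p) (hp2 : p ≤ 2)
    (hF : MemHardy p F) {ε : ℝ} (hε : 0 < ε) {Φ : ℂ → ℂ}
    (hΦ : DifferentiableOn ℂ Φ {z | 0 < z.re}) (hΦre : ∀ z : ℂ, 0 < z.re → 0 ≤ (Φ z).re)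
    {z : ℂ} (hz : 0 < z.re) :
    ‖F (ε + z)‖ ^ (p / 2) ≤ ‖cauchyTransform
      (fun t => ((‖F (ε + t * Complex.I)‖ ^ (p / 2) : ℝ) : ℂ)) z + Φ z‖ := by
  have hp0 : 0 < p := by linarith
  set g : ℝ → ℝ := fun t => ‖F (ε + t * Complex.I)‖ ^ (p / 2) with hg
  have hgmem := hF.memLp_norm_rpow hp hε
  set G := cauchyTransform fun t => (g t : ℂ) with hG
  have hgc : Continuous g := (continuous_comp_verticalLine hF.differentiableOn
    hε).norm.rpow_const fun t => Or.inr (by linarith)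
  have hg0 : ∀ t, 0 ≤ g t := fun t => by positivity
  obtain ⟨M, hM⟩ := hF.norm_le hp hε
  have hM0 : 0 ≤ M := (norm_nonneg _).trans (hM ε (by simp))
  have hgM : ∀ t, g t ≤ M ^ (p / 2) := fun t =>
    Real.rpow_le_rpow (norm_nonneg _) (hM _ (by simp)) (by linarith)
  obtain ⟨L, hL0, hL⟩ := hF.norm_sub_le hp hε
  have hψ : ∀ x y : ℂ, 0 ≤ x.re → 0 ≤ y.re →
      ‖F (ε + x)‖ ^ (p / 2) ≤ ‖F (ε + y)‖ ^ (p / 2) + (L * ‖x - y‖) ^ (p / 2) :=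
    fun x y hx hy => by
      refine (rpow_le_rpow_add_abs_sub_rpow (norm_nonneg _) (norm_nonneg (F (ε + y)))
        (by linarith) (by linarith)).trans (add_le_add_right (Real.rpow_le_rpow (abs_nonneg _) ?_
          (by linarith)) _)
      refine (abs_norm_sub_norm_le _ _).trans ?_
      simpa using hL (ε + x) (ε + y) (by simpa) (by simpa)
  have hGre : ∀ x y : ℝ, 0 < x → (G (x + y * Complex.I)).re = ∫ t, poissonKernel x y t * g t :=
    fun x y hx => re_cauchyTransform hgmem hx y
  have hGre0 : ∀ w : ℂ, 0 < w.re → 0 ≤ (G w).re := fun w hw => by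
    rw [← Complex.re_add_im w, hGre _ _ hw]
    exact integral_nonneg fun t => mul_nonneg (poissonKernel_nonneg hw.le _ _) (hg0 t)
  refine le_of_forall_pos_le_add fun δ hδ => ?_
  -- The margin `δ` keeps `A` away from zero, so `A^(-2/p) F` is bounded and the claim becomes `‖h‖
  -- ≤ 1`, a maximum principle. It also absorbs the errors near the boundary and is sent to zero at
  -- the end.
  set A : ℂ → ℂ := fun w => G w + Φ w + δ with hA
  have hAre : ∀ w : ℂ, 0 < w.re → (G w).re + δ ≤ (A w).re := fun w hw => by
    simp only [hA, Complex.add_re, Complex.ofReal_re]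
    linarith [hΦre w hw]
  have hAδ : ∀ w : ℂ, 0 < w.re → δ ≤ ‖A w‖ := fun w hw =>
    le_trans (by linarith [hAre w hw, hGre0 w hw]) (Complex.re_le_norm _)
  set h : ℂ → E := fun w => (A w) ^ ((-(2 / p) : ℝ) : ℂ) • F (ε + w) with hh
  have hnorm : ∀ w, ‖h w‖ = ‖A w‖ ^ (-(2 / p)) * ‖F (ε + w)‖ := fun w => by
    rw [hh, norm_smul, Complex.norm_cpow_real]
  have hhd : DifferentiableOn ℂ h {w | 0 < w.re} := by
    refine DifferentiableOn.smul ?_ ((differentiableOn_comp_const_add hF.differentiableOn ε).mono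
      fun w hw => ?_)
    · refine DifferentiableOn.cpow_const
        (((differentiableOn_cauchyTransform hgmem).add hΦ).add_const _) fun w hw => ?_
      exact Complex.mem_slitPlane_iff.2
        (Or.inl (lt_of_lt_of_le (add_pos_of_nonneg_of_pos (hGre0 w hw) hδ) (hAre w hw)))
    · have hw : 0 < w.re := hw
      show -ε < w.re
      linarith
  have hiff : ∀ w : ℂ, 0 < w.re → (‖h w‖ ≤ 1 ↔ ‖F (ε + w)‖ ^ (p / 2) ≤ ‖A w‖) := fun w hw => by
    have hpos : 0 < ‖A w‖ := hδ.trans_le (hAδ w hw)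
    have e : (2 / p) = (p / 2)⁻¹ := (inv_div p 2).symm
    rw [hnorm, Real.rpow_neg hpos.le, inv_mul_le_iff₀ (by positivity), mul_one, e,
      Real.le_rpow_inv_iff_of_pos (norm_nonneg _) hpos.le (by positivity)]
  have hbound : ∀ w : ℂ, 0 < w.re → ‖h w‖ ≤ δ ^ (-(2 / p)) * M := fun w hw => by
    rw [hnorm]
    refine mul_le_mul ?_ (hM _ (by simpa using hw.le)) (norm_nonneg _) (by positivity)
    exact Real.rpow_le_rpow_of_nonpos hδ (hAδ w hw) (by simp; positivity)
  -- the bound on lines close to the boundary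
  have hline : ∀ᶠ η : ℝ in 𝓝[>] 0, ∀ t : ℝ, ‖h (η + t * Complex.I)‖ ≤ 1 := by
    have hcont : Tendsto (fun r : ℝ => (L * r) ^ (p / 2)) (𝓝[>] 0) (𝓝 0) := by
      have : Continuous fun r : ℝ => (L * r) ^ (p / 2) :=
        (continuous_const.mul continuous_id).rpow_const fun r => Or.inr (by linarith)
      refine (this.tendsto' 0 0 ?_).mono_left nhdsWithin_le_nhds
      rw [mul_zero, Real.zero_rpow (by positivity)]
    -- Half of `δ` covers the oscillation of `g` within distance `r`; the other half covers the move
    -- to the line `Re = η` and the tail of the Poisson kernel.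
    obtain ⟨r, hr1, hr⟩ := ((hcont.eventually_lt_const (half_pos hδ)).and
      self_mem_nhdsWithin).exists
    have hr : 0 < r := hr
    have hlim : Tendsto (fun η : ℝ => (L * η) ^ (p / 2) + M ^ (p / 2) * η * (1 + 1 / r ^ 2))
        (𝓝[>] 0) (𝓝 0) := by
      have h2 : Tendsto (fun η : ℝ => M ^ (p / 2) * η * (1 + 1 / r ^ 2)) (𝓝[>] 0) (𝓝 0) :=
        ((by fun_prop : Continuous fun η : ℝ => M ^ (p / 2) * η * (1 + 1 / r ^ 2)).tendsto' 0 0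
          (by simp)).mono_left nhdsWithin_le_nhds
      simpa using hcont.add h2
    filter_upwards [hlim.eventually_lt_const (half_pos hδ), self_mem_nhdsWithin] with η hη hη0 t
    have hη0 : 0 < η := hη0
    have hw : 0 < ((η : ℂ) + t * Complex.I).re := by simpa
    rw [hiff _ hw]
    have h1 := hψ (η + t * Complex.I) (t * Complex.I) (by simpa using hη0.le) (by simp)
    rw [add_sub_cancel_right, Complex.norm_real, Real.norm_of_nonneg hη0.le] at h1
    have h2 := sub_le_poissonIntegral (t := t) hgc hg0 hgM (half_pos hδ).le hr hη0 fun τ hτ => by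
      have h3 := hψ (t * Complex.I) (τ * Complex.I) (by simp) (by simp)
      rw [← sub_mul, norm_mul, Complex.norm_I, mul_one, ← Complex.ofReal_sub, Complex.norm_real,
        Real.norm_eq_abs] at h3
      have h4 : (L * |t - τ|) ^ (p / 2) ≤ (L * r) ^ (p / 2) := by gcongr
      simp only [hg]
      linarith
    rw [← hGre η t hη0] at h2
    have h3 := hAre _ hw
    have h4 := Complex.re_le_norm (A (η + t * Complex.I))
    have h5 : g t = ‖F (ε + t * Complex.I)‖ ^ (p / 2) := rfl
    linarith
  obtain ⟨η, hη, hη0, hηz⟩ := (hline.and ((eventually_mem_nhdsWithin).and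
    (mem_nhdsWithin_of_mem_nhds (Iio_mem_nhds hz)))).exists
  have hη0 : 0 < η := hη0
  have hηz : η < z.re := hηz
  -- Phragmén-Lindelöf on `Re > η`. As `h` is bounded there, the admissible growth `exp (0 · |w|)`
  -- suffices.
  have hPL : ‖h (η + (z - η))‖ ≤ 1 := by
    refine PhragmenLindelof.right_half_plane_of_bounded_on_real (f := fun w => h (η + w)) ?_
      ⟨1, one_lt_two, 0, ?_⟩ ?_ hη (by simpa using hηz.le)
    · refine DifferentiableOn.diffContOnCl (hhd.comp (by fun_prop) fun w hw => ?_)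
      rw [Complex.closure_setOfPred_lt_re] at hw
      have hw : 0 ≤ w.re := hw
      simp only [Set.mem_ofPred_eq, Complex.add_re, Complex.ofReal_re]
      linarith
    · refine Asymptotics.IsBigO.of_bound (δ ^ (-(2 / p)) * M) ?_
      filter_upwards [mem_inf_of_right (mem_principal_self _)] with w hw
      have hw : 0 < w.re := hw
      simpa using hbound (η + w) (by simp; linarith)
    · refine isBoundedUnder_of_eventually_le (a := δ ^ (-(2 / p)) * M) ?_
      filter_upwards [eventually_gt_atTop 0] with x hx
      exact hbound _ (by simp; linarith)
  rw [add_sub_cancel, hiff z hz] at hPL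
  refine hPL.trans ((norm_add_le _ _).trans ?_)
  rw [Complex.norm_real, Real.norm_of_nonneg hδ.le]

/-- A function in `H^p` is dominated by the power `2/p` of a function in `H²` with positive real
part. -/
theorem MemHardy.exists_majorant (hp : 1 ≤ p) (hp2 : p ≤ 2) (hF : MemHardy p F) :
    ∃ G : ℂ → ℂ, MemHardy 2 G ∧ (∀ z : ℂ, 0 < z.re → 0 < (G z).re) ∧
      ∀ z : ℂ, 0 < z.re → ‖F z‖ ^ (p / 2) ≤ ‖G z‖ := by
  obtain ⟨C, hC⟩ := hF.bounded
  set ε : ℕ → ℝ := fun n => 1 / ((n : ℝ) + 1)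
  have hε : ∀ n, 0 < ε n := fun n => Nat.one_div_pos_of_nat
  have hε0 : Tendsto ε atTop (𝓝 0) := tendsto_one_div_add_atTop_nhds_zero_nat
  have hle : (hyperfilter ℕ : Filter ℕ) ≤ atTop := Nat.hyperfilter_le_atTop
  set γ : ℕ → ℝ → ℂ := fun n t => ((‖F (ε n + t * Complex.I)‖ ^ (p / 2) : ℝ) : ℂ) with hγ
  obtain ⟨g, hg, hlim⟩ := exists_weak_limit γ (fun n => hF.memLp_norm_rpow hp (hε n))
    (C := NNReal.sqrt C) fun n => by
      rw [eLpNorm_eq_lintegral_rpow_enorm_toReal two_ne_zero ENNReal.ofNat_ne_top,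
        ENNReal.toReal_ofNat, NNReal.sqrt_eq_rpow, ENNReal.coe_rpow_of_nonneg _ (by norm_num),
        lintegral_norm_rpow_half (by linarith) fun t : ℝ => F (ε n + t * Complex.I)]
      exact ENNReal.rpow_le_rpow (hC _ (hε n)) (by norm_num)
  -- The weak limit `g` may vanish, and then its Cauchy transform has no strictly positive real
  -- part. Adding the Cauchy transform of a positive `L²` function cures this, so that powers of the
  -- majorant are holomorphic.
  have hφ : MemLp (fun t => (poissonKernel 1 0 t : ℂ)) 2 :=
    memLp_poissonKernel one_pos 0 one_le_two
  set Φ := cauchyTransform fun t => (poissonKernel 1 0 t : ℂ) with hΦ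
  have hΦre : ∀ z : ℂ, 0 < z.re → 0 < (Φ z).re := fun z hz => by
    rw [← Complex.re_add_im z, re_cauchyTransform hφ hz]
    have hpos : ∀ t, 0 < poissonKernel z.re z.im t * poissonKernel 1 0 t := fun t =>
      mul_pos (poissonKernel_pos hz _ _) (poissonKernel_pos one_pos _ _)
    rw [integral_pos_iff_support_of_nonneg (fun t => (hpos t).le)]
    · rw [Function.support_eq_univ fun t => (hpos t).ne']
      simp
    · refine (integrable_poissonKernel one_pos 0).bdd_mul (c := (Real.pi * z.re)⁻¹)
        (continuous_poissonKernel_right hz _).aestronglyMeasurable (.of_forall fun t => ?_)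
      rw [Real.norm_of_nonneg (poissonKernel_nonneg hz.le _ _)]
      exact poissonKernel_le hz _ _
  have hGlim : ∀ z : ℂ, 0 < z.re → Tendsto (fun n => cauchyTransform (γ n) z) (hyperfilter ℕ)
      (𝓝 (cauchyTransform g z)) := fun z hz => by
    have h1 := (hlim _ (memLp_inv_sub hz le_rfl) 1)
    have h2 := (Complex.continuous_conj.tendsto _).comp h1
    simp only [Function.comp_def, RCLike.inner_apply, one_mul, Complex.conj_conj] at h2
    exact h2.const_mul _
  refine ⟨fun z => cauchyTransform g z + Φ z, ?_, fun z hz => ?_, fun z hz => ?_⟩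
  · have : ∀ z : ℂ, 0 < z.re → cauchyTransform (g + fun t => (poissonKernel 1 0 t : ℂ)) z =
        cauchyTransform g z + Φ z := fun z hz => by
      rw [hΦ, cauchyTransform, cauchyTransform, cauchyTransform, ← mul_add, ← integral_add
        (MemLp.integrable_smul' (memLp_inv_sub hz le_rfl) hg)
        (MemLp.integrable_smul' (memLp_inv_sub hz le_rfl) hφ)]
      simp_rw [Pi.add_apply, smul_add]
    obtain ⟨h1, C', h2⟩ := memHardy_cauchyTransform (hg.add hφ)
    refine ⟨h1.congr fun z hz => (this z hz).symm, C', fun u hu => ?_⟩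
    refine (lintegral_congr fun v => ?_).trans_le (h2 u hu)
    rw [this _ (by simpa)]
  · rw [Complex.add_re]
    refine add_pos_of_nonneg_of_pos ?_ (hΦre z hz)
    refine ge_of_tendsto' ((Complex.continuous_re.tendsto _).comp (hGlim z hz)) fun n => ?_
    simp only [Function.comp_apply]
    rw [← Complex.re_add_im z, re_cauchyTransform (hF.memLp_norm_rpow hp (hε n)) hz]
    exact integral_nonneg fun t => mul_nonneg (poissonKernel_nonneg hz.le _ _) (by positivity)
  · have h1 : Tendsto (fun n => ‖F (ε n + z)‖ ^ (p / 2)) (hyperfilter ℕ)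
        (𝓝 (‖F z‖ ^ (p / 2))) := by
      have hat : ContinuousAt F z :=
        (hF.differentiableOn.differentiableAt (isOpen_rightHalfPlane.mem_nhds hz)).continuousAt
      have hc : Continuous fun s : ℝ => (s : ℂ) + z := by fun_prop
      have h2 : Tendsto (fun n => (ε n : ℂ) + z) atTop (𝓝 z) := by
        have := (hc.tendsto 0).comp hε0
        rwa [Complex.ofReal_zero, zero_add] at this
      exact ((hat.tendsto.comp h2).norm.rpow_const (Or.inr (by linarith))).mono_left hle
    refine le_of_tendsto_of_tendsto' h1 ((hGlim z hz).add_const (Φ z)).norm fun n => ?_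
    exact hF.norm_rpow_le_norm_cauchyTransform_add hp hp2 (hε n)
      (differentiableOn_cauchyTransform hφ) (fun z hz => (hΦre z hz).le) hz

end Majorant

/-! ### Dominated convergence with varying dominating functions -/

section Convergence

/-- Pratt's theorem: dominated convergence, with a convergent sequence of dominating functions. -/
theorem tendsto_lintegral_zero_of_le {f D : ℕ → ℝ → ℝ≥0∞} {D₀ : ℝ → ℝ≥0∞}
    (hf : ∀ n, AEMeasurable (f n)) (hD : ∀ n, AEMeasurable (D n))
    (hfD : ∀ n, f n ≤ᵐ[volume] D n) (hf0 : ∀ᵐ t, Tendsto (fun n => f n t) atTop (𝓝 0))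
    (hDD : ∀ᵐ t, Tendsto (fun n => D n t) atTop (𝓝 (D₀ t)))
    (hle : ∀ n, ∫⁻ t, D n t ≤ ∫⁻ t, D₀ t) (hfin : ∫⁻ t, D₀ t ≠ ⊤) :
    Tendsto (fun n => ∫⁻ t, f n t) atTop (𝓝 0) := by
  set K := ∫⁻ t, D₀ t with hK
  have hsum : ∀ n, (∫⁻ t, f n t) + ∫⁻ t, (D n t - f n t) ≤ K := fun n => by
    rw [← lintegral_add_left' (hf n)]
    refine le_trans (le_of_eq (lintegral_congr_ae ?_)) (hle n)
    filter_upwards [hfD n] with t ht using add_tsub_cancel_of_le ht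
  -- Fatou's lemma for `D n - f n`, which tends to `D₀`: these differences already carry the whole
  -- mass `K` in the limit, leaving none for `f n`.
  have hfatou : K ≤ liminf (fun n => ∫⁻ t, (D n t - f n t)) atTop := by
    refine le_trans (le_of_eq (lintegral_congr_ae ?_))
      (lintegral_liminf_le' fun n => (hD n).sub (hf n))
    filter_upwards [hf0, hDD] with t h0 h1
    have := ENNReal.Tendsto.sub h1 h0 (Or.inr ENNReal.zero_ne_top)
    rw [tsub_zero] at this
    exact this.liminf_eq.symm
  rw [ENNReal.tendsto_nhds_zero]
  intro ε hε
  rcases eq_or_ne K 0 with h0 | h0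
  · exact .of_forall fun n => (le_self_add.trans (hsum n)).trans (h0.trans_le zero_le)
  · have hlt : K - ε < liminf (fun n => ∫⁻ t, (D n t - f n t)) atTop :=
      (ENNReal.sub_lt_self hfin h0 hε.ne').trans_le hfatou
    filter_upwards [eventually_lt_of_lt_liminf hlt] with n hn
    have hne : K - ε ≠ ⊤ := ne_top_of_le_ne_top hfin tsub_le_self
    refine ENNReal.le_of_add_le_add_right hne ?_
    calc _ ≤ (∫⁻ t, f n t) + ∫⁻ t, (D n t - f n t) := add_le_add_right hn.le _
      _ ≤ K := hsum n
      _ ≤ ε + (K - ε) := le_add_tsub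

end Convergence

/-! ### Boundary values of `H^p`: pointwise and in `L^p` -/

section Boundary

theorem lintegral_ofReal_inv_one_add_sq :
    ∫⁻ t : ℝ, ENNReal.ofReal (1 + t ^ 2)⁻¹ = ENNReal.ofReal Real.pi := by
  rw [← integral_univ_inv_one_add_sq, ofReal_integral_eq_lintegral_ofReal
    integrable_inv_one_add_sq (.of_forall fun t => by positivity)]

/-- The closed right half-plane meets the branch cut only at 0, where a positive power is continuous
because its norm is. Boundary values of the majorant are only known to have nonnegative real part.
-/
theorem tendsto_cpow_of_re_nonneg {ι : Type*} {l : Filter ι} {G : ι → ℂ} {a : ℂ} {s : ℝ}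
    (hs : 0 < s) (ha : 0 ≤ a.re) (h : Tendsto G l (𝓝 a)) :
    Tendsto (fun i => G i ^ (s : ℂ)) l (𝓝 (a ^ (s : ℂ))) := by
  rcases eq_or_ne a 0 with rfl | h0
  · rw [Complex.zero_cpow (by exact_mod_cast hs.ne'), tendsto_zero_iff_norm_tendsto_zero]
    simp_rw [Complex.norm_cpow_real]
    have := h.norm.rpow_const (p := s) (Or.inr hs.le)
    rwa [norm_zero, Real.zero_rpow hs.ne'] at this
  · have hsl : a ∈ Complex.slitPlane := by
      rw [Complex.mem_slitPlane_iff]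
      rcases ha.lt_or_eq with h1 | h1
      · exact Or.inl h1
      · exact Or.inr fun h2 => h0 (Complex.ext h1.symm h2)
    exact (continuousAt_cpow_const hsl).tendsto.comp h

theorem cone_neBot (t₀ : ℝ) {α : ℝ} (hα : 0 < α) :
    (𝓝[{z : ℝ × ℝ | 0 < z.1 ∧ |z.2 - t₀| < α * z.1}] ((0 : ℝ), t₀)).NeBot := by
  have : Tendsto (fun x : ℝ => (x, t₀)) (𝓝[>] 0)
      (𝓝[{z : ℝ × ℝ | 0 < z.1 ∧ |z.2 - t₀| < α * z.1}] ((0 : ℝ), t₀)) := by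
    refine tendsto_nhdsWithin_iff.2 ⟨?_, ?_⟩
    · exact ((Continuous.prodMk_left t₀).tendsto 0).mono_left nhdsWithin_le_nhds
    · filter_upwards [self_mem_nhdsWithin] with x hx
      have hx : 0 < x := hx
      exact ⟨hx, by simpa using mul_pos hα hx⟩
  exact this.neBot

theorem tendsto_cone_radial {X : Type*} {f : ℝ × ℝ → X} {l : Filter X} {t₀ : ℝ} {x : ℕ → ℝ}
    (hx : ∀ n, 0 < x n) (hx0 : Tendsto x atTop (𝓝 0)) {α : ℝ} (hα : 0 < α)
    (h : Tendsto f (𝓝[{z : ℝ × ℝ | 0 < z.1 ∧ |z.2 - t₀| < α * z.1}] ((0 : ℝ), t₀)) l) :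
    Tendsto (fun n => f (x n, t₀)) atTop l := by
  refine h.comp (tendsto_nhdsWithin_iff.2 ⟨?_, .of_forall fun n => ⟨hx n, ?_⟩⟩)
  · exact ((Continuous.prodMk_left t₀).tendsto 0).comp hx0
  · simpa using mul_pos hα (hx n)

variable {E : Type*} [NormedAddCommGroup E] [InnerProductSpace ℂ E] [CompleteSpace E]
  {F : ℂ → E} {p : ℝ}

/-- Functions in `H^p` have non-tangential limits almost everywhere. -/
theorem MemHardy.exists_boundary (hp : 1 ≤ p) (hp2 : p ≤ 2) (hF : MemHardy p F) :
    ∃ g : ℝ → E, ∀ᵐ t₀ : ℝ, ∀ α : ℝ, 0 < α →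
      Tendsto (fun z : ℝ × ℝ => F (z.1 + z.2 * Complex.I))
        (𝓝[{z : ℝ × ℝ | 0 < z.1 ∧ |z.2 - t₀| < α * z.1}] (0, t₀)) (𝓝 (g t₀)) := by
  have hp0 : 0 < p := by linarith
  obtain ⟨G, hG, hGre, hFG⟩ := hF.exists_majorant hp hp2
  obtain ⟨γ, -, hγ, -⟩ := hG.exists_boundary_two
  -- The quotient of `F` by `G^(2/p)` is bounded by 1; the factor `(1 + z)⁻¹` makes it square
  -- integrable on vertical lines, with squared norm at most `π`.
  set B : ℂ → E := fun z => ((1 + z)⁻¹ * (G z) ^ ((-(2 / p) : ℝ) : ℂ)) • F z with hB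
  have hne : ∀ z : ℂ, 0 < z.re → 1 + z ≠ 0 := fun z hz =>
    ne_zero_of_re_pos (by simp; linarith)
  have hBH : MemHardy 2 B := by
    refine ⟨DifferentiableOn.smul (DifferentiableOn.mul (fun z hz => ?_) ?_)
      hF.differentiableOn, Real.pi.toNNReal, fun u hu => ?_⟩
    · exact ((differentiableAt_id.const_add 1).inv (hne z hz)).differentiableWithinAt
    · exact hG.differentiableOn.cpow_const fun z hz =>
        Complex.mem_slitPlane_iff.2 (Or.inl (hGre z hz))
    · change _ ≤ ENNReal.ofReal Real.pi
      rw [← lintegral_ofReal_inv_one_add_sq]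
      refine lintegral_mono fun v => ?_
      have hz : 0 < (u + v * Complex.I : ℂ).re := by simpa
      have hGpos : 0 < ‖G (u + v * Complex.I)‖ := norm_pos_iff.2 (ne_zero_of_re_pos (hGre _ hz))
      have h1 : ‖B (u + v * Complex.I)‖ ≤ ‖1 + (u + v * Complex.I : ℂ)‖⁻¹ := by
        rw [hB, norm_smul, norm_mul, norm_inv, Complex.norm_cpow_real, mul_assoc]
        refine mul_le_of_le_one_right (by positivity) ?_
        have h2 := hFG _ hz
        rw [Real.rpow_neg hGpos.le, inv_mul_le_iff₀ (by positivity), mul_one,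
          show 2 / p = (p / 2)⁻¹ from (inv_div p 2).symm,
          Real.le_rpow_inv_iff_of_pos (norm_nonneg _) hGpos.le (by positivity)]
        exact h2
      rw [← ofReal_norm, ENNReal.ofReal_rpow_of_nonneg (norm_nonneg _) zero_le_two]
      refine ENNReal.ofReal_le_ofReal ?_
      rw [Real.rpow_two]
      refine (pow_le_pow_left₀ (norm_nonneg _) h1 2).trans ?_
      rw [inv_pow]
      refine inv_anti₀ (by positivity) ?_
      have h3 : (1 + (u + v * Complex.I) : ℂ) = ((1 + u : ℝ) : ℂ) + v * Complex.I := by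
        push_cast
        ring
      rw [h3, Complex.sq_norm, Complex.normSq_add_mul_I]
      nlinarith
  obtain ⟨β, -, hβ, -⟩ := hBH.exists_boundary_two
  refine ⟨fun t => ((1 + t * Complex.I) * γ t ^ ((2 / p : ℝ) : ℂ)) • β t, ?_⟩
  filter_upwards [hγ, hβ] with t₀ h1 h2 α hα
  have := cone_neBot t₀ hα
  have hre : 0 ≤ (γ t₀).re := by
    refine ge_of_tendsto ((Complex.continuous_re.tendsto _).comp (h1 α)) ?_
    filter_upwards [self_mem_nhdsWithin] with z hz
    exact (hGre _ (by simpa using hz.1)).le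
  -- Recovering `F` from `B` uses the positive power of `G`, so a zero of the boundary function `γ`
  -- does no harm.
  have h3 := tendsto_cpow_of_re_nonneg (s := 2 / p) (by positivity) hre (h1 α)
  have h4 : Tendsto (fun z : ℝ × ℝ => (1 : ℂ) + (z.1 + z.2 * Complex.I))
      (𝓝[{z : ℝ × ℝ | 0 < z.1 ∧ |z.2 - t₀| < α * z.1}] (0, t₀)) (𝓝 (1 + t₀ * Complex.I)) := by
    refine ((by fun_prop : Continuous fun z : ℝ × ℝ =>
      (1 : ℂ) + (z.1 + z.2 * Complex.I)).tendsto' _ _ ?_).mono_left nhdsWithin_le_nhds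
    simp
  refine ((h4.mul h3).smul (h2 α)).congr' ?_
  filter_upwards [self_mem_nhdsWithin] with z hz
  have hz1 : 0 < (z.1 + z.2 * Complex.I : ℂ).re := by simpa using hz.1
  have hG0 := ne_zero_of_re_pos (hGre _ hz1)
  rw [hB, smul_smul, Complex.ofReal_neg, Complex.cpow_neg]
  have hcp : G (z.1 + z.2 * Complex.I) ^ ((2 / p : ℝ) : ℂ) ≠ 0 := by
    rw [Ne, Complex.cpow_eq_zero_iff]
    exact fun h => hG0 h.1
  have := hne _ hz1
  rw [mul_mul_mul_comm, mul_inv_cancel₀ this, mul_inv_cancel₀ hcp, one_mul, one_smul]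

/-- The functions on lines converge in `L^p` to the boundary function. -/
theorem MemHardy.tendsto_eLpNorm (hp : 1 ≤ p) (hp2 : p ≤ 2) (hF : MemHardy p F) {x : ℕ → ℝ}
    (hx : ∀ n, 0 < x n) (hx0 : Tendsto x atTop (𝓝 0)) {g : ℝ → E}
    (hg : ∀ᵐ t : ℝ, Tendsto (fun n => F (x n + t * Complex.I)) atTop (𝓝 (g t))) :
    MemLp g (ENNReal.ofReal p) ∧
      Tendsto (fun n => eLpNorm (g - fun t : ℝ => F (x n + t * Complex.I)) (ENNReal.ofReal p) volume)
        atTop (𝓝 0) := by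
  have hp0 : 0 < p := by linarith
  have hp0' : ENNReal.ofReal p ≠ 0 := by simpa using hp0
  obtain ⟨G, hG, -, hFG⟩ := hF.exists_majorant hp hp2
  obtain ⟨γ, hγ2, hγ, hγle⟩ := hG.exists_boundary_two
  have hFc : ∀ n, Continuous fun t : ℝ => F (x n + t * Complex.I) := fun n =>
    continuous_comp_verticalLine hF.differentiableOn (hx n)
  have hGc : ∀ n, Continuous fun t : ℝ => G (x n + t * Complex.I) := fun n =>
    continuous_comp_verticalLine hG.differentiableOn (hx n)
  have hgm : AEStronglyMeasurable g := aestronglyMeasurable_of_tendsto_ae atTop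
    (fun n => (hFc n).aestronglyMeasurable) hg
  have hle : ∀ n (t : ℝ), ‖F (x n + t * Complex.I)‖ₑ ^ p ≤ ‖G (x n + t * Complex.I)‖ₑ ^ (2 : ℝ) :=
    fun n t => by
      have h1 := hFG (x n + t * Complex.I) (by simpa using hx n)
      have h2 := ENNReal.rpow_le_rpow (ENNReal.ofReal_le_ofReal h1) zero_le_two
      rwa [← ENNReal.ofReal_rpow_of_nonneg (norm_nonneg _) (by positivity), ← ENNReal.rpow_mul,
        div_mul_cancel₀ _ two_ne_zero, ofReal_norm, ofReal_norm] at h2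
  have hGlim : ∀ᵐ t : ℝ, Tendsto (fun n => ‖G (x n + t * Complex.I)‖ₑ ^ (2 : ℝ)) atTop
      (𝓝 (‖γ t‖ₑ ^ (2 : ℝ))) := by
    filter_upwards [hγ] with t ht
    exact (ENNReal.continuous_rpow_const.tendsto _).comp
      (tendsto_cone_radial hx hx0 one_pos (ht 1)).enorm
  have hgγ : ∀ᵐ t : ℝ, ‖g t‖ₑ ^ p ≤ ‖γ t‖ₑ ^ (2 : ℝ) := by
    filter_upwards [hGlim, hg] with t h1 h2
    exact le_of_tendsto_of_tendsto' ((ENNReal.continuous_rpow_const.tendsto _).comp h2.enorm) h1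
      fun n => hle n t
  have hfin : ∫⁻ t, ‖γ t‖ₑ ^ (2 : ℝ) ≠ ⊤ := by
    simpa using ((eLpNorm_lt_top_iff_lintegral_rpow_enorm_lt_top two_ne_zero
      ENNReal.ofNat_ne_top).1 hγ2.2).ne
  have hgL : MemLp g (ENNReal.ofReal p) := by
    refine ⟨hgm, ?_⟩
    rw [eLpNorm_lt_top_iff_lintegral_rpow_enorm_lt_top hp0' ENNReal.ofReal_ne_top,
      ENNReal.toReal_ofReal hp0.le]
    exact (lintegral_mono_ae hgγ).trans_lt hfin.lt_top
  refine ⟨hgL, ?_⟩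
  have hγm : AEMeasurable fun t => ‖γ t‖ₑ ^ (2 : ℝ) := hγ2.1.enorm.pow_const _
  have key : Tendsto (fun n => ∫⁻ t, ‖g t - F (x n + t * Complex.I)‖ₑ ^ p) atTop (𝓝 0) := by
    -- The dominating functions come from `‖F‖^p ≤ ‖G‖²` and vary with `n`. Their integrals do not
    -- exceed that of the limit because the Poisson integral contracts `L²`.
    refine tendsto_lintegral_zero_of_le
      (D := fun n t => 2 ^ (p - 1) * (‖γ t‖ₑ ^ (2 : ℝ) + ‖G (x n + t * Complex.I)‖ₑ ^ (2 : ℝ)))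
      (D₀ := fun t => 2 ^ (p - 1) * (‖γ t‖ₑ ^ (2 : ℝ) + ‖γ t‖ₑ ^ (2 : ℝ)))
      (fun n => (hgm.sub (hFc n).aestronglyMeasurable).enorm.pow_const _)
      (fun n => (hγm.add ((hGc n).aestronglyMeasurable.enorm.pow_const _)).const_mul _)
      (fun n => ?_) ?_ ?_ (fun n => ?_) ?_
    · filter_upwards [hgγ] with t ht
      refine (ENNReal.rpow_le_rpow enorm_sub_le hp0.le).trans ?_
      refine (ENNReal.rpow_add_le_mul_rpow_add_rpow _ _ hp).trans ?_
      exact mul_le_mul' le_rfl (add_le_add ht (hle n t))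
    · filter_upwards [hg] with t ht
      have h1 : Tendsto (fun n => g t - F (x n + t * Complex.I)) atTop (𝓝 0) := by
        simpa using ht.const_sub (g t)
      have h2 := (ENNReal.continuous_rpow_const (y := p)).tendsto _ |>.comp h1.enorm
      rwa [enorm_zero, ENNReal.zero_rpow_of_pos hp0] at h2
    · filter_upwards [hGlim] with t ht
      exact ENNReal.Tendsto.const_mul (tendsto_const_nhds.add ht)
        (Or.inr (ENNReal.rpow_ne_top_of_nonneg (by linarith) ENNReal.ofNat_ne_top))
    · have hc : (2 : ℝ≥0∞) ^ (p - 1) ≠ ⊤ :=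
        ENNReal.rpow_ne_top_of_nonneg (by linarith) ENNReal.ofNat_ne_top
      rw [lintegral_const_mul' _ _ hc, lintegral_const_mul' _ _ hc, lintegral_add_left' hγm,
        lintegral_add_left' hγm]
      exact mul_le_mul' le_rfl (add_le_add le_rfl (hγle _ (hx n)))
    · rw [lintegral_const_mul' _ _ (ENNReal.rpow_ne_top_of_nonneg (by linarith)
        ENNReal.ofNat_ne_top), lintegral_add_left' hγm]
      exact ENNReal.mul_ne_top (ENNReal.rpow_ne_top_of_nonneg (by linarith)
        ENNReal.ofNat_ne_top) (ENNReal.add_ne_top.2 ⟨hfin, hfin⟩)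
  have h2 := (ENNReal.continuous_rpow_const (y := 1 / p)).tendsto _ |>.comp key
  rw [ENNReal.zero_rpow_of_pos (by positivity)] at h2
  refine h2.congr fun n => ?_
  rw [eLpNorm_eq_lintegral_rpow_enorm_toReal hp0' ENNReal.ofReal_ne_top,
    ENNReal.toReal_ofReal hp0.le]
  rfl

end Boundary

/-! ### Injectivity of the Fourier and Laplace transforms -/

section Uniqueness

variable {E : Type*} [NormedAddCommGroup E] [NormedSpace ℂ E] [CompleteSpace E]

/-- Injectivity of the Fourier transform on `L¹`. -/
theorem ae_eq_zero_of_ft_eq_zero {φ : ℝ → E} (hφ : Integrable φ) (h : ∀ w, ft φ w = 0) :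
    φ =ᵐ[volume] 0 := by
  have hF : ∀ w, 𝓕 φ w = 0 := fun w => by
    have h1 := h (2 * Real.pi * w)
    rw [ft_eq_fourier, inv_mul_cancel_left₀ (by positivity), smul_eq_zero] at h1
    exact h1.resolve_left (inv_ne_zero sqrt_two_pi_ne_zero)
  refine ae_eq_zero_of_integral_contDiff_smul_eq_zero hφ.locallyIntegrable fun ψ hψ hψc => ?_
  have hd : ContDiff ℝ ∞ fun x => (ψ x : ℂ) := Complex.ofRealCLM.contDiff.comp hψ
  have hdc : HasCompactSupport fun x => (ψ x : ℂ) := hψc.comp_left Complex.ofReal_zero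
  set Ψ : 𝓢(ℝ, ℂ) := hdc.toSchwartzMap hd with hΨ
  -- Every test function is the Fourier transform of a Schwartz function, so the multiplication
  -- formula moves the transform onto `φ`.
  have h1 : (Ψ : ℝ → ℂ) = 𝓕 ((𝓕⁻ Ψ : 𝓢(ℝ, ℂ)) : ℝ → ℂ) := by
    rw [← SchwartzMap.fourier_coe, FourierTransform.fourier_fourierInv_eq]
  have h2 := VectorFourier.integral_fourierIntegral_smul_eq_flip (L := innerₗ ℝ)
    Real.continuous_fourierChar continuous_inner ((𝓕⁻ Ψ : 𝓢(ℝ, ℂ)).integrable (μ := volume)) hφ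
  rw [flip_innerₗ] at h2
  have h3 : ∫ x, Ψ x • φ x = ∫ x, (𝓕⁻ Ψ : 𝓢(ℝ, ℂ)) x • 𝓕 φ x := by
    rw [h1]
    exact h2
  simp_rw [hF, smul_zero, integral_zero] at h3
  simpa [hΨ] using h3

/-- A function on the positive half-line with vanishing Laplace transform is zero. -/
theorem ae_eq_zero_of_integral_expRight_eq_zero {h : ℝ → E}
    (hi : Integrable fun w => expRight 1 w • h w)
    (h0 : ∀ c : ℂ, 0 < c.re → ∫ w, expRight c w • h w = 0) :
    ∀ᵐ w : ℝ, w ∈ Set.Ioi (0 : ℝ) → h w = 0 := by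
  have := ae_eq_zero_of_ft_eq_zero hi fun w => by
    refine smul_eq_zero_of_right _ ?_
    -- On the line `Re c = 1` the Laplace transform of `h` is the Fourier transform of `e^{-t} h(t)`
    -- on the positive half-line.
    rw [← h0 (1 + w * Complex.I) (by simp)]
    refine integral_congr_ae (.of_forall fun t => ?_)
    simp only
    rw [smul_smul]
    congr 1
    by_cases ht : t ∈ Set.Ioi (0 : ℝ)
    · rw [expRight, expRight, Set.indicator_of_mem ht, Set.indicator_of_mem ht, ← Complex.exp_add]
      congr 1
      ring
    · rw [expRight, expRight, Set.indicator_of_notMem ht, Set.indicator_of_notMem ht, mul_zero]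
  filter_upwards [this] with w hw hw0
  rw [Pi.zero_apply, expRight, Set.indicator_of_mem hw0, smul_eq_zero] at hw
  exact hw.resolve_left (Complex.exp_ne_zero _)

end Uniqueness

/-- The conjugate exponent, infinite for `p = 1`. From `p ≤ 2` it is at least 2, the range in which
the Cauchy kernels are known to lie in `L^q`. -/
theorem exists_holderTriple {p : ℝ} (hp : 1 ≤ p) (hp2 : p ≤ 2) :
    ∃ q : ℝ≥0∞, 2 ≤ q ∧ ENNReal.HolderTriple q (ENNReal.ofReal p) 1 := by
  have h1 : (ENNReal.ofReal p)⁻¹ ≤ 1 := by simpa using hp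
  have h2 : (2 : ℝ≥0∞)⁻¹ ≤ (ENNReal.ofReal p)⁻¹ := by
    rw [ENNReal.inv_le_inv]
    simpa using ENNReal.ofReal_le_ofReal hp2
  refine ⟨(1 - (ENNReal.ofReal p)⁻¹)⁻¹, ?_, ⟨?_⟩⟩
  · rw [ENNReal.le_inv_iff_le_inv, tsub_le_iff_right]
    calc (1 : ℝ≥0∞) = 2⁻¹ + 2⁻¹ := ENNReal.inv_two_add_inv_two.symm
      _ ≤ _ := by gcongr
  · rw [inv_inv, inv_one, tsub_add_cancel_of_le h1]

/-! ### Cauchy and Poisson formulas for the boundary function -/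

section Boundary

variable {E : Type*} [NormedAddCommGroup E] [NormedSpace ℂ E] [CompleteSpace E] {F : ℂ → E} {p : ℝ}

/-- The auxiliary factor `(m + 1) / (it + m + 1)` has modulus at most 1 and tends to 1; with it the
integral vanishes for every `m`, and dominated convergence removes it. -/
theorem MemHardy.integral_inv_eq_zero (hp : 1 ≤ p) (hp2 : p ≤ 2) (hF : MemHardy p F) {ε : ℝ}
    (hε : 0 < ε) {c : ℂ} (hc : 0 < c.re) :
    ∫ t : ℝ, (t * Complex.I + c)⁻¹ • F (ε + t * Complex.I) = 0 := by
  obtain ⟨q, hq, hqp⟩ := exists_holderTriple hp hp2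
  have hint : Integrable fun t : ℝ => (t * Complex.I + c)⁻¹ • F (ε + t * Complex.I) :=
    MemLp.integrable_smul' (memLp_inv_add hc hq) (hF.memLp hp hε)
  have hm : ∀ m : ℕ, 0 < ((m + 1 : ℝ) : ℂ).re := fun m => by
    rw [Complex.ofReal_re]
    positivity
  have hlim := tendsto_integral_of_dominated_convergence (μ := volume)
    (F := fun (m : ℕ) (t : ℝ) => (((m + 1 : ℝ) : ℂ) * (t * Complex.I + (m + 1 : ℝ))⁻¹) •
      ((t * Complex.I + c)⁻¹ • F (ε + t * Complex.I)))
    (f := fun t : ℝ => (t * Complex.I + c)⁻¹ • F (ε + t * Complex.I))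
    (fun t => ‖(t * Complex.I + c)⁻¹ • F (ε + t * Complex.I)‖)
    (fun m => ((memLp_inv_add (hm m) hq).1.const_mul _).smul hint.1) hint.norm
    (fun m => .of_forall fun t => by
      rw [norm_smul]
      refine mul_le_of_le_one_left (norm_nonneg _) ?_
      rw [← div_eq_mul_inv, norm_div]
      refine div_le_one_of_le₀ ?_ (norm_nonneg _)
      have := Complex.abs_re_le_norm (t * Complex.I + (m + 1 : ℝ))
      rw [Complex.norm_real]
      simpa using this)
    (.of_forall fun t => by
      have h1 : Tendsto (fun m : ℕ => ((1 : ℂ) + t * Complex.I * (1 / ((m : ℂ) + 1)))⁻¹) atTop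
          (𝓝 (1 + t * Complex.I * 0)⁻¹) :=
        ((tendsto_one_div_add_atTop_nhds_zero_nat (𝕜 := ℂ)).const_mul _ |>.const_add 1).inv₀
          (by simp)
      rw [mul_zero, add_zero, inv_one] at h1
      have h2 := h1.smul_const ((t * Complex.I + c)⁻¹ • F (ε + t * Complex.I))
      rw [one_smul] at h2
      refine h2.congr fun m => ?_
      congr 1
      have h3 : ((m : ℂ) + 1) ≠ 0 := by exact_mod_cast m.succ_ne_zero
      have h4 := mul_I_add_ne_zero (hm m) t
      push_cast at h4 ⊢
      rw [← div_eq_mul_inv, inv_eq_iff_eq_inv, inv_div]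
      field_simp
      ring)
  refine tendsto_nhds_unique hlim (tendsto_const_nhds.congr fun m => ?_)
  have h := hF.integral_inv_mul_inv_eq_zero hp hε hc (hm m)
  rw [← smul_zero (((m + 1 : ℝ) : ℂ)), ← h, ← integral_smul]
  refine integral_congr_ae (.of_forall fun t => ?_)
  simp only [smul_smul]
  congr 1
  ring

variable {g : ℝ → E}

theorem tendsto_inv_nat_add_one : Tendsto (fun n : ℕ => 1 / ((n : ℝ) + 1)) atTop (𝓝 0) :=
  tendsto_one_div_add_atTop_nhds_zero_nat

/-- The boundary function of `F` as a limit in `L^p`. -/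
def IsLpBoundary (p : ℝ) (F : ℂ → E) (g : ℝ → E) : Prop :=
  MemLp g (ENNReal.ofReal p) ∧
    Tendsto (fun n : ℕ => eLpNorm (g - fun t : ℝ => F ((1 / ((n : ℝ) + 1) : ℝ) + t * Complex.I))
      (ENNReal.ofReal p) volume) atTop (𝓝 0)

theorem MemHardy.integral_inv_smul_boundary_eq_zero (hp : 1 ≤ p) (hp2 : p ≤ 2)
    (hF : MemHardy p F) (hg : IsLpBoundary p F g) {c : ℂ} (hc : 0 < c.re) :
    ∫ t : ℝ, (t * Complex.I + c)⁻¹ • g t = 0 := by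
  obtain ⟨q, hq, hqp⟩ := exists_holderTriple hp hp2
  have hx : ∀ n : ℕ, (0 : ℝ) < 1 / ((n : ℝ) + 1) := fun n => Nat.one_div_pos_of_nat
  have := tendsto_integral_smul_of_tendsto_eLpNorm (memLp_inv_add hc hq) hg.1
    (.of_forall fun n => hF.memLp hp (hx n)) hg.2
  simp_rw [hF.integral_inv_eq_zero hp hp2 (hx _) hc] at this
  exact tendsto_nhds_unique this tendsto_const_nhds

/-- Functions in `H^p` are the Poisson integrals of their boundary functions. -/
theorem MemHardy.eq_integral_poissonKernel_boundary (hp : 1 ≤ p) (hp2 : p ≤ 2)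
    (hF : MemHardy p F) (hg : IsLpBoundary p F g) {u : ℝ} (hu : 0 < u) (v : ℝ) :
    F (u + v * Complex.I) = ∫ t : ℝ, (poissonKernel u v t : ℂ) • g t := by
  obtain ⟨q, hq, hqp⟩ := exists_holderTriple hp hp2
  have hx : ∀ n : ℕ, (0 : ℝ) < 1 / ((n : ℝ) + 1) := fun n => Nat.one_div_pos_of_nat
  have h1 := tendsto_integral_smul_of_tendsto_eLpNorm
    (memLp_poissonKernel hu v (one_le_two.trans hq)) hg.1
    (.of_forall fun n => hF.memLp hp (hx n)) hg.2
  simp_rw [← hF.eq_integral_poissonKernel hp (hx _) hu v] at h1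
  have h2 : ContinuousAt F (u + v * Complex.I) :=
    (hF.differentiableOn.differentiableAt (isOpen_rightHalfPlane.mem_nhds
      (by simpa))).continuousAt
  refine tendsto_nhds_unique (h2.tendsto.comp ?_) h1
  have h3 : Tendsto (fun n : ℕ => ((1 / ((n : ℝ) + 1) : ℝ) : ℂ) + (u + v * Complex.I)) atTop
      (𝓝 ((0 : ℝ) + (u + v * Complex.I))) :=
    ((Complex.continuous_ofReal.tendsto _).comp tendsto_inv_nat_add_one).add_const _
  rw [Complex.ofReal_zero, zero_add] at h3
  refine h3.congr fun n => ?_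
  push_cast
  ring

/-- Cauchy's formula for the boundary function. -/
theorem MemHardy.integral_inv_sub_smul_boundary (hp : 1 ≤ p) (hp2 : p ≤ 2)
    (hF : MemHardy p F) (hg : IsLpBoundary p F g) {u : ℝ} (hu : 0 < u) (v : ℝ) :
    ∫ t : ℝ, ((u + v * Complex.I : ℂ) - t * Complex.I)⁻¹ • g t =
      (2 * Real.pi : ℂ) • F (u + v * Complex.I) := by
  obtain ⟨q, hq, hqp⟩ := exists_holderTriple hp hp2
  have hz : 0 < (u + v * Complex.I : ℂ).re := by simpa
  have hz' : 0 < (u - v * Complex.I : ℂ).re := by simpa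
  -- With `c` the conjugate of `z` this vanishing integral may be added freely, and `(z - it)⁻¹ +
  -- (it + c)⁻¹` is `2π` times the Poisson kernel.
  have h0 := hF.integral_inv_smul_boundary_eq_zero hp hp2 hg hz'
  rw [hF.eq_integral_poissonKernel_boundary hp hp2 hg hu v, ← integral_smul,
    ← add_zero (∫ t : ℝ, _), ← h0, ← integral_add
      (MemLp.integrable_smul' (memLp_inv_sub hz hq) hg.1)
      (MemLp.integrable_smul' (memLp_inv_add hz' hq) hg.1)]
  refine integral_congr_ae (.of_forall fun t => ?_)
  simp only
  rw [← add_smul, smul_smul, poissonKernel_eq_complex]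
  congr 1
  have h1 := sub_mul_I_ne_zero hz t
  have h2 := mul_I_add_ne_zero hz' t
  have hpi : (Real.pi : ℂ) ≠ 0 := by exact_mod_cast Real.pi_ne_zero
  have h3 : (u + v * Complex.I - t * Complex.I : ℂ) + (t * Complex.I + (u - v * Complex.I)) =
      2 * u := by ring
  rw [← neg_sub (u + v * Complex.I : ℂ), inv_neg, inv_add_inv h1 h2, h3]
  generalize (u + v * Complex.I - t * Complex.I : ℂ) = a at *
  generalize (t * Complex.I + (u - v * Complex.I) : ℂ) = b at *
  field_simp

end Boundary

/-! ### The Paley-Wiener theorem for `E`-valued `H^p` -/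

section PaleyWiener

variable {E : Type*} [NormedAddCommGroup E] [InnerProductSpace ℂ E] [CompleteSpace E]
  {F : ℂ → E} {p : ℝ} {g h : ℝ → E}

/-- The Fourier transform of the boundary function of `F ∈ H^p` vanishes on the positive
half-line. -/
theorem MemHardy.isFT_eq_zero (hp : 1 ≤ p) (hp2 : p ≤ 2) (hF : MemHardy p F)
    (hg : IsLpBoundary p F g) (hgh : IsFT g h) :
    ∀ᵐ w : ℝ, w ∈ Set.Ioi (0 : ℝ) → h w = 0 := by
  refine ae_eq_zero_of_integral_expRight_eq_zero
    (hgh.integral_smul (integrable_expRight (by simp)) (memLp_expRight (by simp))).1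
    fun c hc => ?_
  -- The multiplication formula turns the Laplace integral of `h` into a Cauchy integral of `g` with
  -- its pole `-c` in the left half-plane.
  rw [(hgh.integral_smul (integrable_expRight hc) (memLp_expRight hc)).2.2]
  simp_rw [ft_expRight hc, mul_smul, integral_smul]
  rw [hF.integral_inv_smul_boundary_eq_zero hp hp2 hg hc, smul_zero]

/-- The Paley–Wiener representation of `F ∈ H^p`. -/
theorem MemHardy.eq_integral_isFT (hp : 1 ≤ p) (hp2 : p ≤ 2) (hF : MemHardy p F)
    (hg : IsLpBoundary p F g) (hgh : IsFT g h) {u : ℝ} (hu : 0 < u) (v : ℝ) :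
    IntegrableOn (fun w : ℝ => Complex.exp ((u + v * Complex.I) * w) • h w) (Set.Iic 0) ∧
      F (u + v * Complex.I) = ((√(2 * Real.pi))⁻¹ : ℂ) •
        ∫ w in Set.Iic (0 : ℝ), Complex.exp ((u + v * Complex.I) * w) • h w := by
  have hz : 0 < (u + v * Complex.I : ℂ).re := by simpa
  obtain ⟨h1, -, h2⟩ := hgh.integral_smul (integrable_expLeft hz) (memLp_expLeft hz)
  have h3 : (fun w => expLeft (u + v * Complex.I) w • h w) =
      (Set.Iic 0).indicator fun w : ℝ => Complex.exp ((u + v * Complex.I) * w) • h w := by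
    funext w
    rw [expLeft, Set.indicator_smul_apply_left]
  rw [h3] at h1 h2
  refine ⟨(integrable_indicator_iff measurableSet_Iic).1 h1, ?_⟩
  rw [integral_indicator measurableSet_Iic] at h2
  simp_rw [ft_expLeft hz, mul_smul, integral_smul] at h2
  rw [h2, hF.integral_inv_sub_smul_boundary hp hp2 hg hu v, smul_smul, smul_smul,
    ← sqrt_two_pi_mul_self]
  have := sqrt_two_pi_ne_zero
  rw [mul_mul_mul_comm, inv_mul_cancel₀ this, one_mul, one_smul]

end PaleyWiener

/-! ### Transfer between the Clifford algebra and a complex Euclidean space -/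

section Transfer

variable {n : ℕ}

/-- Left multiplication by the slice `L_J` makes the Clifford algebra a finite-dimensional complex
vector space. -/
theorem exists_sliceEquiv (J : ImagUnit n) :
    ∃ (m : ℕ) (e : Cl n ≃L[ℝ] EuclideanSpace ℂ (Fin m)),
      ∀ (z : ℂ) (a : Cl n), e (sliceEmb J z * a) = z • e a := by
  let _ : Module ℂ (Cl n) := Module.compHom (Cl n) (sliceEmb J).toRingHom
  have hsmul : ∀ (z : ℂ) (a : Cl n), z • a = sliceEmb J z * a := fun z a => rfl
  have : IsScalarTower ℝ ℂ (Cl n) := ⟨fun r z a => by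
    rw [hsmul, hsmul, map_smul, smul_mul_assoc]⟩
  have : Module.Finite ℂ (Cl n) := Module.Finite.of_restrictScalars_finite ℝ ℂ (Cl n)
  let e₀ : Cl n ≃ₗ[ℂ] EuclideanSpace ℂ (Fin (Module.finrank ℂ (Cl n))) :=
    (Module.finBasis ℂ (Cl n)).equivFun.trans (WithLp.linearEquiv 2 ℂ _).symm
  refine ⟨_, (e₀.restrictScalars ℝ).toContinuousLinearEquiv, fun z a => ?_⟩
  exact e₀.map_smul z a

theorem sliceEmb_I (J : ImagUnit n) :
    sliceEmb J Complex.I = vec (J : EuclideanSpace ℝ (Fin n)) := by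
  simp [sliceEmb]

variable {E : Type*} [NormedAddCommGroup E] [InnerProductSpace ℂ E]
  {f : Paravector n → Cl n} {J : ImagUnit n} {e : Cl n ≃L[ℝ] E}

/-- The restriction of `f` to the slice `L_J`, as a function of a complex variable. -/
noncomputable def sliceFun (e : Cl n ≃L[ℝ] E) (J : ImagUnit n) (f : Paravector n → Cl n) (z : ℂ) : E :=
  e (f (slicePoint J z.re z.im))

theorem sliceFun_add_mul_I (u v : ℝ) :
    sliceFun e J f (u + v * Complex.I) = e (f (slicePoint J u v)) := by
  simp [sliceFun]

/-- Under `e`, left multiplication by `J` is multiplication by `i`, so the slice equation says that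
the real derivative is complex linear. -/
theorem differentiableOn_sliceFun
    (he : ∀ (z : ℂ) (a : Cl n), e (sliceEmb J z * a) = z • e a) (hf : LeftSliceMonogenicOn f (rightHalfSpace n)) :
    DifferentiableOn ℂ (sliceFun e J f) {z | 0 < z.re} := by
  intro z hz
  have hz : 0 < z.re := hz
  have hopen : IsOpen (rightHalfSpace n) := isOpen_lt continuous_const continuous_fst
  have hmem : slicePoint J z.re z.im ∈ rightHalfSpace n := hz
  have hA := (hf.differentiableOn.differentiableAt (hopen.mem_nhds hmem)).hasFDerivAt
  set A := fderiv ℝ f (slicePoint J z.re z.im) with hAdef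
  have d1 : HasDerivAt (fun s : ℝ => slicePoint J s z.im) (1, 0) z.re :=
    (hasDerivAt_id _).prodMk (hasDerivAt_const _ _)
  have d2 : HasDerivAt (fun t : ℝ => slicePoint J z.re t)
      (0, (J : EuclideanSpace ℝ (Fin n))) z.im := by
    have := (hasDerivAt_id z.im).smul_const (J : EuclideanSpace ℝ (Fin n))
    rw [one_smul] at this
    exact (hasDerivAt_const _ _).prodMk this
  have hCR := hf.cauchyRiemann J z.re z.im hmem
  have e1 := (HasFDerivAt.comp_hasDerivAt z.re hA d1).deriv
  have e2 := (HasFDerivAt.comp_hasDerivAt z.im hA d2).deriv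
  simp only [Function.comp_def] at e1 e2
  rw [e1, e2, smul_eq_zero, or_iff_right (by norm_num), ← sliceEmb_I] at hCR
  have hCR' := congrArg e hCR
  rw [map_add, he, map_zero] at hCR'
  let L : ℂ →L[ℝ] Paravector n :=
    Complex.reCLM.prod (Complex.imCLM.smulRight (J : EuclideanSpace ℝ (Fin n)))
  have hL : HasFDerivAt (sliceFun e J f) ((e : Cl n →L[ℝ] E).comp (A.comp L)) z :=
    (e : Cl n →L[ℝ] E).hasFDerivAt.comp z (HasFDerivAt.comp z hA L.hasFDerivAt)
  refine (differentiableAt_complex_iff_differentiableAt_real.2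
    ⟨hL.differentiableAt, ?_⟩).differentiableWithinAt
  rw [hL.fderiv]
  have l1 : L 1 = (1, 0) := by simp [L]
  have l2 : L Complex.I = (0, (J : EuclideanSpace ℝ (Fin n))) := by simp [L]
  simp only [ContinuousLinearMap.comp_apply, l1, l2, ContinuousLinearEquiv.coe_coe]
  rw [eq_neg_of_add_eq_zero_left hCR', smul_neg, smul_smul, Complex.I_mul_I, neg_one_smul, neg_neg]

theorem memHardy_sliceFun
    (he : ∀ (z : ℂ) (a : Cl n), e (sliceEmb J z * a) = z • e a) {p : ℝ} (hp : 1 ≤ p) (hf : MemSliceHardy p f) :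
    MemHardy p (sliceFun e J f) := by
  refine ⟨differentiableOn_sliceFun he hf.monogenic, ?_⟩
  set S := ⨆ (I : ImagUnit n) (u : ℝ) (_ : 0 < u), ∫⁻ v : ℝ, ‖f (slicePoint I u v)‖ₑ ^ p
  have hK : ‖(e : Cl n →L[ℝ] E)‖ₑ ^ p ≠ ⊤ :=
    ENNReal.rpow_ne_top_of_nonneg (by linarith) enorm_ne_top
  have hS : ‖(e : Cl n →L[ℝ] E)‖ₑ ^ p * S ≠ ⊤ := ENNReal.mul_ne_top hK hf.bounded.ne
  refine ⟨(‖(e : Cl n →L[ℝ] E)‖ₑ ^ p * S).toNNReal, fun u hu => ?_⟩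
  rw [ENNReal.coe_toNNReal hS]
  calc ∫⁻ v : ℝ, ‖sliceFun e J f (u + v * Complex.I)‖ₑ ^ p
      ≤ ∫⁻ v : ℝ, ‖(e : Cl n →L[ℝ] E)‖ₑ ^ p * ‖f (slicePoint J u v)‖ₑ ^ p := by
        refine lintegral_mono fun v => ?_
        rw [sliceFun_add_mul_I, ← ENNReal.mul_rpow_of_nonneg _ _ (by linarith)]
        exact ENNReal.rpow_le_rpow ((e : Cl n →L[ℝ] E).le_opENorm _) (by linarith)
    _ = ‖(e : Cl n →L[ℝ] E)‖ₑ ^ p * ∫⁻ v : ℝ, ‖f (slicePoint J u v)‖ₑ ^ p :=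
        lintegral_const_mul' _ _ hK
    _ ≤ _ := by
        gcongr
        exact le_iSup_of_le J (le_iSup_of_le u (le_iSup_of_le hu le_rfl))

theorem hasNonTangentialLimit_iff {v : ℝ} {a : Cl n} :
    HasNonTangentialLimit f J v a ↔ ∀ α : ℝ, 0 < α →
      Tendsto (fun z : ℝ × ℝ => sliceFun e J f (z.1 + z.2 * Complex.I))
        (𝓝[{z : ℝ × ℝ | 0 < z.1 ∧ |z.2 - v| < α * z.1}] (0, v)) (𝓝 (e a)) := by
  refine forall₂_congr fun α hα => ?_
  simp_rw [sliceFun_add_mul_I]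
  exact e.toHomeomorph.isInducing.tendsto_nhds_iff

theorem memLp_comp_iff {g : ℝ → Cl n} {q : ℝ≥0∞} :
    MemLp (fun t => e (g t)) q ↔ MemLp g q := by
  refine ⟨fun h => ?_, fun h => (e : Cl n →L[ℝ] E).comp_memLp' h⟩
  simpa [Function.comp_def] using (e.symm : E →L[ℝ] Cl n).comp_memLp' h

/-- The kernel `e^{-Jtw}` stands to the left of `g`, which is exactly where `e` turns it into the
scalar `e^{-itw}`. -/
theorem ft_comp
    (he : ∀ (z : ℂ) (a : Cl n), e (sliceEmb J z * a) = z • e a) (g : ℝ → Cl n) (w : ℝ) :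
    ft (fun t => e (g t)) w = e (fourierInt J g w) := by
  rw [ft, fourierInt, map_smul, ← e.integral_comp_comm]
  simp_rw [he]
  rw [← Complex.coe_smul, Complex.ofReal_inv]

theorem isFTL2_comp_iff
    (he : ∀ (z : ℂ) (a : Cl n), e (sliceEmb J z * a) = z • e a) {g h : ℝ → Cl n} :
    IsFTL2 (fun t => e (g t)) (fun w => e (h w)) ↔ IsFourierL2 J g h := by
  refine and_congr memLp_comp_iff ?_
  have h1 : ∀ T : ℝ, (fun w => e (h w)) - ft ((Set.Icc (-T) T).indicator fun t => e (g t)) =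
      fun w => e ((h - fourierInt J ((Set.Icc (-T) T).indicator g)) w) := fun T => by
    funext w
    have : ((Set.Icc (-T) T).indicator fun t => e (g t)) =
        fun t => e ((Set.Icc (-T) T).indicator g t) :=
      Set.indicator_comp_of_zero (map_zero e)
    rw [Pi.sub_apply, this, ft_comp he, Pi.sub_apply, map_sub]
  simp_rw [h1]
  constructor <;> intro hT
  · have := ENNReal.Tendsto.const_mul (a := (‖(e.symm : E →L[ℝ] Cl n)‖₊ : ℝ≥0∞)) hT
      (Or.inr ENNReal.coe_ne_top)
    rw [mul_zero] at this
    refine tendsto_of_tendsto_of_tendsto_of_le_of_le tendsto_const_nhds this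
      (fun _ => zero_le) fun T => ?_
    refine eLpNorm_le_nnreal_smul_eLpNorm_of_ae_le_mul (.of_forall fun w => ?_) _
    have hw := (e.symm : E →L[ℝ] Cl n).le_opNNNorm
      (e ((h - fourierInt J ((Set.Icc (-T) T).indicator g)) w))
    rwa [ContinuousLinearEquiv.coe_coe, e.symm_apply_apply] at hw
  · have := ENNReal.Tendsto.const_mul (a := (‖(e : Cl n →L[ℝ] E)‖₊ : ℝ≥0∞)) hT
      (Or.inr ENNReal.coe_ne_top)
    rw [mul_zero] at this
    refine tendsto_of_tendsto_of_tendsto_of_le_of_le tendsto_const_nhds this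
      (fun _ => zero_le) fun T => ?_
    exact eLpNorm_le_nnreal_smul_eLpNorm_of_ae_le_mul
      (.of_forall fun w => (e : Cl n →L[ℝ] E).le_opNNNorm _) _

theorem isFT_comp_iff
    (he : ∀ (z : ℂ) (a : Cl n), e (sliceEmb J z * a) = z • e a) {g h : ℝ → Cl n} :
    IsFT (fun t => e (g t)) (fun w => e (h w)) ↔ IsFourier J g h := by
  have key : ∀ g₁ g₂ h₂ : ℝ → Cl n,
      (MemLp (fun t => e (g₁ t)) 1 ∧ MemLp (fun t => e (g₂ t)) 2 ∧
        (fun t => e (g t)) =ᵐ[volume] (fun t => e (g₁ t)) + (fun t => e (g₂ t)) ∧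
        IsFTL2 (fun t => e (g₂ t)) (fun t => e (h₂ t)) ∧
        (fun t => e (h t)) =ᵐ[volume] ft (fun t => e (g₁ t)) + fun t => e (h₂ t)) ↔
      (MemLp g₁ 1 ∧ MemLp g₂ 2 ∧ g =ᵐ[volume] g₁ + g₂ ∧
        IsFourierL2 J g₂ h₂ ∧ h =ᵐ[volume] fourierInt J g₁ + h₂) := fun g₁ g₂ h₂ => by
    refine and_congr memLp_comp_iff (and_congr memLp_comp_iff (and_congr
      (eventually_congr (.of_forall fun t => ?_)) (and_congr (isFTL2_comp_iff he)
      (eventually_congr (.of_forall fun t => ?_)))))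
    · rw [Pi.add_apply, Pi.add_apply, ← map_add, e.injective.eq_iff]
    · rw [Pi.add_apply, Pi.add_apply, ft_comp he, ← map_add, e.injective.eq_iff]
  constructor
  · rintro ⟨g₁, g₂, h₂, H⟩
    refine ⟨fun t => e.symm (g₁ t), fun t => e.symm (g₂ t), fun t => e.symm (h₂ t),
      (key _ _ _).1 ?_⟩
    simpa only [ContinuousLinearEquiv.apply_symm_apply] using H
  · rintro ⟨g₁, g₂, h₂, H⟩
    exact ⟨_, _, _, (key _ _ _).2 H⟩

end Transfer

theorem essSupport_subset_Iic {n : ℕ} {h : ℝ → Cl n}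
    (hh : ∀ᵐ w : ℝ, w ∈ Set.Ioi (0 : ℝ) → h w = 0) : essSupport h ⊆ Set.Iic 0 := by
  rw [essSupport, Set.compl_subset_comm, Set.compl_Iic]
  exact Set.subset_sUnion_of_mem ⟨isOpen_Ioi, hh⟩

end SliceMonogenic

open SliceMonogenic

/-- Boundary limits and transforms are determined only almost everywhere, so the conclusions are
stated for every representative, and existence is asserted separately. -/
theorem mainTheorem1 (n : ℕ) (p : ℝ) (hp₁ : 1 ≤ p) (hp₂ : p ≤ 2)
    (f : Paravector n → Cl n) (hf : MemSliceHardy p f) (J : ImagUnit n) :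
    (∃ g : ℝ → Cl n, IsBoundaryLimit f J g) ∧
    ∀ g : ℝ → Cl n, IsBoundaryLimit f J g →
      MemLp g (ENNReal.ofReal p) ∧
      (∃ h : ℝ → Cl n, IsFourier J g h) ∧
      ∀ h : ℝ → Cl n, IsFourier J g h →
        essSupport h ⊆ Set.Iic 0 ∧
        ∀ u v : ℝ, 0 < u →
          IntegrableOn
            (fun w : ℝ => sliceEmb J (Complex.exp ((u + Complex.I * v) * w)) * h w) (Set.Iic 0) ∧
          f (slicePoint J u v) = (√(2 * Real.pi))⁻¹ •
            ∫ w in Set.Iic (0 : ℝ), sliceEmb J (Complex.exp ((u + Complex.I * v) * w)) * h w := by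
  obtain ⟨m, e, he⟩ := exists_sliceEquiv J
  have hF : MemHardy p (sliceFun e J f) := memHardy_sliceFun he hp₁ hf
  constructor
  · obtain ⟨G, hG⟩ := hF.exists_boundary hp₁ hp₂
    refine ⟨fun t => e.symm (G t), hG.mono fun t ht => ?_⟩
    rw [hasNonTangentialLimit_iff (e := e), e.apply_symm_apply]
    exact ht
  intro g hg
  have hx : ∀ k : ℕ, (0 : ℝ) < 1 / ((k : ℝ) + 1) := fun k => Nat.one_div_pos_of_nat
  -- A cone contains its axis, so any non-tangential limit is the limit along the abscissas `1 / (k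
  -- + 1)`, and hence the limit in `L^p`.
  have hgL : IsLpBoundary p (sliceFun e J f) fun t => e (g t) := by
    refine hF.tendsto_eLpNorm hp₁ hp₂ hx tendsto_inv_nat_add_one ?_
    filter_upwards [hg] with t ht
    exact tendsto_cone_radial hx tendsto_inv_nat_add_one one_pos
      (hasNonTangentialLimit_iff.1 ht 1 one_pos)
  refine ⟨memLp_comp_iff.1 hgL.1, ?_, fun h hgh => ?_⟩
  · obtain ⟨H, hH⟩ := exists_isFT hp₁ hp₂ hgL.1
    refine ⟨fun w => e.symm (H w), (isFT_comp_iff he).1 ?_⟩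
    simpa only [ContinuousLinearEquiv.apply_symm_apply] using hH
  have hft : IsFT (fun t => e (g t)) fun w => e (h w) := (isFT_comp_iff he).2 hgh
  refine ⟨essSupport_subset_Iic ?_, fun u v hu => ?_⟩
  · filter_upwards [hF.isFT_eq_zero hp₁ hp₂ hgL hft] with w hw hw0
    exact (map_eq_zero_iff e e.injective).1 (hw hw0)
  obtain ⟨h1, h2⟩ := hF.eq_integral_isFT hp₁ hp₂ hgL hft hu v
  simp_rw [← he, mul_comm (v : ℂ) Complex.I] at h1 h2
  refine ⟨(e.integrable_comp_iff).1 h1, e.injective ?_⟩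
  rw [e.integral_comp_comm, ← Complex.ofReal_inv, Complex.coe_smul, ← map_smul] at h2
  rw [← h2, mul_comm Complex.I, sliceFun_add_mul_I]
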